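/- Let $k$ be a field of characteristic $0$. For a graded vector space $W$ write $W[m]_i=W_{i+m}$; all signs follow the Koszul rule, and $|a|$ denotes the degree of $a$. A *pre-Lie$^2$ algebra* is a $\mathbb Z$-graded $k$-vector space $V$ with bilinear operations $a\circ b$ (of degree $0$) and $[a\bullet b]$ (of degree $1$), such that $a\otimes b\mapsto(-1)^{|b|}[a\bullet b]$ is graded symmetric and, for all homogeneous $a,b,c$, 1. $(a\circ b)\circ c-a\circ(b\circ c)-(-1)^{|b||c|}(a\circ c)\circ b+(-1)^{|b||c|}a\circ(c\circ b)=0$; 2. $[[a\bullet b]\bullet c]=[a\bullet[b\bullet c]]+(-1)^{|b||a|+|b|+|a|}[b\bullet[a\bullet c]]$; 3. $[a\bullet b]\circ c+(-1)^{|b|}a\circ[b\bullet c]+(-1)^{|b||a|+|b|}b\circ[a\bullet c]=(-1)^{|b||c|+|c|}[(a\circ c)\bullet b]+(-1)^{(|a|+1)(|b|+|c|)+|a|}[(b\circ c)\bullet a]$. *The operadic complex.* Let $\mathcal P=Free(E)/\langle R\rangle$ be the quadratic operad of pre-Lie$^2$ algebras. Its generators are $E=E(2)=k[S_2][0]\oplus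 \mathbf 1_2[-1]$, namely $\circ$, its opposite, and the symmetric operation $(-1)^{|a|}[a\bullet b]$ of degree $1$; $R$ is the $S_3$-submodule of $Free(E)(3)$ given by the identities 1–3. Let $\mathcal P^!=Free(E^*\otimes \mathrm{sgn}_2)/\langle R^\perp\rangle$ be its Koszul dual. The operadic homology complex of $V$ is $$C_{\mathcal P}V=\bigoplus_{n\ge1}C^n_{\mathcal P}(V),\qquad C^n_{\mathcal P}(V)=\mathcal P^!(n)^*\otimes_{S_n}V[1]^{\otimes n},$$ with the differential $d_{\mathcal P}:C^{n+1}_{\mathcal P}(V)\to C^{n}_{\mathcal P}(V)$ which is the sum over all pairs of inputs of the following operation: apply the map $\mathcal P^!(n+1)^*\to\mathcal P^!(n)^*\otimes\mathcal P^!(2)^*$ dual to the partial composition that joins this pair, and then apply to the two elements of $V[1]$ in question the operation on $V[1]$ that the factor in $\mathcal P^!(2)^*\cong E(2)\otimes \mathrm{sgn}_2$ induces through the algebra structure of $V$. *The Chevalley–Eilenberg quotient.* Write elements of $V\oplus V[-1]$ as $a+\Pi b$, with $\Pi$ a symbol of degree $1$. It is a graded Lie algebra with the graded antisymmetric bracket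 $$[a,b]=a\circ b-(-1)^{|a||b|}b\circ a,\qquad[\Pi a,b]=-(-1)^{|a|}[a\bullet b]+\Pi(a\circ b),\qquad[\Pi a,\Pi b]=\Pi[a\bullet b],$$ and $V$ is a Lie subalgebra. Let $d_{CE}$ be the Chevalley–Eilenberg differential of this graded Lie algebra (that is, the part given by the bracket, without the internal differential $a+\Pi b\mapsto\Pi a$) on $\odot^\bullet((V\oplus V[-1])[1])$, and let $$J^n=\odot^n\big((V\oplus V[-1])[1]\big)\big/\odot^n(V[1]),$$ with the induced differential $d:J^{n+1}\to J^{n}$, be the quotient by the image of the Chevalley–Eilenberg complex of $V$. **Proposition.** For every pre-Lie$^2$ algebra $V$ the maps $d_{CE}$, $d$ and $d_{\mathcal P}$ square to zero, and the quotient complex $(J^\bullet,d)$ is isomorphic to the operadic complex $(C_{\mathcal P}V,d_{\mathcal P})$: there are linear isomorphisms $\Phi_n:J^n\to C^n_{\mathcal P}(V)$, $n\ge0$ (both sides being $0$ for $n=0$), with $\Phi_{n}\circ d=d_{\mathcal P}\circ\Phi_{n+1}$ for $n\ge 1$. Moreover $\Phi_n$ maps the part of internal degree $m$ of $J^n$ onto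 the part of internal degree $m-1$ of $C^n_{\mathcal P}(V)$, for all $m$. -/

import Mathlib

noncomputable section

namespace PreLieTwo

open scoped TensorProduct

universe u v w x

/-! ## Graded vector spaces -/

section Gradings

variable {k : Type u} [Field k] {W : Type v} [AddCommGroup W] [Module k W]

/-- A `ℤ`-grading of the vector space `W`: subspaces `deg i` (the homogeneous elements of
degree `i`) of which `W` is the internal direct sum. -/
structure Grading (k : Type u) [Field k] (W : Type v) [AddCommGroup W] [Module k W] where
  deg : ℤ → Submodule k W
  isInternal : DirectSum.IsInternal deg

namespace Grading

/-- The projection of `W` onto the part of parity `p`. -/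
def proj (𝒲 : Grading k W) (p : ZMod 2) : W →ₗ[k] W :=
  DirectSum.toModule k ℤ W
      (fun i => if (i : ZMod 2) = p then (𝒲.deg i).subtype else 0) ∘ₗ
    (LinearEquiv.ofBijective (DirectSum.coeLinearMap 𝒲.deg) 𝒲.isInternal).symm.toLinearMap

/-- The grading involution `a ↦ (-1)^{|a|} a`. -/
def sign (𝒲 : Grading k W) : W →ₗ[k] W := 𝒲.proj 0 - 𝒲.proj 1

theorem proj_of_mem (𝒲 : Grading k W) (p : ZMod 2) {i : ℤ} {w : W} (hw : w ∈ 𝒲.deg i) :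
    𝒲.proj p w = if (i : ZMod 2) = p then w else 0 := by
  have h : (LinearEquiv.ofBijective (DirectSum.coeLinearMap 𝒲.deg) 𝒲.isInternal).symm w =
      DirectSum.lof k ℤ (fun i => 𝒲.deg i) i ⟨w, hw⟩ := by
    rw [LinearEquiv.symm_apply_eq]
    exact (DirectSum.coeLinearMap_lof 𝒲.deg i ⟨w, hw⟩).symm
  rw [proj, LinearMap.comp_apply, LinearEquiv.coe_coe, h, DirectSum.toModule_lof]
  split_ifs <;> simp

theorem hom_ext (𝒲 : Grading k W) {X : Type w} [AddCommGroup X] [Module k X]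
    {f g : W →ₗ[k] X} (h : ∀ i, ∀ w ∈ 𝒲.deg i, f w = g w) : f = g := by
  have hs : ⨆ i, 𝒲.deg i = ⊤ :=
    ((DirectSum.isInternal_submodule_iff_iSupIndep_and_iSup_eq_top _).1 𝒲.isInternal).2
  have hle : ⨆ i, 𝒲.deg i ≤ LinearMap.eqLocus f g := iSup_le fun i w hw => h i w hw
  ext w
  exact hle (hs ▸ Submodule.mem_top)

theorem proj_proj (𝒲 : Grading k W) (p q : ZMod 2) (x : W) :
    𝒲.proj p (𝒲.proj q x) = if p = q then 𝒲.proj q x else 0 := by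
  have : 𝒲.proj p ∘ₗ 𝒲.proj q = if p = q then 𝒲.proj q else 0 := by
    refine 𝒲.hom_ext fun i w hw => ?_
    rw [LinearMap.comp_apply, 𝒲.proj_of_mem q hw]
    by_cases h : (i : ZMod 2) = q <;> by_cases h' : p = q <;>
      simp_all [𝒲.proj_of_mem _ hw, eq_comm]
  rw [← LinearMap.comp_apply, this]
  split_ifs <;> simp

theorem sum_proj (𝒲 : Grading k W) (x : W) : ∑ p, 𝒲.proj p x = x := by
  have : ∑ p, 𝒲.proj p = LinearMap.id := by
    refine 𝒲.hom_ext fun i w hw => ?_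
    simp [LinearMap.sum_apply, 𝒲.proj_of_mem _ hw]
  conv_rhs => rw [← LinearMap.id_apply (R := k) x, ← this]
  simp

/-- The shifted graded vector space `W[m]`, with `W[m]_i = W_{i+m}`. -/
def shift (𝒲 : Grading k W) (m : ℤ) : Grading k W where
  deg i := 𝒲.deg (i + m)
  isInternal := by
    have h := (DirectSum.isInternal_submodule_iff_iSupIndep_and_iSup_eq_top _).1 𝒲.isInternal
    refine (DirectSum.isInternal_submodule_iff_iSupIndep_and_iSup_eq_top _).2 ⟨?_, ?_⟩
    · exact h.1.comp (add_left_injective m)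
    · rw [← h.2]
      exact (Equiv.addRight m).iSup_comp (g := 𝒲.deg)

/-- The direct sum of two graded vector spaces. -/
def prod {X : Type w} [AddCommGroup X] [Module k X] (𝒲 : Grading k W) (𝒳 : Grading k X) :
    Grading k (W × X) where
  deg i := (𝒲.deg i).prod (𝒳.deg i)
  isInternal := by
    have h := (DirectSum.isInternal_submodule_iff_iSupIndep_and_iSup_eq_top _).1 𝒲.isInternal
    have h' := (DirectSum.isInternal_submodule_iff_iSupIndep_and_iSup_eq_top _).1 𝒳.isInternal
    refine (DirectSum.isInternal_submodule_iff_iSupIndep_and_iSup_eq_top _).2 ⟨?_, ?_⟩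
    · intro i
      have key : ⨆ j, ⨆ (_ : j ≠ i), (𝒲.deg j).prod (𝒳.deg j) ≤
          (⨆ j, ⨆ (_ : j ≠ i), 𝒲.deg j).prod (⨆ j, ⨆ (_ : j ≠ i), 𝒳.deg j) :=
        iSup₂_le fun j hj => Submodule.prod_mono
          (le_iSup₂ (f := fun j (_ : j ≠ i) => 𝒲.deg j) j hj)
          (le_iSup₂ (f := fun j (_ : j ≠ i) => 𝒳.deg j) j hj)
      refine Disjoint.mono_right key ?_
      rw [disjoint_iff, Submodule.prod_inf_prod, (h.1 i).eq_bot, (h'.1 i).eq_bot,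
        Submodule.prod_bot]
    · rw [eq_top_iff]
      rintro ⟨a, b⟩ -
      have ha : (⨆ i, 𝒲.deg i) ≤
          (⨆ i, (𝒲.deg i).prod (𝒳.deg i)).comap (LinearMap.inl k W X) :=
        iSup_le fun i w hw => Submodule.mem_iSup_of_mem i ⟨hw, zero_mem _⟩
      have hb : (⨆ i, 𝒳.deg i) ≤
          (⨆ i, (𝒲.deg i).prod (𝒳.deg i)).comap (LinearMap.inr k W X) :=
        iSup_le fun i w hw => Submodule.mem_iSup_of_mem i ⟨zero_mem _, hw⟩
      have ha' : a ∈ ⨆ i, 𝒲.deg i := by rw [h.2]; exact Submodule.mem_top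
      have hb' : b ∈ ⨆ i, 𝒳.deg i := by rw [h'.2]; exact Submodule.mem_top
      have ha'' := ha ha'
      have hb'' := hb hb'
      rw [Submodule.mem_comap] at ha'' hb''
      simpa using add_mem ha'' hb''

/-- The bilinear map `(a, b) ↦ (-1)^{|a||b|} f (b, a)`. -/
def flip {X : Type w} [AddCommGroup X] [Module k X] (𝒲 : Grading k W)
    (f : W →ₗ[k] W →ₗ[k] X) : W →ₗ[k] W →ₗ[k] X :=
  f.flip.compl₁₂ (𝒲.proj 0) LinearMap.id + f.flip.compl₁₂ (𝒲.proj 1) 𝒲.sign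

end Grading

end Gradings

/-! ## The symmetric group acting on tensor powers of a graded vector space -/

section Koszul

/-- The Koszul sign of the permutation that moves the `i`-th of `n` homogeneous factors, of
parity `ε i`, to the position `σ i`. -/
def koszulSign {n : ℕ} (σ : Equiv.Perm (Fin n)) (ε : Fin n → ZMod 2) : ℤˣ :=
  ∏ i, ∏ j, if i < j ∧ σ j < σ i ∧ ε i = 1 ∧ ε j = 1 then -1 else 1

theorem koszulSign_one {n : ℕ} (ε : Fin n → ZMod 2) : koszulSign 1 ε = 1 := by
  refine Finset.prod_eq_one fun i _ => Finset.prod_eq_one fun j _ => if_neg ?_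
  rintro ⟨h, h', -⟩
  exact absurd h (not_lt.2 h'.le)

theorem prod_pairs {n : ℕ} (f : Fin n → Fin n → ℤˣ) (hf : ∀ i j, f i j = f j i)
    (τ : Equiv.Perm (Fin n)) :
    (∏ i, ∏ j, if i < j then f (τ i) (τ j) else 1) = ∏ i, ∏ j, if i < j then f i j else 1 := by
  have h : (∏ i, ∏ j, if τ i < τ j then f (τ i) (τ j) else 1) =
      ∏ i, ∏ j, if i < j then f i j else 1 := by
    rw [← Equiv.prod_comp τ (fun i => ∏ j, if i < j then f i j else 1)]
    exact Finset.prod_congr rfl fun i _ =>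
      Equiv.prod_comp τ (fun j => if τ i < j then f (τ i) j else 1)
  rw [← h]
  have split : ∀ F : Fin n → Fin n → ℤˣ, (∀ i, F i i = 1) →
      ∏ i, ∏ j, F i j = ∏ i, ∏ j, if i < j then F i j * F j i else 1 := by
    intro F hF
    have h1 : ∀ i j, F i j = (if i < j then F i j else 1) * (if j < i then F i j else 1) := by
      intro i j
      rcases lt_trichotomy i j with h | h | h
      · simp [h, h.le]
      · subst h; simp [hF]
      · simp [h, h.le]
    have h2 : ∏ i, ∏ j, F i j = (∏ i, ∏ j, if i < j then F i j else 1) *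
        ∏ i, ∏ j, if j < i then F i j else 1 := by
      rw [← Finset.prod_mul_distrib]
      refine Finset.prod_congr rfl fun i _ => ?_
      rw [← Finset.prod_mul_distrib]
      exact Finset.prod_congr rfl fun j _ => h1 i j
    rw [h2, Finset.prod_comm (f := fun i j => if j < i then F i j else 1),
      ← Finset.prod_mul_distrib]
    refine Finset.prod_congr rfl fun i _ => ?_
    rw [← Finset.prod_mul_distrib]
    refine Finset.prod_congr rfl fun j _ => ?_
    split_ifs <;> simp
  rw [split (fun i j => if i < j then f (τ i) (τ j) else 1) (by simp),
    split (fun i j => if τ i < τ j then f (τ i) (τ j) else 1) (by simp)]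
  refine Finset.prod_congr rfl fun i _ => Finset.prod_congr rfl fun j _ => ?_
  by_cases hij : i < j
  · have hne : τ i ≠ τ j := fun h => hij.ne (τ.injective h)
    rcases lt_or_gt_of_ne hne with h | h
    · simp [hij, not_lt.2 hij.le, h, not_lt.2 h.le]
    · simp [hij, not_lt.2 hij.le, h, not_lt.2 h.le, hf (τ j) (τ i)]
  · simp [hij]

theorem koszulSign_mul {n : ℕ} (σ τ : Equiv.Perm (Fin n)) (ε : Fin n → ZMod 2) :
    koszulSign (σ * τ) ε = koszulSign σ (fun j => ε (τ.symm j)) * koszulSign τ ε := by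
  let f : Fin n → Fin n → ℤˣ := fun i j =>
    if ((i < j ∧ σ j < σ i) ∨ (j < i ∧ σ i < σ j)) ∧ ε (τ.symm i) = 1 ∧ ε (τ.symm j) = 1
      then -1 else 1
  have hf : ∀ i j, f i j = f j i := by
    intro i j
    simp only [f]
    refine if_congr ?_ rfl rfl
    tauto
  have h1 : koszulSign σ (fun j => ε (τ.symm j)) =
      ∏ i, ∏ j, if i < j then f i j else 1 := by
    refine Finset.prod_congr rfl fun i _ => Finset.prod_congr rfl fun j _ => ?_
    simp only [f]
    by_cases hij : i < j
    · simp [hij, not_lt.2 hij.le]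
    · simp [hij]
  rw [h1, ← prod_pairs f hf τ, koszulSign, koszulSign, ← Finset.prod_mul_distrib]
  refine Finset.prod_congr rfl fun i _ => ?_
  rw [← Finset.prod_mul_distrib]
  refine Finset.prod_congr rfl fun j _ => ?_
  simp only [f, Equiv.symm_apply_apply, Equiv.Perm.mul_apply]
  by_cases hij : i < j
  · have hne : τ i ≠ τ j := fun h => hij.ne (τ.injective h)
    have hne' : σ (τ i) ≠ σ (τ j) := fun h => hne (σ.injective h)
    by_cases he : ε i = 1 ∧ ε j = 1
    · rcases lt_or_gt_of_ne hne with h | h <;> rcases lt_or_gt_of_ne hne' with h' | h' <;>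
        simp [hij, h, h', not_lt.2 h.le, not_lt.2 h'.le, he.1, he.2]
    · have he' : ∀ P : Prop, ¬ (P ∧ ε i = 1 ∧ ε j = 1) := fun P h => he h.2
      simp [hij, he]
  · simp [hij]

variable {k : Type u} [Field k] {W : Type v} [AddCommGroup W] [Module k W]

/-- The action of a permutation on `W^{⊗ n}` with Koszul signs:
`w₁ ⊗ ⋯ ⊗ wₙ`, with `wᵢ` homogeneous, goes to the tensor that has `wᵢ` in position `σ i`,
multiplied by the Koszul sign. -/
def koszulAct (𝒲 : Grading k W) (n : ℕ) (σ : Equiv.Perm (Fin n)) :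
    (⨂[k] _ : Fin n, W) →ₗ[k] (⨂[k] _ : Fin n, W) :=
  ∑ ε : Fin n → ZMod 2, (((koszulSign σ ε : ℤˣ) : ℤ) : k) •
    ((PiTensorProduct.reindex k (fun _ : Fin n => W) σ).toLinearMap ∘ₗ
      PiTensorProduct.map (fun i => 𝒲.proj (ε i)))

theorem koszulAct_tprod (𝒲 : Grading k W) {n : ℕ} (σ : Equiv.Perm (Fin n)) (ε : Fin n → ZMod 2)
    (w : Fin n → W) :
    koszulAct 𝒲 n σ (PiTensorProduct.tprod k fun i => 𝒲.proj (ε i) (w i)) =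
      (((koszulSign σ ε : ℤˣ) : ℤ) : k) •
        PiTensorProduct.tprod k fun i => 𝒲.proj (ε (σ.symm i)) (w (σ.symm i)) := by
  rw [koszulAct, LinearMap.sum_apply, Finset.sum_eq_single ε]
  · simp [PiTensorProduct.map_tprod, PiTensorProduct.reindex_tprod, Grading.proj_proj]
  · intro δ _ hδ
    obtain ⟨i, hi⟩ := Function.ne_iff.1 hδ
    have : (PiTensorProduct.tprod k fun i => 𝒲.proj (δ i) (𝒲.proj (ε i) (w i))) = 0 :=
      MultilinearMap.map_coord_zero _ i (by simp [Grading.proj_proj, hi])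
    simp [PiTensorProduct.map_tprod, this]
  · simp

theorem koszul_ext (𝒲 : Grading k W) {n : ℕ} {X : Type w} [AddCommGroup X] [Module k X]
    {f g : (⨂[k] _ : Fin n, W) →ₗ[k] X}
    (h : ∀ (ε : Fin n → ZMod 2) (w : Fin n → W),
      f (PiTensorProduct.tprod k fun i => 𝒲.proj (ε i) (w i)) =
        g (PiTensorProduct.tprod k fun i => 𝒲.proj (ε i) (w i))) : f = g := by
  refine PiTensorProduct.ext (MultilinearMap.ext fun w => ?_)
  have hw : PiTensorProduct.tprod k w =
      ∑ ε : Fin n → ZMod 2, PiTensorProduct.tprod k fun i => 𝒲.proj (ε i) (w i) := by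
    rw [← MultilinearMap.map_sum (PiTensorProduct.tprod k) (fun i p => 𝒲.proj p (w i))]
    simp [Grading.sum_proj]
  simp only [LinearMap.compMultilinearMap_apply, hw, map_sum, h]

/-- The representation of the symmetric group on `W^{⊗ n}` with Koszul signs. -/
def koszulRep (𝒲 : Grading k W) (n : ℕ) :
    Representation k (Equiv.Perm (Fin n)) (⨂[k] _ : Fin n, W) where
  toFun := koszulAct 𝒲 n
  map_one' := by
    refine koszul_ext 𝒲 fun ε w => ?_
    rw [koszulAct_tprod, koszulSign_one]
    simp only [Units.val_one, Int.cast_one, one_smul]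
    rfl
  map_mul' σ τ := by
    refine koszul_ext 𝒲 fun ε w => ?_
    rw [Module.End.mul_apply, koszulAct_tprod, koszulAct_tprod, map_smul,
      koszulAct_tprod 𝒲 σ (fun i => ε (τ.symm i)) (fun i => w (τ.symm i)), koszulSign_mul,
      smul_smul, mul_comm (koszulSign σ _), Units.val_mul, Int.cast_mul]
    rfl

/-- The linear map on coinvariants induced by the invariant map `x ↦ ∑_σ f (σ x)`. -/
def symmetrized {n : ℕ} {X : Type x} [AddCommGroup X] [Module k X]
    (ρ : Representation k (Equiv.Perm (Fin n)) X) {Y : Type w} [AddCommGroup Y] [Module k Y]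
    (f : X →ₗ[k] Y) : ρ.Coinvariants →ₗ[k] Y :=
  Representation.Coinvariants.lift ρ (∑ σ, f ∘ₗ ρ σ) fun τ => by
    have hsum : (∑ σ, f ∘ₗ ρ σ) ∘ₗ ρ τ = ∑ σ, (f ∘ₗ ρ σ) ∘ₗ ρ τ := by
      ext x
      simp [LinearMap.sum_apply]
    rw [hsum, ← Equiv.sum_comp (Equiv.mulRight τ) (fun σ => f ∘ₗ ρ σ)]
    refine Finset.sum_congr rfl fun σ _ => ?_
    rw [LinearMap.comp_assoc]
    congr 1
    exact (map_mul ρ σ τ).symm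

theorem mergeFirst_zero (m : W →ₗ[k] W →ₗ[k] W) {n : ℕ} (w : Fin (n + 2) → W) (x : W) :
    (Fin.cons (m (Function.update w 0 x 0) (Function.update w 0 x 1))
        fun j => Function.update w 0 x j.succ.succ : Fin (n + 1) → W) =
      Fin.cons (m x (w 1)) fun j => w j.succ.succ := by
  congr 1

theorem mergeFirst_one (m : W →ₗ[k] W →ₗ[k] W) {n : ℕ} (w : Fin (n + 2) → W) (x : W) :
    (Fin.cons (m (Function.update w (Fin.succ 0) x 0) (Function.update w (Fin.succ 0) x 1))
        fun j => Function.update w (Fin.succ 0) x j.succ.succ : Fin (n + 1) → W) =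
      Fin.cons (m (w 0) x) fun j => w j.succ.succ := by
  refine congrArg₂ Fin.cons ?_ ?_
  · congr 1
  · funext j
    exact Function.update_of_ne (fun h => Fin.succ_ne_zero j (Fin.succ_injective _ h)) _ _

theorem mergeFirst_succ (m : W →ₗ[k] W →ₗ[k] W) {n : ℕ} (w : Fin (n + 2) → W) (i : Fin n)
    (x : W) :
    (Fin.cons (m (Function.update w i.succ.succ x 0) (Function.update w i.succ.succ x 1))
        fun j => Function.update w i.succ.succ x j.succ.succ : Fin (n + 1) → W) =
      Function.update (Fin.cons (m (w 0) (w 1)) fun j => w j.succ.succ : Fin (n + 1) → W)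
        i.succ x := by
  funext j
  refine Fin.cases ?_ (fun j => ?_) j
  · rw [Fin.cons_zero, Function.update_of_ne (Fin.succ_ne_zero i).symm, Fin.cons_zero,
      Function.update_of_ne (Fin.succ_ne_zero _).symm, Function.update_of_ne]
    intro h
    have := congrArg Fin.val h
    simp at this
  · by_cases h : j = i
    · subst h
      simp
    · rw [Fin.cons_succ, Function.update_of_ne, Function.update_of_ne, Fin.cons_succ]
      · exact fun h' => h (Fin.succ_injective _ h')
      · exact fun h' => h (Fin.succ_injective _ (Fin.succ_injective _ h'))

theorem tprod_cons_add {n : ℕ} (w : Fin n → W) (x y : W) :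
    PiTensorProduct.tprod k (Fin.cons (x + y) w : Fin (n + 1) → W) =
      PiTensorProduct.tprod k (Fin.cons x w : Fin (n + 1) → W) +
        PiTensorProduct.tprod k (Fin.cons y w : Fin (n + 1) → W) :=
  MultilinearMap.cons_add (PiTensorProduct.tprod k : MultilinearMap k (fun _ : Fin (n + 1) => W) _)
    w x y

theorem tprod_cons_smul {n : ℕ} (w : Fin n → W) (c : k) (x : W) :
    PiTensorProduct.tprod k (Fin.cons (c • x) w : Fin (n + 1) → W) =
      c • PiTensorProduct.tprod k (Fin.cons x w : Fin (n + 1) → W) :=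
  MultilinearMap.cons_smul (PiTensorProduct.tprod k : MultilinearMap k (fun _ : Fin (n + 1) => W) _)
    w c x

/-- The map `w₁ ⊗ w₂ ⊗ w₃ ⊗ ⋯ ↦ m (w₁, w₂) ⊗ w₃ ⊗ ⋯`. -/
def mergeFirst (m : W →ₗ[k] W →ₗ[k] W) (n : ℕ) :
    (⨂[k] _ : Fin (n + 2), W) →ₗ[k] (⨂[k] _ : Fin (n + 1), W) :=
  PiTensorProduct.lift <| MultilinearMap.mk'
    (fun w => PiTensorProduct.tprod k
      (Fin.cons (m (w 0) (w 1)) fun i => w i.succ.succ : Fin (n + 1) → W))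
    (fun w i x y => by
      refine Fin.cases ?_ (fun i => Fin.cases ?_ (fun i => ?_) i) i
      · simp only [mergeFirst_zero, map_add, LinearMap.add_apply, tprod_cons_add]
      · simp only [mergeFirst_one, map_add, tprod_cons_add]
      · simp only [mergeFirst_succ, MultilinearMap.map_update_add])
    (fun w i c x => by
      refine Fin.cases ?_ (fun i => Fin.cases ?_ (fun i => ?_) i) i
      · simp only [mergeFirst_zero, map_smul, LinearMap.smul_apply, tprod_cons_smul]
      · simp only [mergeFirst_one, map_smul, tprod_cons_smul]
      · simp only [mergeFirst_succ, MultilinearMap.map_update_smul])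

theorem mergeFirst_tprod (m : W →ₗ[k] W →ₗ[k] W) (n : ℕ) (w : Fin (n + 2) → W) :
    mergeFirst m n (PiTensorProduct.tprod k w) =
      PiTensorProduct.tprod k
        (Fin.cons (m (w 0) (w 1)) fun i => w i.succ.succ : Fin (n + 1) → W) := by
  rw [mergeFirst, PiTensorProduct.lift.tprod]
  rfl

end Koszul

/-! ## Binary quadratic operads and their Koszul duals -/

section Operads

/-- Planar binary trees with vertices decorated by `O` and leaves labelled by `X`. -/
inductive BTree (O : Type) (X : Type) : Type
  | leaf (x : X) : BTree O X
  | node (g : O) (l r : BTree O X) : BTree O X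

namespace BTree

variable {O X Y : Type}

/-- The labels of the leaves, from left to right. -/
def leaves : BTree O X → List X
  | leaf x => [x]
  | node _ l r => l.leaves ++ r.leaves

/-- Replace every leaf with label `x` by the tree `f x`. -/
def graft (f : X → BTree O Y) : BTree O X → BTree O Y
  | leaf x => f x
  | node g l r => node g (l.graft f) (r.graft f)

/-- Relabel the leaves. -/
def map (f : X → Y) (t : BTree O X) : BTree O Y := t.graft fun x => leaf (f x)

/-- The degree of a tree: the sum of the degrees of the decorations of its vertices. -/
def degree (δ : O → ℤ) : BTree O X → ℤ
  | leaf _ => 0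
  | node g l r => δ g + l.degree δ + r.degree δ

/-- The sum of the degrees of the decorations that stand after the leaf `x` when the tree is
written in prefix notation. -/
def degreeAfter [DecidableEq X] (δ : O → ℤ) (x : X) : BTree O X → ℤ
  | leaf _ => 0
  | node _ l r => if x ∈ l.leaves then l.degreeAfter δ x + r.degree δ else r.degreeAfter δ x

/-- Every label occurs at exactly one leaf. -/
def IsMultilinear (t : BTree O X) : Prop := t.leaves.Nodup ∧ ∀ x, x ∈ t.leaves

theorem leaves_graft (f : X → BTree O Y) (t : BTree O X) :
    (t.graft f).leaves = t.leaves.flatMap fun x => (f x).leaves := by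
  induction t with
  | leaf x => simp [graft, leaves]
  | node g l r hl hr => simp [graft, leaves, hl, hr]

theorem leaves_map (f : X → Y) (t : BTree O X) : (t.map f).leaves = t.leaves.map f := by
  rw [map, leaves_graft]
  simp only [leaves]
  induction t.leaves with
  | nil => rfl
  | cons a l h => simp [h]

theorem degree_graft (δ : O → ℤ) (f : X → BTree O Y) (t : BTree O X) :
    (t.graft f).degree δ = t.degree δ + (t.leaves.map fun x => (f x).degree δ).sum := by
  induction t with
  | leaf x => simp [graft, leaves, degree]
  | node g l r hl hr => simp [graft, leaves, degree, hl, hr]; ring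

theorem degree_map (δ : O → ℤ) (f : X → Y) (t : BTree O X) :
    (t.map f).degree δ = t.degree δ := by
  rw [map, degree_graft]
  simp [degree]

theorem map_id (t : BTree O X) : t.map id = t := by
  induction t with
  | leaf x => rfl
  | node g l r hl hr => simp_all [map, graft]

theorem map_map {Z : Type} (f : X → Y) (h : Y → Z) (t : BTree O X) :
    (t.map f).map h = t.map (h ∘ f) := by
  induction t with
  | leaf x => rfl
  | node g l r hl hr => simp_all [map, graft]

end BTree

/-- Planar decorated trees with `n` leaves that are labelled bijectively by `Fin n`. -/
def LTree (O : Type) (n : ℕ) : Type := {t : BTree O (Fin n) // t.IsMultilinear}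

namespace LTree

variable {O : Type}

/-- Relabelling by a permutation: the leaf `i` becomes the leaf `σ i`. -/
def perm {n : ℕ} (σ : Equiv.Perm (Fin n)) (t : LTree O n) : LTree O n :=
  ⟨t.1.map σ, by
    refine ⟨?_, fun x => ?_⟩
    · rw [BTree.leaves_map]
      exact t.2.1.map σ.injective
    · rw [BTree.leaves_map, List.mem_map]
      exact ⟨σ.symm x, t.2.2 _, σ.apply_symm_apply x⟩⟩

/-- The new name of the leaf `j ≠ i` of `t` in the composition of `t` and `s` at `i`, where `s`
has `m` leaves. -/
def outerLabel {n : ℕ} (m : ℕ) (i j : Fin (n + 1)) (h : j ≠ i) : Fin (n + m) :=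
  if hj : j < i then ⟨j, by have := i.2; have : (j : ℕ) < i := hj; omega⟩
  else ⟨j - 1 + m, by
    have := j.2
    have h1 : ¬ (j : ℕ) < i := hj
    have h2 : (j : ℕ) ≠ i := fun h' => h (Fin.ext h')
    omega⟩

/-- The new name of the leaf `l` of `s` in the composition of `t` and `s` at `i`. -/
def innerLabel {n m : ℕ} (i : Fin (n + 1)) (l : Fin m) : Fin (n + m) :=
  ⟨i + l, by have := i.2; have := l.2; omega⟩

/-- What is put at the leaf `j` of `t` in the composition of `t` and `s` at `i`. -/
def compAt {n m : ℕ} (i : Fin (n + 1)) (s : BTree O (Fin m)) (j : Fin (n + 1)) :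
    BTree O (Fin (n + m)) :=
  if h : j = i then s.map (innerLabel i) else BTree.leaf (outerLabel m i j h)

theorem mem_compAt {n m : ℕ} (i : Fin (n + 1)) (s : LTree O m) (j : Fin (n + 1))
    (x : Fin (n + m)) : x ∈ (compAt i s.1 j).leaves ↔
      (j = i ∧ (i : ℕ) ≤ x ∧ (x : ℕ) < i + m) ∨ ((j : ℕ) < i ∧ (x : ℕ) = j) ∨
        ((i : ℕ) < j ∧ (x : ℕ) + 1 = j + m) := by
  unfold compAt
  split_ifs with h
  · subst h
    rw [BTree.leaves_map, List.mem_map]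
    constructor
    · rintro ⟨l, -, rfl⟩
      exact Or.inl ⟨rfl, by simp [innerLabel], by simp [innerLabel]⟩
    · rintro (⟨-, h1, h2⟩ | h1 | h1)
      · exact ⟨⟨x - j, by omega⟩, s.2.2 _, Fin.ext (by simp [innerLabel]; omega)⟩
      · omega
      · omega
  · have hne : (j : ℕ) ≠ i := fun h' => h (Fin.ext h')
    simp only [BTree.leaves, List.mem_singleton, h, false_and, false_or]
    rw [Fin.ext_iff]
    unfold outerLabel
    split_ifs with hj
    · have hj' : (j : ℕ) < i := hj
      simp only
      omega
    · have hj' : ¬ (j : ℕ) < i := hj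
      simp only
      omega

/-- The partial composition of trees: the root of `s` is glued to the leaf `i` of `t`. -/
def comp {n m : ℕ} (i : Fin (n + 1)) (t : LTree O (n + 1)) (s : LTree O m) : LTree O (n + m) :=
  ⟨t.1.graft (compAt i s.1), by
    refine ⟨?_, fun x => ?_⟩
    · rw [BTree.leaves_graft, List.nodup_flatMap]
      refine ⟨fun j _ => ?_, ?_⟩
      · unfold compAt
        split_ifs
        · rw [BTree.leaves_map]
          refine s.2.1.map fun a b hab => ?_
          have := congrArg Fin.val hab
          simp only [innerLabel] at this
          exact Fin.ext (by omega)
        · simp [BTree.leaves]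
      · refine t.2.1.imp fun {a b} hab => ?_
        have hab' : (a : ℕ) ≠ b := fun h' => hab (Fin.ext h')
        intro x ha hb
        rw [mem_compAt] at ha hb
        have e1 : a = i ↔ (a : ℕ) = i := Fin.ext_iff
        have e2 : b = i ↔ (b : ℕ) = i := Fin.ext_iff
        rw [e1] at ha
        rw [e2] at hb
        omega
    · rw [BTree.leaves_graft, List.mem_flatMap]
      have hx := x.2
      have hi := i.2
      by_cases h1 : (x : ℕ) < i
      · exact ⟨⟨x, by omega⟩, t.2.2 _, (mem_compAt _ _ _ _).2 (by simp [h1])⟩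
      · by_cases h2 : (x : ℕ) < i + m
        · exact ⟨i, t.2.2 _, (mem_compAt _ _ _ _).2 (Or.inl ⟨rfl, by omega, h2⟩)⟩
        · refine ⟨⟨x + 1 - m, by omega⟩, t.2.2 _, (mem_compAt _ _ _ _).2 (Or.inr (Or.inr ?_))⟩
          simp only
          omega⟩

/-- The degree of a tree. -/
def degree (δ : O → ℤ) {n : ℕ} (t : LTree O n) : ℤ := t.1.degree δ

theorem degree_comp (δ : O → ℤ) {n m : ℕ} (i : Fin (n + 1)) (t : LTree O (n + 1))
    (s : LTree O m) : (comp i t s).degree δ = t.degree δ + s.degree δ := by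
  simp only [degree, comp, BTree.degree_graft]
  congr 1
  rw [List.sum_map_eq_nsmul_single i]
  · rw [List.count_eq_one_of_mem t.2.1 (t.2.2 i)]
    simp [compAt, BTree.degree_map]
  · intro j hj _
    simp [compAt, hj, BTree.degree]

theorem degree_perm (δ : O → ℤ) {n : ℕ} (σ : Equiv.Perm (Fin n)) (t : LTree O n) :
    (t.perm σ).degree δ = t.degree δ :=
  BTree.degree_map δ σ t.1

/-- The corolla `g(1, 2)`. -/
def corolla (g : O) : LTree O 2 :=
  ⟨.node g (.leaf 0) (.leaf 1), by simp [BTree.IsMultilinear, BTree.leaves, Fin.forall_fin_two]⟩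

/-- The transposed corolla `g(2, 1)`. -/
def corollaSwap (g : O) : LTree O 2 :=
  ⟨.node g (.leaf 1) (.leaf 0), by simp [BTree.IsMultilinear, BTree.leaves, Fin.forall_fin_two]⟩

/-- The tree `g(h(σ 1, σ 2), σ 3)`. -/
def leftComb (g h : O) (σ : Equiv.Perm (Fin 3)) : LTree O 3 :=
  perm σ ⟨.node g (.node h (.leaf 0) (.leaf 1)) (.leaf 2), by
    simp [BTree.IsMultilinear, BTree.leaves, Fin.forall_fin_succ]⟩

/-- The tree `g(σ 1, h(σ 2, σ 3))`. -/
def rightComb (g h : O) (σ : Equiv.Perm (Fin 3)) : LTree O 3 :=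
  perm σ ⟨.node g (.leaf 0) (.node h (.leaf 1) (.leaf 2)), by
    simp [BTree.IsMultilinear, BTree.leaves, Fin.forall_fin_succ]⟩

end LTree

variable (k : Type u) [Field k] (O : Type)

/-- The span of the planar decorated trees with `n` labelled leaves. The free operad on the
`S₂`-module of generators is its quotient by the symmetry relations of the generators. -/
abbrev TreeSpan (n : ℕ) : Type u := LTree O n →₀ k

variable {k O}

namespace TreeSpan

/-- The action of the symmetric group by relabelling. -/
def perm {n : ℕ} (σ : Equiv.Perm (Fin n)) : TreeSpan k O n →ₗ[k] TreeSpan k O n :=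
  Finsupp.lmapDomain k k (LTree.perm σ)

/-- The partial composition at the `i`-th input. A tree is read as a product of its decorations
in prefix order, which gives the sign: the decorations of `s` jump over the decorations
of `t` that follow the leaf `i`. -/
def comp (δ : O → ℤ) {n m : ℕ} (i : Fin (n + 1)) :
    TreeSpan k O (n + 1) →ₗ[k] TreeSpan k O m →ₗ[k] TreeSpan k O (n + m) :=
  Finsupp.linearCombination k fun t => Finsupp.linearCombination k fun s =>
    Finsupp.single (LTree.comp i t s)
      (((s.degree δ * t.1.degreeAfter δ i).negOnePow : ℤ) : k)

/-- The map `t ↦ (-1)^{|t|} t`. -/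
def sign (δ : O → ℤ) (n : ℕ) : TreeSpan k O n →ₗ[k] TreeSpan k O n :=
  Finsupp.linearCombination k fun t => Finsupp.single t (((t.degree δ).negOnePow : ℤ) : k)

/-- Ideals: families of subspaces stable under the symmetric groups and under partial
composition with arbitrary elements. -/
structure IsIdeal (δ : O → ℤ) (I : ∀ n, Submodule k (TreeSpan k O n)) : Prop where
  perm_mem : ∀ {n : ℕ} (σ : Equiv.Perm (Fin n)), ∀ x ∈ I n, perm σ x ∈ I n
  comp_left : ∀ {n m : ℕ} (i : Fin (n + 1)), ∀ x ∈ I (n + 1), ∀ y : TreeSpan k O m,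
    comp δ i x y ∈ I (n + m)
  comp_right : ∀ {n m : ℕ} (i : Fin (n + 1)) (x : TreeSpan k O (n + 1)), ∀ y ∈ I m,
    comp δ i x y ∈ I (n + m)

theorem comp_single (δ : O → ℤ) {n m : ℕ} (i : Fin (n + 1)) (t : LTree O (n + 1))
    (s : LTree O m) (c d : k) :
    comp δ i (Finsupp.single t c) (Finsupp.single s d) =
      Finsupp.single (LTree.comp i t s)
        (c * (d * (((s.degree δ * t.1.degreeAfter δ i).negOnePow : ℤ) : k))) := by
  rw [comp, Finsupp.linearCombination_single, LinearMap.smul_apply,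
    Finsupp.linearCombination_single, Finsupp.smul_single, Finsupp.smul_single, smul_eq_mul,
    smul_eq_mul]

theorem sign_single (δ : O → ℤ) {n : ℕ} (t : LTree O n) (c : k) :
    sign δ n (Finsupp.single t c) =
      Finsupp.single t (c * (((t.degree δ).negOnePow : ℤ) : k)) := by
  rw [sign, Finsupp.linearCombination_single, Finsupp.smul_single, smul_eq_mul]

theorem perm_single {n : ℕ} (σ : Equiv.Perm (Fin n)) (t : LTree O n) (c : k) :
    perm σ (Finsupp.single t c) = Finsupp.single (LTree.perm σ t) c := by
  simp [perm]

theorem sign_comp (δ : O → ℤ) {n m : ℕ} (i : Fin (n + 1)) (x : TreeSpan k O (n + 1))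
    (y : TreeSpan k O m) :
    sign δ (n + m) (comp δ i x y) = comp δ i (sign δ (n + 1) x) (sign δ m y) := by
  induction x using Finsupp.induction_linear with
  | zero => simp
  | add a b ha hb => simp only [map_add, LinearMap.add_apply, ha, hb]
  | single t c =>
    induction y using Finsupp.induction_linear with
    | zero => simp
    | add a b ha hb => simp only [map_add, ha, hb]
    | single s d =>
      rw [comp_single, sign_single, sign_single, sign_single, comp_single, LTree.degree_comp,
        Int.negOnePow_add]
      congr 1
      push_cast
      ring

theorem sign_perm (δ : O → ℤ) {n : ℕ} (σ : Equiv.Perm (Fin n)) (x : TreeSpan k O n) :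
    sign δ n (perm σ x) = perm σ (sign δ n x) := by
  induction x using Finsupp.induction_linear with
  | zero => simp
  | add a b ha hb => simp only [map_add, ha, hb]
  | single t c => rw [perm_single, sign_single, sign_single, perm_single, LTree.degree_perm]

/-- The elements that are homogeneous of degree `d`. -/
def homogeneous (k : Type u) [Field k] (δ : O → ℤ) (n : ℕ) (d : ℤ) :
    Submodule k (TreeSpan k O n) :=
  Finsupp.supported k k {t | t.degree δ = d}

theorem sign_of_homogeneous (δ : O → ℤ) {n : ℕ} (x : TreeSpan k O n) (d : ℤ)
    (hx : x ∈ homogeneous k δ n d) : sign δ n x = ((d.negOnePow : ℤ) : k) • x := by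
  rw [sign, Finsupp.linearCombination_apply]
  conv_rhs => rw [← Finsupp.sum_single x]
  rw [Finsupp.smul_sum, Finsupp.sum, Finsupp.sum]
  refine Finset.sum_congr rfl fun t ht => ?_
  have hd : t.degree δ = d := (Finsupp.mem_supported k x).1 hx ht
  rw [hd, Finsupp.smul_single, Finsupp.smul_single, smul_eq_mul, smul_eq_mul, mul_comm]

end TreeSpan

namespace TreeSpan

/-- The coordinates of a planar tree with three labelled leaves in `Free(E)(3) = 3 (E ⊗ E)`:
the basis vector `(g, h, l)` stands for the tree `g(h(l + 1, l + 2), l)`, the labels being taken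
modulo `3`, and every tree is brought to this form, up to a sign, with the rule
`g(2, 1) = sgn(g) (swap g)(1, 2)`. -/
def combTree (k : Type u) [Field k] (swap : O → O) (sgn : O → ℤˣ) :
    BTree O (Fin 3) → (O × O × Fin 3 →₀ k)
  | .node g (.node h (.leaf i) (.leaf j)) (.leaf l) =>
    if j = i + 1 then Finsupp.single (g, h, l) 1
    else Finsupp.single (g, swap h, l) (((sgn h : ℤˣ) : ℤ) : k)
  | .node g (.leaf l) (.node h (.leaf i) (.leaf j)) =>
    if j = i + 1 then Finsupp.single (swap g, h, l) (((sgn g : ℤˣ) : ℤ) : k)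
    else Finsupp.single (swap g, swap h, l) (((sgn g * sgn h : ℤˣ) : ℤ) : k)
  | _ => 0

/-- The coordinates of an element of `Free(E)(3)`. -/
def comb (swap : O → O) (sgn : O → ℤˣ) : TreeSpan k O 3 →ₗ[k] (O × O × Fin 3 →₀ k) :=
  Finsupp.linearCombination k fun t => combTree k swap sgn t.1

end TreeSpan

/-- Data presenting a binary quadratic operad `Free(E)/⟨R⟩`. The graded `S₂`-module `E = E(2)` of
generators is given by a finite homogeneous basis `O` that the transposition permutes up
to signs: `g(2, 1) = sgn(g) (swap g)(1, 2)`. The relations `R` are the subspace of `Free(E)(3)`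
generated, as an `S₃`-module, by a set of homogeneous elements. -/
structure QuadraticData (k : Type u) [Field k] (O : Type) where
  deg : O → ℤ
  swap : O → O
  sgn : O → ℤˣ
  swap_swap : ∀ g, swap (swap g) = g
  sgn_swap : ∀ g, sgn (swap g) = sgn g
  deg_swap : ∀ g, deg (swap g) = deg g
  rel : Set (TreeSpan k O 3)
  homogeneous : ∀ r ∈ rel, ∃ d, r ∈ TreeSpan.homogeneous k deg 3 d

namespace QuadraticData

variable (Q : QuadraticData k O)

/-- The generators of the ideal of relations among planar trees: the symmetry of the generating
operations, and the elements of `R`. -/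
inductive IsRelator : ∀ n, TreeSpan k O n → Prop
  | symm (g : O) : IsRelator 2 (Finsupp.single (LTree.corollaSwap g) 1 -
      Finsupp.single (LTree.corolla (Q.swap g)) (((Q.sgn g : ℤˣ) : ℤ) : k))
  | rel (r : TreeSpan k O 3) (hr : r ∈ Q.rel) : IsRelator 3 r

/-- The smallest ideal that contains the relators. -/
def ideal (n : ℕ) : Submodule k (TreeSpan k O n) :=
  ⨅ (I : ∀ n, Submodule k (TreeSpan k O n))
    (_ : TreeSpan.IsIdeal Q.deg I ∧ ∀ m x, Q.IsRelator m x → x ∈ I m), I n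

theorem mem_ideal {n : ℕ} {x : TreeSpan k O n} : x ∈ Q.ideal n ↔
    ∀ I : ∀ n, Submodule k (TreeSpan k O n),
      TreeSpan.IsIdeal Q.deg I → (∀ m y, Q.IsRelator m y → y ∈ I m) → x ∈ I n := by
  simp only [ideal, Submodule.mem_iInf, and_imp]

theorem isIdeal_ideal : TreeSpan.IsIdeal Q.deg Q.ideal where
  perm_mem σ x hx := Q.mem_ideal.2 fun I h h' => h.perm_mem σ x (Q.mem_ideal.1 hx I h h')
  comp_left i x hx y :=
    Q.mem_ideal.2 fun I h h' => h.comp_left i x (Q.mem_ideal.1 hx I h h') y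
  comp_right i x y hy :=
    Q.mem_ideal.2 fun I h h' => h.comp_right i x y (Q.mem_ideal.1 hy I h h')

theorem sign_mem {n : ℕ} (x : TreeSpan k O n) (hx : x ∈ Q.ideal n) :
    TreeSpan.sign Q.deg n x ∈ Q.ideal n := by
  refine Q.mem_ideal.1 hx (fun n => (Q.ideal n).comap (TreeSpan.sign Q.deg n))
    ⟨fun σ x hx => ?_, fun i x hx y => ?_, fun i x y hy => ?_⟩ fun m y hy => ?_
  · rw [Submodule.mem_comap] at hx ⊢
    rw [TreeSpan.sign_perm]
    exact Q.isIdeal_ideal.perm_mem σ _ hx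
  · rw [Submodule.mem_comap] at hx ⊢
    rw [TreeSpan.sign_comp]
    exact Q.isIdeal_ideal.comp_left i _ hx _
  · rw [Submodule.mem_comap] at hy ⊢
    rw [TreeSpan.sign_comp]
    exact Q.isIdeal_ideal.comp_right i _ _ hy
  · have hmem : y ∈ Q.ideal m := Q.mem_ideal.2 fun I _ h' => h' m y hy
    rw [Submodule.mem_comap]
    obtain ⟨d, hd⟩ : ∃ d, y ∈ TreeSpan.homogeneous k Q.deg m d := by
      cases hy with
      | rel _ hr => exact Q.homogeneous _ hr
      | symm g =>
        refine ⟨Q.deg g, sub_mem (Finsupp.single_mem_supported k _ ?_)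
          (Finsupp.single_mem_supported k _ ?_)⟩
        · rw [Set.mem_ofPred_eq]
          simp [LTree.degree, LTree.corollaSwap, BTree.degree]
        · rw [Set.mem_ofPred_eq]
          simp [LTree.degree, LTree.corolla, BTree.degree, Q.deg_swap]
    rw [TreeSpan.sign_of_homogeneous Q.deg y d hd]
    exact Submodule.smul_mem _ _ hmem

/-- The arity `n` component of the quadratic operad `Free(E)/⟨R⟩`. -/
abbrev operad (n : ℕ) : Type u := TreeSpan k O n ⧸ Q.ideal n

/-- The action of the symmetric group on the operad, by relabelling the inputs. -/
def operadRep (n : ℕ) : Representation k (Equiv.Perm (Fin n)) (Q.operad n) where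
  toFun σ := Submodule.mapQ _ _ (TreeSpan.perm σ) fun x hx => Q.isIdeal_ideal.perm_mem σ x hx
  map_one' := by
    refine Submodule.linearMap_qext _ (Finsupp.lhom_ext fun t c => ?_)
    have : LTree.perm 1 t = t := Subtype.ext (BTree.map_id t.1)
    simp [TreeSpan.perm, this]
  map_mul' σ τ := by
    refine Submodule.linearMap_qext _ (Finsupp.lhom_ext fun t c => ?_)
    have : LTree.perm (σ * τ) t = LTree.perm σ (LTree.perm τ t) :=
      Subtype.ext (BTree.map_map τ σ t.1).symm
    simp [TreeSpan.perm, this]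

/-- The map `x ↦ (-1)^{|x|} x` on the operad. -/
def operadSign (n : ℕ) : Q.operad n →ₗ[k] Q.operad n :=
  Submodule.mapQ _ _ (TreeSpan.sign Q.deg n) fun x hx => Q.sign_mem x hx

/-- The partial composition with a generator at the first input, `x ↦ x ∘₁ g`. -/
def insertFirst (g : O) (n : ℕ) : Q.operad (n + 1) →ₗ[k] Q.operad (n + 2) :=
  Submodule.mapQ _ _ ((TreeSpan.comp Q.deg (m := 2) (0 : Fin (n + 1))).flip
      (Finsupp.single (LTree.corolla g) 1))
    fun x hx => Q.isIdeal_ideal.comp_left 0 x hx _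

section KoszulDual

variable [Fintype O]

/-- The natural pairing of `Free(E^∨)(3)` with `Free(E)(3)`, where `E^∨ = E^* ⊗ sgn₂` has the
basis dual to that of `E`. In coordinates this is the pairing of `E^* ⊗ E^*` with `E ⊗ E`,
`⟨g' ⊗ h', g ⊗ h⟩ = (-1)^{|h'||g|} g'(g) h'(h)`, on each of the three summands. -/
def pairing (x y : TreeSpan k O 3) : k :=
  ∑ c : O × O × Fin 3, (((Q.deg c.2.1 * Q.deg c.1).negOnePow : ℤ) : k) *
    TreeSpan.comb Q.swap (fun g => -Q.sgn g) x c * TreeSpan.comb Q.swap Q.sgn y c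

/-- The Koszul dual `Free(E^∨)/⟨R^⊥⟩`: its generators are the dual basis of `E^∨ = E^* ⊗ sgn₂`,
and its relations are the (homogeneous) elements of the annihilator `R^⊥` of `R`. -/
def koszulDual : QuadraticData k O where
  deg g := -Q.deg g
  swap := Q.swap
  sgn g := -Q.sgn g
  swap_swap := Q.swap_swap
  sgn_swap g := by rw [Q.sgn_swap]
  deg_swap g := by rw [Q.deg_swap]
  rel := {x | (∃ d, x ∈ TreeSpan.homogeneous k (fun g => -Q.deg g) 3 d) ∧
    ∀ r ∈ Q.rel, ∀ σ : Equiv.Perm (Fin 3), Q.pairing x (TreeSpan.perm σ r) = 0}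
  homogeneous _ hx := hx.1

end KoszulDual

/-- The elements of degree `d` of the linear dual of the operad: functionals that vanish on all
trees whose degree is not `-d`. -/
def dualDeg (n : ℕ) (d : ℤ) : Submodule k (Module.Dual k (Q.operad n)) where
  carrier := {φ | ∀ t : LTree O n, LTree.degree Q.deg t ≠ -d →
    φ (Submodule.Quotient.mk (Finsupp.single t 1)) = 0}
  add_mem' ha hb t ht := by simp [ha t ht, hb t ht]
  zero_mem' _ _ := rfl
  smul_mem' c φ h t ht := by simp [h t ht]

end QuadraticData

end Operads

/-! ## The complex of algebra homology of an algebra over a quadratic operad -/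

section OperadicComplex

variable {k : Type u} [Field k] {O : Type} [Fintype O] {V : Type v} [AddCommGroup V] [Module k V]

namespace QuadraticData

variable (Q : QuadraticData k O) (𝒱 : Grading k V)

/-- The tensor product `𝒪^!(n)^* ⊗ V[1]^{⊗ n}`. -/
def PreChains (V : Type v) [AddCommGroup V] [Module k V] (n : ℕ) : Type (max u v) :=
  Module.Dual k (Q.koszulDual.operad n) ⊗[k] (⨂[k] _ : Fin n, V)

instance (n : ℕ) : AddCommGroup (Q.PreChains V n) :=
  inferInstanceAs (AddCommGroup (Module.Dual k (Q.koszulDual.operad n) ⊗[k] (⨂[k] _ : Fin n, V)))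

instance (n : ℕ) : Module k (Q.PreChains V n) :=
  inferInstanceAs (Module k (Module.Dual k (Q.koszulDual.operad n) ⊗[k] (⨂[k] _ : Fin n, V)))

/-- The diagonal action of the symmetric group on `𝒪^!(n)^* ⊗ V[1]^{⊗ n}`. -/
def chainRep (n : ℕ) : Representation k (Equiv.Perm (Fin n)) (Q.PreChains V n) :=
  (Q.koszulDual.operadRep n).dual.tprod (koszulRep (𝒱.shift 1) n)

/-- The space `C^n(V) = 𝒪^!(n)^* ⊗_{S_n} V[1]^{⊗ n}` of chains of weight `n`. -/
abbrev Chains (n : ℕ) : Type (max u v) :=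
  Representation.Coinvariants (V := Q.PreChains V n) (Q.chainRep 𝒱 n)

/-- The class of an element of `𝒪^!(n)^* ⊗ V[1]^{⊗ n}`. -/
def toChains (n : ℕ) : Q.PreChains V n →ₗ[k] Q.Chains 𝒱 n :=
  Representation.Coinvariants.mk (V := Q.PreChains V n) (Q.chainRep 𝒱 n)

/-- The chains of weight `n` and internal degree `m`. -/
def chainDeg (n : ℕ) (m : ℤ) : Submodule k (Q.Chains 𝒱 n) :=
  Submodule.span k {c | ∃ (e : ℤ) (d : Fin n → ℤ) (φ : Module.Dual k (Q.koszulDual.operad n))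
    (v : Fin n → V), φ ∈ Q.koszulDual.dualDeg n e ∧ (∀ i, v i ∈ (𝒱.shift 1).deg (d i)) ∧
      e + ∑ i, d i = m ∧
      c = Q.toChains 𝒱 n (φ ⊗ₜ PiTensorProduct.tprod k v)}

/-- The component `φ ↦ φ_g` at the dual basis of the infinitesimal decomposition
`𝒪^!(n+2)^* → 𝒪^!(n+1)^* ⊗ 𝒪^!(2)^*`, `φ ↦ ∑ φ_g ⊗ g`, dual to the composition
`x ⊗ g^* ↦ x ∘₁ g^*`, with its Koszul signs: `φ_g(x) = (-1)^{|x||g|} (-1)^{|x|} φ(x ∘₁ g^*)`.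
The first sign is that of the pairing of tensor products, the second that of the structure map
of degree one which is afterwards applied to `g` and to two elements of `V[1]`. -/
def decompose (g : O) (n : ℕ) : Module.Dual k (Q.koszulDual.operad (n + 2)) →ₗ[k]
    Module.Dual k (Q.koszulDual.operad (n + 1)) :=
  (Q.koszulDual.insertFirst g n ∘ₗ
    (Q.koszulDual.operadSign (n + 1)) ^ ((Q.deg g).natAbs + 1)).dualMap

/-- For operations `μ g` on `V`, `g` a generator of `𝒪`, the map
`φ ⊗ v₁ ⊗ v₂ ⊗ v₃ ⊗ ⋯ ↦ ∑_g φ_g ⊗ (-1)^{|v₁|} μ_g(v₁, v₂) ⊗ v₃ ⊗ ⋯` that contracts the first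
two inputs. Here `|v₁|` is the degree in `V`, so that `(-1)^{|v₁|} μ_g(v₁, v₂)` is the operation
induced by `μ g` on `V[1]`. -/
def contractFirst (μ : O → V →ₗ[k] V →ₗ[k] V) (n : ℕ) :
    Q.PreChains V (n + 2) →ₗ[k] Q.PreChains V (n + 1) :=
  ∑ g, TensorProduct.map (Q.decompose g n) (mergeFirst (μ g ∘ₗ 𝒱.sign) n)

/-- The differential of the complex of algebra homology: all pairs of inputs are contracted. Each
pair occurs `2 · n!` times in the sum over all permutations of the `n + 2` inputs. -/
def chainDifferential (μ : O → V →ₗ[k] V →ₗ[k] V) (n : ℕ) :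
    Q.Chains 𝒱 (n + 2) →ₗ[k] Q.Chains 𝒱 (n + 1) :=
  ((2 * n.factorial : ℕ) : k)⁻¹ • symmetrized (X := Q.PreChains V (n + 2))
    (Q.chainRep 𝒱 (n + 2)) (Q.toChains 𝒱 (n + 1) ∘ₗ Q.contractFirst 𝒱 μ n)

end QuadraticData

end OperadicComplex

/-! ## The Chevalley–Eilenberg complex of a graded Lie algebra -/

section ChevalleyEilenberg

variable {k : Type u} [Field k] {W : Type v} [AddCommGroup W] [Module k W]
  {X : Type w} [AddCommGroup X] [Module k X]

/-- The symmetric power `⊙ⁿ W` of a graded vector space. -/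
abbrev SymPower (𝒲 : Grading k W) (n : ℕ) : Type (max u v) := (koszulRep 𝒲 n).Coinvariants

/-- The part of internal degree `m` of the symmetric power. -/
def symDeg (𝒲 : Grading k W) (n : ℕ) (m : ℤ) : Submodule k (SymPower 𝒲 n) :=
  Submodule.span k {c | ∃ (d : Fin n → ℤ) (w : Fin n → W), (∀ i, w i ∈ 𝒲.deg (d i)) ∧
    ∑ i, d i = m ∧ c = Representation.Coinvariants.mk (koszulRep 𝒲 n) (PiTensorProduct.tprod k w)}

/-- The Chevalley–Eilenberg differential on `⊙(𝔤[1])`, for a bracket on the graded vector space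
`(𝔤, 𝒢)`: `x₁ ⋯ x_{n+2}` goes to the sum over the pairs `i < j`, with the Koszul sign that moves
`x_i, x_j` to the front, of `(-1)^{|x_i|} [x_i, x_j] x₁ ⋯ x_{n+2}` (with `x_i, x_j` omitted),
`|x_i|` being the degree in `𝔤`. Each pair occurs `2 · n!` times in the sum over all
permutations. -/
def ceDifferential (𝒢 : Grading k W) (br : W →ₗ[k] W →ₗ[k] W) (n : ℕ) :
    SymPower (𝒢.shift 1) (n + 2) →ₗ[k] SymPower (𝒢.shift 1) (n + 1) :=
  ((2 * n.factorial : ℕ) : k)⁻¹ • symmetrized (koszulRep (𝒢.shift 1) (n + 2))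
    (Representation.Coinvariants.mk (koszulRep (𝒢.shift 1) (n + 1)) ∘ₗ
      mergeFirst (br ∘ₗ 𝒢.sign) n)

theorem map_proj {𝒲 : Grading k W} {𝒳 : Grading k X} {f : W →ₗ[k] X}
    (hf : ∀ i, ∀ w ∈ 𝒲.deg i, f w ∈ 𝒳.deg i) (p : ZMod 2) (w : W) :
    f (𝒲.proj p w) = 𝒳.proj p (f w) := by
  have : f ∘ₗ 𝒲.proj p = 𝒳.proj p ∘ₗ f := by
    refine 𝒲.hom_ext fun i w hw => ?_
    rw [LinearMap.comp_apply, LinearMap.comp_apply, 𝒲.proj_of_mem p hw,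
      𝒳.proj_of_mem p (hf i w hw)]
    split_ifs <;> simp
  exact LinearMap.congr_fun this w

theorem map_koszulAct {𝒲 : Grading k W} {𝒳 : Grading k X} {f : W →ₗ[k] X}
    (hf : ∀ i, ∀ w ∈ 𝒲.deg i, f w ∈ 𝒳.deg i) (n : ℕ) (σ : Equiv.Perm (Fin n))
    (t : ⨂[k] _ : Fin n, W) :
    PiTensorProduct.map (fun _ => f) (koszulRep 𝒲 n σ t) =
      koszulRep 𝒳 n σ (PiTensorProduct.map (fun _ => f) t) := by
  have : PiTensorProduct.map (fun _ => f) ∘ₗ koszulAct 𝒲 n σ =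
      koszulAct 𝒳 n σ ∘ₗ PiTensorProduct.map (fun _ => f) := by
    refine koszul_ext 𝒲 fun ε w => ?_
    rw [LinearMap.comp_apply, LinearMap.comp_apply, koszulAct_tprod, map_smul,
      PiTensorProduct.map_tprod, PiTensorProduct.map_tprod]
    simp only [map_proj hf]
    rw [koszulAct_tprod]
  exact LinearMap.congr_fun this t

/-- The map `⊙ⁿ W → ⊙ⁿ X` induced by a linear map of degree zero. -/
def symMap {𝒲 : Grading k W} {𝒳 : Grading k X} (f : W →ₗ[k] X)
    (hf : ∀ i, ∀ w ∈ 𝒲.deg i, f w ∈ 𝒳.deg i) (n : ℕ) : SymPower 𝒲 n →ₗ[k] SymPower 𝒳 n :=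
  Representation.Coinvariants.lift _
    (Representation.Coinvariants.mk _ ∘ₗ PiTensorProduct.map fun _ => f) fun σ => by
      ext t
      simp only [LinearMap.compMultilinearMap_apply, LinearMap.comp_apply]
      rw [map_koszulAct hf, Representation.Coinvariants.mk_self_apply]

theorem shift_mem {𝒲 : Grading k W} {𝒳 : Grading k X} {f : W →ₗ[k] X}
    (hf : ∀ i, ∀ w ∈ 𝒲.deg i, f w ∈ 𝒳.deg i) (m : ℤ) :
    ∀ i, ∀ w ∈ (𝒲.shift m).deg i, f w ∈ (𝒳.shift m).deg i :=
  fun i w hw => hf (i + m) w hw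

theorem symMap_ceDifferential {𝒲 : Grading k W} {𝒳 : Grading k X} {f : W →ₗ[k] X}
    (hf : ∀ i, ∀ w ∈ 𝒲.deg i, f w ∈ 𝒳.deg i) (br : W →ₗ[k] W →ₗ[k] W)
    (br' : X →ₗ[k] X →ₗ[k] X) (hbr : ∀ a b, f (br a b) = br' (f a) (f b)) (n : ℕ)
    (c : SymPower (𝒲.shift 1) (n + 2)) :
    symMap f (shift_mem hf 1) (n + 1) (ceDifferential 𝒲 br n c) =
      ceDifferential 𝒳 br' n (symMap f (shift_mem hf 1) (n + 2) c) := by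
  have hmerge : ∀ t : ⨂[k] _ : Fin (n + 2), W,
      PiTensorProduct.map (fun _ => f) (mergeFirst (br ∘ₗ 𝒲.sign) n t) =
        mergeFirst (br' ∘ₗ 𝒳.sign) n (PiTensorProduct.map (fun _ => f) t) := by
    intro t
    refine LinearMap.congr_fun (f := PiTensorProduct.map (fun _ => f) ∘ₗ
      mergeFirst (br ∘ₗ 𝒲.sign) n) (g := mergeFirst (br' ∘ₗ 𝒳.sign) n ∘ₗ
        PiTensorProduct.map (fun _ => f)) (PiTensorProduct.ext (MultilinearMap.ext fun w => ?_)) t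
    simp only [LinearMap.compMultilinearMap_apply, LinearMap.comp_apply,
      PiTensorProduct.map_tprod, mergeFirst_tprod]
    congr 1
    funext j
    refine Fin.cases ?_ (fun j => ?_) j
    · simp [Grading.sign, hbr, map_proj hf]
    · simp
  induction c using Representation.Coinvariants.induction_on with
  | h t =>
    simp only [ceDifferential, symmetrized, symMap, LinearMap.smul_apply,
      Representation.Coinvariants.lift_mk, LinearMap.sum_apply, LinearMap.comp_apply, map_smul,
      map_sum, hmerge, map_koszulAct (shift_mem hf 1)]

end ChevalleyEilenberg

/-! ## Pre-Lie² algebras -/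

section PreLieSq

variable {k : Type u} [Field k] {V : Type v} [AddCommGroup V] [Module k V]

/-- A pre-Lie² algebra structure on the graded vector space `(V, 𝒱)`: a product `a ∘ b` of degree
`0` and a bracket `[a • b]` of degree `1`, such that `∘` is a (right) pre-Lie product, `[ • ]` is
an odd Lie bracket, and the two are compatible. -/
structure PreLieSq (𝒱 : Grading k V) where
  circ : V →ₗ[k] V →ₗ[k] V
  bul : V →ₗ[k] V →ₗ[k] V
  circ_mem : ∀ i j, ∀ a ∈ 𝒱.deg i, ∀ b ∈ 𝒱.deg j, circ a b ∈ 𝒱.deg (i + j)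
  bul_mem : ∀ i j, ∀ a ∈ 𝒱.deg i, ∀ b ∈ 𝒱.deg j, bul a b ∈ 𝒱.deg (i + j + 1)
  /-- The map `a ⊗ b ↦ (-1)^{|b|} [a • b]` is graded symmetric. -/
  bul_symm : ∀ i j, ∀ a ∈ 𝒱.deg i, ∀ b ∈ 𝒱.deg j,
    j.negOnePow • bul a b = (i * j).negOnePow • i.negOnePow • bul b a
  preLie : ∀ i j l, ∀ a ∈ 𝒱.deg i, ∀ b ∈ 𝒱.deg j, ∀ c ∈ 𝒱.deg l,
    circ (circ a b) c - circ a (circ b c) - (j * l).negOnePow • circ (circ a c) b +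
      (j * l).negOnePow • circ a (circ c b) = 0
  jacobi : ∀ i j l, ∀ a ∈ 𝒱.deg i, ∀ b ∈ 𝒱.deg j, ∀ c ∈ 𝒱.deg l,
    bul (bul a b) c = bul a (bul b c) + (j * i + j + i).negOnePow • bul b (bul a c)
  compat : ∀ i j l, ∀ a ∈ 𝒱.deg i, ∀ b ∈ 𝒱.deg j, ∀ c ∈ 𝒱.deg l,
    circ (bul a b) c + j.negOnePow • circ a (bul b c) +
        (j * i + j).negOnePow • circ b (bul a c) =
      (j * l + l).negOnePow • bul (circ a c) b +
        ((i + 1) * (j + l) + i).negOnePow • bul (circ b c) a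

/-- The basis of the `S₂`-module `k[S₂][0] ⊕ 1₂[-1]` of generating operations of pre-Lie² algebras:
`∘`, the opposite of `∘`, and the symmetric operation of degree one. -/
inductive Gen : Type
  | circ
  | circOp
  | bul

namespace Gen

instance : Fintype Gen where
  elems := ⟨[circ, circOp, bul], by simp⟩
  complete g := by cases g <;> simp

/-- The degrees of the generators. -/
def deg : Gen → ℤ
  | circ => 0
  | circOp => 0
  | bul => 1

/-- The transposition exchanges `∘` and its opposite, and fixes the symmetric operation. -/
def swap : Gen → Gen
  | circ => circOp
  | circOp => circ
  | bul => bul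

end Gen

open LTree Gen in
/-- The operad `𝒫` of pre-Lie² algebras. -/
def preLieSqOperad (k : Type u) [Field k] : QuadraticData k Gen where
  deg := Gen.deg
  swap := Gen.swap
  sgn _ := 1
  swap_swap g := by cases g <;> rfl
  sgn_swap _ := rfl
  deg_swap g := by cases g <;> rfl
  rel := {
    Finsupp.single (leftComb circ circ 1) 1 - Finsupp.single (rightComb circ circ 1) 1 -
      Finsupp.single (leftComb circ circ (Equiv.swap 1 2)) 1 +
      Finsupp.single (rightComb circ circ (Equiv.swap 1 2)) 1,
    Finsupp.single (leftComb bul bul 1) 1 +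
      Finsupp.single (leftComb bul bul (finRotate 3)) 1 +
      Finsupp.single (leftComb bul bul (finRotate 3 * finRotate 3)) 1,
    Finsupp.single (leftComb circ bul 1) 1 + Finsupp.single (rightComb circ bul 1) 1 +
      Finsupp.single (rightComb circ bul (Equiv.swap 0 1)) 1 -
      Finsupp.single (leftComb bul circ (Equiv.swap 1 2)) 1 -
      Finsupp.single (leftComb bul circ (finRotate 3)) 1 }
  homogeneous r hr := by
    have hl : ∀ g h σ, Finsupp.single (leftComb g h σ) (1 : k) ∈
        TreeSpan.homogeneous k Gen.deg 3 (g.deg + h.deg) := fun g h σ =>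
      Finsupp.single_mem_supported k _ (by
        rw [Set.mem_ofPred_eq]
        simp [leftComb, LTree.degree, LTree.perm, BTree.degree_map, BTree.degree])
    have hr' : ∀ g h σ, Finsupp.single (rightComb g h σ) (1 : k) ∈
        TreeSpan.homogeneous k Gen.deg 3 (g.deg + h.deg) := fun g h σ =>
      Finsupp.single_mem_supported k _ (by
        rw [Set.mem_ofPred_eq]
        simp [rightComb, LTree.degree, LTree.perm, BTree.degree_map, BTree.degree])
    rcases hr with rfl | rfl | rfl
    · exact ⟨_, add_mem (sub_mem (sub_mem (hl circ circ _) (hr' circ circ _)) (hl circ circ _))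
        (hr' circ circ _)⟩
    · exact ⟨_, add_mem (add_mem (hl bul bul _) (hl bul bul _)) (hl bul bul _)⟩
    · exact ⟨_, sub_mem (sub_mem (add_mem (add_mem (hl circ bul _) (hr' circ bul _))
        (hr' circ bul _)) (hl bul circ _)) (hl bul circ _)⟩

namespace PreLieSq

variable {𝒱 : Grading k V} (A : PreLieSq 𝒱)

/-- The operations of a pre-Lie² algebra that represent the generators of the operad: `a ∘ b`, its
opposite `(-1)^{|a||b|} b ∘ a`, and the symmetric operation `(-1)^{|a|} [a • b]` of degree one. -/
def op : Gen → V →ₗ[k] V →ₗ[k] V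
  | .circ => A.circ
  | .circOp => 𝒱.flip A.circ
  | .bul => A.bul ∘ₗ 𝒱.sign

/-- The space `C^n_𝒫(V) = 𝒫^!(n)^* ⊗_{S_n} V[1]^{⊗ n}`. -/
abbrev C (_ : PreLieSq 𝒱) (n : ℕ) : Type (max u v) := (preLieSqOperad k).Chains 𝒱 n

/-- The differential `d_𝒫 : C^{n+2}_𝒫(V) → C^{n+1}_𝒫(V)`. -/
def dC (n : ℕ) : A.C (n + 2) →ₗ[k] A.C (n + 1) :=
  (preLieSqOperad k).chainDifferential 𝒱 A.op n

/-- The chains of weight `n` and internal degree `m`. -/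
def degC (n : ℕ) (m : ℤ) : Submodule k (A.C n) := (preLieSqOperad k).chainDeg 𝒱 n m

/-- The Lie bracket `[a, b] = a ∘ b - (-1)^{|a||b|} b ∘ a` of `V`. -/
def lieBr : V →ₗ[k] V →ₗ[k] V := A.circ - 𝒱.flip A.circ

/-- The grading of `V ⊕ V[-1]`. The pair `(a, b)` stands for `a + Π b`. -/
def double (𝒱 : Grading k V) : Grading k (V × V) := 𝒱.prod (𝒱.shift (-1))

/-- The Lie bracket of `V ⊕ V[-1]`: the graded antisymmetric bracket with
`[a, b] = a ∘ b - (-1)^{|a||b|} b ∘ a`, `[Π a, b] = -(-1)^{|a|} [a • b] + Π (a ∘ b)` and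
`[Π a, Π b] = Π [a • b]`. The terms with `x.1` and `y.2` are those of
`[a, Π b] = -(-1)^{|a|(|b|+1)} [Π b, a]`, which is
`(-1)^{|a||b|+|a|+|b|} [b • a] - Π ((-1)^{|a||b|+|a|} b ∘ a)`. -/
def doubleBr : V × V →ₗ[k] V × V →ₗ[k] V × V :=
  let p := LinearMap.fst k V V
  let q := LinearMap.snd k V V
  (A.lieBr.compl₁₂ p p - A.bul.compl₁₂ (𝒱.sign ∘ₗ q) p +
      (𝒱.flip A.bul).compl₁₂ (𝒱.sign ∘ₗ p) (𝒱.sign ∘ₗ q)).compr₂ (LinearMap.inl k V V) +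
    (A.circ.compl₁₂ q p - (𝒱.flip A.circ).compl₁₂ (𝒱.sign ∘ₗ p) q +
      A.bul.compl₁₂ q q).compr₂ (LinearMap.inr k V V)

theorem inl_mem (i : ℤ) (a : V) (ha : a ∈ 𝒱.deg i) :
    LinearMap.inl k V V a ∈ (double 𝒱).deg i := ⟨ha, zero_mem _⟩

theorem inl_lieBr (a b : V) : LinearMap.inl k V V (A.lieBr a b) =
    A.doubleBr (LinearMap.inl k V V a) (LinearMap.inl k V V b) := by
  simp [doubleBr]

/-- The space `⊙ⁿ((V ⊕ V[-1])[1])` of the Chevalley–Eilenberg complex of `V ⊕ V[-1]`. -/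
abbrev CE (_ : PreLieSq 𝒱) (n : ℕ) : Type (max u v) := SymPower ((double 𝒱).shift 1) n

/-- The Chevalley–Eilenberg differential of `V ⊕ V[-1]`. -/
def dCE (n : ℕ) : A.CE (n + 2) →ₗ[k] A.CE (n + 1) := ceDifferential (double 𝒱) A.doubleBr n

/-- The subcomplex `⊙ⁿ(V[1])` given by the Lie subalgebra `V` of `V ⊕ V[-1]`. -/
def subCE (n : ℕ) : Submodule k (A.CE n) :=
  LinearMap.range (symMap (LinearMap.inl k V V) (shift_mem (inl_mem (𝒱 := 𝒱)) 1) n)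

theorem dCE_mem (n : ℕ) : A.subCE (n + 2) ≤ (A.subCE (n + 1)).comap (A.dCE n) := by
  rintro _ ⟨c, rfl⟩
  exact ⟨ceDifferential 𝒱 A.lieBr n c,
    symMap_ceDifferential inl_mem A.lieBr A.doubleBr A.inl_lieBr n c⟩

/-- The quotient complex `J`. -/
abbrev J (n : ℕ) : Type (max u v) := A.CE n ⧸ A.subCE n

/-- The differential of the quotient complex `J`. -/
def dJ (n : ℕ) : A.J (n + 2) →ₗ[k] A.J (n + 1) :=
  Submodule.mapQ _ _ (A.dCE n) (A.dCE_mem n)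

/-- The part of `J` of weight `n` and internal degree `m`. -/
def degJ (n : ℕ) (m : ℤ) : Submodule k (A.J n) :=
  (symDeg ((double 𝒱).shift 1) n m).map (A.subCE n).mkQ

end PreLieSq

end PreLieSq

end PreLieTwo

end

noncomputable section

namespace PreLieTwo

open scoped TensorProduct

universe u v w x

/-! ## Signs -/

/-! The point is an explicit model of the Koszul dual operad. In arity `n` it is the span of the
nonconstant monomials in the exterior algebra on odd generators `ξ_1, …, ξ_n`, so it has one basis
element for each exponent vector `ε ≠ 0`. An exponent vector also says which factors of a tensor in
`V ⊕ V[-1]` carry the symbol `Π`. Hence `(V ⊕ V[-1])^{⊗ n}` splits into one copy of `V^{⊗ n}` for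
each `ε`, and dividing by the tensors in `V` removes exactly `ε = 0`. This is the isomorphism; the
rest is signs.

The model is given by `ev`. A leaf goes to its generator, `l ∘ r` to `l · eps r`, where `eps` is the
odd derivation with `eps ξ_i = 1`, and the odd operation goes to the product, up to sign. Grafting
becomes the operation `subst`, with precisely the sign of operadic composition (`ev_graft_of_mem`),
so the kernel of `ev` is an ideal. In arity three the values lie in the span of seven monomials, and
the seven coefficient functionals are, up to sign and the Koszul sign of the pairing, the relabelled
defining relations of pre-Lie² algebras (`relCoord_eq_coeff`, `coeff_eq_relCoord`). Therefore a
homogeneous element belongs to `R^⊥` exactly if its value is zero, and `ev` descends to the dual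
operad (`ideal_le_ker_evSpan`).

For injectivity the operad is bounded from above. Every tree is a combination of left combs modulo
the ideal (`tree_mem_combSpan`). The steps of a comb can be permuted, and its initial leaf can be
exchanged with any leaf attached by the odd operation, in each case up to a scalar (`comb_perm`,
`comb_exchange`). So a comb depends, up to a scalar, only on the set of leaves with exponent one,
which is nonempty; its value is a nonzero multiple of the corresponding monomial. This gives
`span_basisElement` and `evOperad_injective`.

In the dual basis `coordinate` the symmetric group acts by Koszul signs (`dual_coordinate`), and the
infinitesimal decomposition is the transpose of three explicit insertions (`decompose_circ`,
`decompose_circOp`, `decompose_bul`). The comparison map `toPre` is equivariant by the sign identity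
`crossSign_perm`, and it carries the merging of the first two factors by the Lie bracket to the
contraction of the first two inputs (`toPre_mergeFirst`). Both differentials are the same normalised
sums over permutations of these maps, so they correspond. The component `ε` removes `weight ε` from
the degree of the tensor, while its functional has degree `weight ε - 1`; this accounts for the
shift by one.

That the squares vanish is shown on the Chevalley–Eilenberg side. The shifted bracket is a graded
symmetric operation of degree one satisfying the Jacobi identity (`isShiftedLie`). In the square of
the differential the iterated brackets cancel by Jacobi, and the pairs of disjoint brackets cancel
because two odd operations anticommute (`twice_eq_zero`). The statement passes to the quotient and
then, through the isomorphism, to the operadic complex. -/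

/-- The sign `(-1)^i` as a scalar. -/
def sg (k : Type u) [Field k] (i : ℤ) : k := ((i.negOnePow : ℤ) : k)

section Sg

variable (k : Type u) [Field k]

theorem sg_add (i j : ℤ) : sg k (i + j) = sg k i * sg k j := by
  simp [sg, Int.negOnePow_add]

theorem sg_zero : sg k 0 = 1 := by simp [sg]

theorem sg_one : sg k 1 = -1 := by simp [sg]

theorem sg_neg (i : ℤ) : sg k (-i) = sg k i := by simp [sg, Int.negOnePow_neg]

theorem sg_mul_self (i : ℤ) : sg k i * sg k i = 1 := by
  rw [← sg_add]
  simp [sg, Int.negOnePow_even _ (Even.add_self i)]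

theorem sg_eq_or (i : ℤ) : sg k i = 1 ∨ sg k i = -1 := by
  rcases Int.even_or_odd i with h | h
  · exact Or.inl (by simp [sg, Int.negOnePow_even _ h])
  · exact Or.inr (by simp [sg, Int.negOnePow_odd _ h])

theorem sg_ne_zero (i : ℤ) : sg k i ≠ 0 := by
  rcases sg_eq_or k i with h | h <;> simp [h]

theorem sg_even {i : ℤ} (h : Even i) : sg k i = 1 := by simp [sg, Int.negOnePow_even _ h]

theorem sg_odd {i : ℤ} (h : Odd i) : sg k i = -1 := by simp [sg, Int.negOnePow_odd _ h]

theorem sg_congr {i j : ℤ} (h : Even (i - j)) : sg k i = sg k j := by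
  have : i = j + (i - j) := by ring
  rw [this, sg_add, sg_even k h, mul_one]

end Sg

/-! ## Exterior algebras -/

section Exterior

variable {k : Type u} [Field k] {M N : Type*} [AddCommGroup M] [Module k M] [AddCommGroup N]
  [Module k N]

open CliffordAlgebra (contractLeft involute)

theorem contractLeft_ι_mul' (d : Module.Dual k M) (v : M) (b : ExteriorAlgebra k M) :
    contractLeft d (ExteriorAlgebra.ι k v * b) =
      d v • b - ExteriorAlgebra.ι k v * contractLeft d b :=
  CliffordAlgebra.contractLeft_ι_mul d v b

theorem involute_ι' (v : M) :
    involute (ExteriorAlgebra.ι k v) = -ExteriorAlgebra.ι k v :=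
  CliffordAlgebra.involute_ι v

theorem exterior_induction {P : ExteriorAlgebra k M → Prop}
    (hr : ∀ r : k, P (algebraMap k _ r)) (ha : ∀ x y, P x → P y → P (x + y))
    (hι : ∀ x m, P x → P (ExteriorAlgebra.ι k m * x)) (x : ExteriorAlgebra k M) : P x :=
  CliffordAlgebra.left_induction (Q := (0 : QuadraticForm k M)) hr ha hι x

/-- Contractions are odd derivations. Both `eps` and the partial derivatives `pd i` inherit the
signed Leibniz rule from here. -/
theorem contractLeft_mul (d : Module.Dual k M) (a b : ExteriorAlgebra k M) :
    contractLeft d (a * b) = contractLeft d a * b + involute a * contractLeft d b := by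
  induction a using exterior_induction with
  | hr r =>
    rw [CliffordAlgebra.contractLeft_algebraMap_mul, CliffordAlgebra.contractLeft_algebraMap,
      zero_mul, zero_add, AlgHom.commutes]
  | ha x y hx hy => simp only [add_mul, map_add, hx, hy]; abel
  | hι x m hx =>
    rw [mul_assoc, contractLeft_ι_mul', hx, contractLeft_ι_mul', map_mul, involute_ι', mul_add,
      sub_mul, smul_mul_assoc]
    noncomm_ring

theorem involute_contractLeft (d : Module.Dual k M) (a : ExteriorAlgebra k M) :
    involute (contractLeft d a) = -contractLeft d (involute a) := by
  induction a using exterior_induction with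
  | hr r => simp [CliffordAlgebra.contractLeft_algebraMap]
  | ha x y hx hy => simp only [map_add, hx, hy]; abel
  | hι x m hx =>
    rw [contractLeft_ι_mul', map_sub, map_smul, map_mul, map_mul, involute_ι', hx, neg_mul, neg_mul, map_neg,
      contractLeft_ι_mul']
    noncomm_ring

theorem involute_involute' (a : ExteriorAlgebra k M) : involute (involute a) = a :=
  CliffordAlgebra.involute_involute a

theorem map_involute (f : M →ₗ[k] N) (a : ExteriorAlgebra k M) :
    ExteriorAlgebra.map f (involute a) = involute (ExteriorAlgebra.map f a) := by
  induction a using exterior_induction with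
  | hr r => simp
  | ha x y hx hy => simp only [map_add, hx, hy]
  | hι x m hx =>
    rw [map_mul, involute_ι', map_mul, map_mul, map_mul, map_neg, ExteriorAlgebra.map_apply_ι,
      involute_ι', hx]

/-- Naturality of contraction, with the functional pulled back. It reduces the behaviour of `eps`
and `pd` under relabelling, killing a generator or rescaling to an identity between functionals on
the generators. -/
theorem map_contractLeft (f : M →ₗ[k] N) (d : Module.Dual k N) (a : ExteriorAlgebra k M) :
    ExteriorAlgebra.map f (contractLeft (d ∘ₗ f) a) = contractLeft d (ExteriorAlgebra.map f a) := by
  induction a using exterior_induction with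
  | hr r => simp [CliffordAlgebra.contractLeft_algebraMap]
  | ha x y hx hy => simp only [map_add, hx, hy]
  | hι x m hx =>
    rw [contractLeft_ι_mul', map_sub, map_smul, map_mul, map_mul, hx, ExteriorAlgebra.map_apply_ι,
      contractLeft_ι_mul']
    rfl

theorem ι_mul_comm (v : M) (a : ExteriorAlgebra k M) :
    ExteriorAlgebra.ι k v * a = involute a * ExteriorAlgebra.ι k v := by
  induction a using exterior_induction with
  | hr r => simpa using (Algebra.commutes r (ExteriorAlgebra.ι k v)).symm
  | ha x y hx hy => simp only [mul_add, map_add, add_mul, hx, hy]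
  | hι x m hx =>
    rw [map_mul, involute_ι', mul_assoc, ← hx, ← mul_assoc, ← mul_assoc,
      eq_neg_of_add_eq_zero_left (ExteriorAlgebra.ι_add_mul_swap v m), neg_mul, neg_mul, neg_mul]

/-- The element `x` has parity `i` and commutes with homogeneous elements up to the Koszul sign. -/
def IsPar (i : ℤ) (x : ExteriorAlgebra k M) : Prop :=
  involute x = sg k i • x ∧ ∀ (j : ℤ) (y : ExteriorAlgebra k M), involute y = sg k j • y →
    x * y = sg k (i * j) • (y * x)

theorem isPar_ι (v : M) : IsPar 1 (ExteriorAlgebra.ι k v) := by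
  refine ⟨by rw [involute_ι', sg_one, neg_one_smul], fun j y hy => ?_⟩
  rw [ι_mul_comm, hy, one_mul, smul_mul_assoc]

theorem IsPar.mul {i j : ℤ} {x y : ExteriorAlgebra k M} (hx : IsPar i x) (hy : IsPar j y) :
    IsPar (i + j) (x * y) := by
  refine ⟨?_, fun l z hz => ?_⟩
  · rw [map_mul, hx.1, hy.1, smul_mul_smul_comm, sg_add]
  · rw [mul_assoc, hy.2 l z hz, mul_smul_comm, ← mul_assoc, hx.2 l z hz, smul_mul_assoc, smul_smul,
      add_mul, sg_add, mul_comm (sg k (j * l)), mul_assoc]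

theorem IsPar.smul {i : ℤ} {x : ExteriorAlgebra k M} (hx : IsPar i x) (c : k) :
    IsPar i (c • x) := by
  refine ⟨by rw [map_smul, hx.1, smul_comm], fun j y hy => ?_⟩
  rw [smul_mul_assoc, hx.2 j y hy, mul_smul_comm, smul_comm]

theorem IsPar.congr {i j : ℤ} {x : ExteriorAlgebra k M} (hx : IsPar i x) (h : Even (i - j)) :
    IsPar j x := by
  refine ⟨by rw [hx.1, sg_congr k h], fun l y hy => ?_⟩
  rw [hx.2 l y hy, sg_congr k (i := i * l) (j := j * l)]
  rw [← sub_mul]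
  exact h.mul_right l

/-- The commutation rule for the contraction is obtained by contracting the commutation rule of `x`
itself. -/
theorem IsPar.contract {i : ℤ} {x : ExteriorAlgebra k M} (hx : IsPar i x)
    (d : Module.Dual k M) : IsPar (i + 1) (contractLeft d x) := by
  refine ⟨?_, fun j y hy => ?_⟩
  · rw [involute_contractLeft, hx.1, map_smul, sg_add, sg_one, mul_neg_one, neg_smul]
  -- Leibniz gives two terms on each side; those in which `y` is contracted cancel by the rule for
  -- `x` and the contraction of `y`, which has parity `j + 1`.
  · have h := congrArg (contractLeft d) (hx.2 j y hy)
    have hy' : involute (contractLeft d y) = sg k (j + 1) • contractLeft d y := by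
      rw [involute_contractLeft, hy, map_smul, sg_add, sg_one, mul_neg_one, neg_smul]
    rw [map_smul, contractLeft_mul, contractLeft_mul, hx.1, hy, smul_mul_assoc, smul_mul_assoc,
      hx.2 (j + 1) _ hy', smul_smul, smul_add, smul_smul, mul_add, mul_one, sg_add k (i * j) i,
      mul_left_comm, sg_mul_self, mul_one, add_comm, add_left_cancel_iff] at h
    rw [h, add_mul, one_mul, sg_add]

end Exterior

/-! ## Evaluation of trees in exterior algebras -/

section Evaluation

variable {k : Type u} [Field k] {X Y : Type}

open CliffordAlgebra (contractLeft involute)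

/-- The degrees of the generators of the Koszul dual operad. -/
def codeg (g : Gen) : ℤ := -g.deg

variable (k) in
/-- The exterior algebra on generators indexed by `X`. -/
abbrev Lam (X : Type) : Type u := ExteriorAlgebra k (X →₀ k)

/-- The generator of the exterior algebra with index `x`. -/
def xi (x : X) : Lam k X := ExteriorAlgebra.ι k (Finsupp.single x 1)

/-- The functional with value one on all generators. -/
def total : Module.Dual k (X →₀ k) := Finsupp.linearCombination k fun _ => (1 : k)

/-- The derivation of the exterior algebra with value one on all generators. -/
def eps : Lam k X →ₗ[k] Lam k X := contractLeft total

/-- The partial derivative with respect to the generator `i`. -/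
def pd (i : X) : Lam k X →ₗ[k] Lam k X := contractLeft (Finsupp.lapply i : (X →₀ k) →ₗ[k] k)

theorem eps_mul (a b : Lam k X) : eps (a * b) = eps a * b + involute a * eps b :=
  contractLeft_mul _ a b

theorem pd_mul (i : X) (a b : Lam k X) : pd i (a * b) = pd i a * b + involute a * pd i b :=
  contractLeft_mul _ a b

theorem eps_eps (a : Lam k X) : eps (eps a) = 0 := CliffordAlgebra.contractLeft_contractLeft _ _

theorem eps_pd (i : X) (a : Lam k X) : eps (pd i a) = -pd i (eps a) :=
  CliffordAlgebra.contractLeft_comm _ _ _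

theorem IsPar.eps {i : ℤ} {a : Lam k X} (ha : IsPar i a) : IsPar (i + 1) (eps a) :=
  ha.contract total

theorem eps_xi (x : X) : eps (xi x : Lam k X) = 1 := by
  rw [eps, xi, CliffordAlgebra.contractLeft_ι]
  simp [total]

theorem pd_xi [DecidableEq X] (i x : X) : pd i (xi x : Lam k X) = if x = i then 1 else 0 := by
  rw [pd, xi, CliffordAlgebra.contractLeft_ι]
  simp [Finsupp.single_apply, apply_ite (algebraMap k (Lam k X))]

theorem involute_eps (a : Lam k X) : involute (eps a) = -eps (involute a) :=
  involute_contractLeft _ a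

variable (k) in
/-- The value of a tree in the exterior algebra. -/
def ev : BTree Gen X → Lam k X
  | .leaf x => xi x
  | .node .circ l r => ev l * eps (ev r)
  | .node .circOp l r => -(sg k (l.degree codeg) • (eps (ev l) * ev r))
  | .node .bul l r => sg k (l.degree codeg) • (ev l * ev r)

/-- The additional one is the parity of a leaf, whose value is an odd generator although its degree
is zero. In `circ` and `circOp` the factor `eps` removes the surplus of two leaves over one; in
`bul` the odd degree of the vertex does. -/
theorem isPar_ev (t : BTree Gen X) : IsPar (t.degree codeg + 1) (ev k t) := by
  induction t with
  | leaf x =>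
    rw [BTree.degree, zero_add]
    exact isPar_ι _
  | node g l r hl hr =>
    cases g with
    | circ =>
      refine (hl.mul (hr.eps)).congr ?_
      simp only [BTree.degree, codeg, Gen.deg]
      exact ⟨1, by ring⟩
    | circOp =>
      have := (((hl.eps).mul hr).smul (sg k (l.degree codeg))).smul (-1)
      rw [neg_one_smul] at this
      refine this.congr ?_
      simp only [BTree.degree, codeg, Gen.deg]
      exact ⟨1, by ring⟩
    | bul =>
      refine ((hl.mul hr).smul _).congr ?_
      simp only [BTree.degree, codeg, Gen.deg]
      exact ⟨1, by ring⟩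

theorem involute_ev (t : BTree Gen X) :
    involute (ev k t) = sg k (t.degree codeg + 1) • ev k t := (isPar_ev t).1

theorem map_eps_lmapDomain (f : X → Y) (a : Lam k X) :
    eps (ExteriorAlgebra.map (Finsupp.lmapDomain k k f) a) =
      ExteriorAlgebra.map (Finsupp.lmapDomain k k f) (eps a) := by
  rw [eps, ← map_contractLeft, eps]
  congr 3
  refine Finsupp.lhom_ext fun x c => ?_
  simp [total]

theorem ev_map (f : X → Y) (t : BTree Gen X) :
    ev k (t.map f) = ExteriorAlgebra.map (Finsupp.lmapDomain k k f) (ev k t) := by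
  induction t with
  | leaf x => simp [BTree.map, BTree.graft, ev, xi]
  | node g l r hl hr =>
    have h : (BTree.node g l r).map f = .node g (l.map f) (r.map f) := rfl
    rw [h]
    cases g <;> simp only [ev, hl, hr, BTree.degree_map, map_mul, map_smul, map_neg,
      map_eps_lmapDomain]

variable [DecidableEq Y]

/-- The map that kills the basis vector `i` and relabels the others. -/
def relabelAway (k : Type u) [Field k] (i : Y) (o : Y → X) : (Y →₀ k) →ₗ[k] (X →₀ k) :=
  Finsupp.linearCombination k fun j => if j = i then 0 else Finsupp.single (o j) 1

/-- The homomorphism of exterior algebras that kills the generator `i` and relabels the others. -/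
def tau (i : Y) (o : Y → X) : Lam k Y →ₐ[k] Lam k X := ExteriorAlgebra.map (relabelAway k i o)

theorem tau_xi (i : Y) (o : Y → X) (j : Y) :
    tau i o (xi j : Lam k Y) = if j = i then 0 else xi (o j) := by
  rw [tau, xi, ExteriorAlgebra.map_apply_ι]
  split_ifs with h <;> simp [relabelAway, h, xi]

theorem tau_involute (i : Y) (o : Y → X) (a : Lam k Y) :
    tau i o (involute a) = involute (tau i o a) := map_involute _ a

/-- The pullback of `total` along the relabelling is `total` minus the `i`-th coordinate, since the
generator `i` is killed instead of being sent to a generator. -/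
theorem eps_tau (i : Y) (o : Y → X) (a : Lam k Y) :
    eps (tau i o a) = tau i o (eps a) - tau i o (pd i a) := by
  rw [eps, tau, ← map_contractLeft, eps, pd, ← map_sub, ← LinearMap.sub_apply, ← map_sub]
  congr 3
  refine Finsupp.lhom_ext fun x c => ?_
  by_cases h : x = i <;> simp [total, relabelAway, h]

/-- The effect on values of the substitution of a tree with value `s` for the leaf `i`. -/
def subst (i : Y) (o : Y → X) (s : Lam k X) : Lam k Y →ₗ[k] Lam k X :=
  LinearMap.mulRight k s ∘ₗ (involute : Lam k X →ₐ[k] Lam k X).toLinearMap ∘ₗ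
      (tau i o).toLinearMap ∘ₗ pd i +
    LinearMap.mulRight k (eps s) ∘ₗ (tau i o).toLinearMap

theorem subst_apply (i : Y) (o : Y → X) (s : Lam k X) (p : Lam k Y) :
    subst i o s p = involute (tau i o (pd i p)) * s + tau i o p * eps s := rfl

/-- Writing `p = p₀ + q ξ_i` with the generator moved to the right, substitution sends `ξ_i` to `s`
and `1 = eps ξ_i` to `eps s`. It commutes with `eps` because `eps` squares to zero. -/
theorem eps_subst (i : Y) (o : Y → X) (s : Lam k X) (p : Lam k Y) :
    eps (subst i o s p) = subst i o s (eps p) := by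
  rw [subst_apply, subst_apply, map_add, eps_mul, eps_mul, eps_eps, mul_zero, add_zero, eps_tau,
    ← neg_eq_iff_eq_neg.2 (involute_eps _), involute_involute', eps_tau]
  have h : pd i (pd i p) = 0 := CliffordAlgebra.contractLeft_contractLeft _ _
  rw [h, map_zero, sub_zero, eps_pd, map_neg, map_neg, neg_neg, sub_mul]
  abel

/-- The inserted value stands at the right end, so it must be moved back over `b`. The term with `s`
gets the sign of `(d + 1) * e` and another `e` from the involution; the term with `eps s` gets that
of `(d + 2) * e`. Both agree with `d * e`. -/
theorem subst_mul_of_left (i : Y) (o : Y → X) (s : Lam k X) {a b : Lam k Y} {d e : ℤ}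
    (hs : IsPar (d + 1) s) (hb : involute b = sg k e • b) (hi : pd i b = 0) :
    subst i o s (a * b) = sg k (d * e) • (subst i o s a * tau i o b) := by
  have hb' : involute (tau i o b) = sg k e • tau i o b := by rw [← tau_involute, hb, map_smul]
  rw [subst_apply, subst_apply, pd_mul, hi, mul_zero, add_zero, map_mul, map_mul, map_mul, hb',
    add_mul, mul_assoc _ s, hs.2 e _ hb', mul_assoc _ (eps s), (hs.eps).2 e _ hb',
    mul_smul_comm, mul_smul_comm, mul_smul_comm, smul_add, smul_smul, smul_smul, ← sg_add,
    ← sg_add, smul_mul_assoc, ← mul_assoc, ← mul_assoc]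
  congr 1
  · congr 1
    exact sg_congr k ⟨-(d * e), by ring⟩
  · rw [sg_even k ⟨d * e + e, by ring⟩, one_smul]

theorem subst_mul_of_right (i : Y) (o : Y → X) (s : Lam k X) {a b : Lam k Y} (hi : pd i a = 0) :
    subst i o s (a * b) = tau i o a * subst i o s b := by
  rw [subst_apply, subst_apply, pd_mul, hi, zero_mul, zero_add, map_mul, map_mul, map_mul,
    tau_involute, involute_involute', mul_add, mul_assoc, mul_assoc]

theorem ev_graft_of_notMem (i : Y) (o : Y → X) (F : Y → BTree Gen X)
    (hF : ∀ j, j ≠ i → F j = .leaf (o j)) (t : BTree Gen Y) (hi : i ∉ t.leaves) :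
    ev k (t.graft F) = tau i o (ev k t) ∧ pd i (ev k t) = 0 ∧
      (t.graft F).degree codeg = t.degree codeg := by
  induction t with
  | leaf x =>
    have hx : x ≠ i := fun h => hi (by simp [BTree.leaves, h])
    refine ⟨?_, ?_, ?_⟩
    · simp [BTree.graft, ev, hF x hx, tau_xi, hx]
    · simp [ev, pd_xi, hx]
    · simp [BTree.graft, hF x hx, BTree.degree]
  | node g l r hl hr =>
    simp only [BTree.leaves, List.mem_append, not_or] at hi
    obtain ⟨hl1, hl2, hl3⟩ := hl hi.1
    obtain ⟨hr1, hr2, hr3⟩ := hr hi.2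
    have e1 : eps (tau i o (ev k l)) = tau i o (eps (ev k l)) := by
      rw [eps_tau, hl2, map_zero, sub_zero]
    have e2 : eps (tau i o (ev k r)) = tau i o (eps (ev k r)) := by
      rw [eps_tau, hr2, map_zero, sub_zero]
    have f1 : pd i (eps (ev k l)) = 0 := by rw [← neg_eq_zero, ← eps_pd, hl2, map_zero]
    have f2 : pd i (eps (ev k r)) = 0 := by rw [← neg_eq_zero, ← eps_pd, hr2, map_zero]
    refine ⟨?_, ?_, by simp [BTree.graft, BTree.degree, hl3, hr3]⟩
    · cases g <;> simp [BTree.graft, ev, hl1, hr1, hl3, e1, e2]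
    · cases g <;> simp [ev, pd_mul, hl2, hr2, f1, f2]

/-- Evaluation turns grafting into `subst`, with the same sign that enters the partial composition
of trees: the decorations of the inserted tree pass those that follow the leaf `i`. -/
theorem ev_graft_of_mem (i : Y) (o : Y → X) (F : Y → BTree Gen X)
    (hF : ∀ j, j ≠ i → F j = .leaf (o j)) (t : BTree Gen Y) (hi : i ∈ t.leaves)
    (ht : t.leaves.Nodup) :
    sg k ((F i).degree codeg * t.degreeAfter codeg i) • ev k (t.graft F) =
        subst i o (ev k (F i)) (ev k t) ∧
      (t.graft F).degree codeg = t.degree codeg + (F i).degree codeg := by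
  induction t with
  | leaf x =>
    have hx : i = x := by simpa [BTree.leaves] using hi
    subst hx
    refine ⟨?_, ?_⟩
    · simp [BTree.graft, BTree.degreeAfter, sg_zero, ev, subst_apply, pd_xi, tau_xi]
    · simp [BTree.graft, BTree.degree]
  | node g l r hl hr =>
    have hnd := ht
    rw [BTree.leaves, List.nodup_append'] at hnd
    set d := (F i).degree codeg with hd
    have hs := isPar_ev (k := k) (F i)
    rw [← hd] at hs
    -- The leaf lies in exactly one subtree. If it lies in the left one, the right subtree
    -- contributes to `degreeAfter`, matching the sign in `subst_mul_of_left`; if it lies in the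
    -- right one, nothing is crossed.
    by_cases hil : i ∈ l.leaves
    · have hir : i ∉ r.leaves := fun h => hnd.2.2 hil h
      obtain ⟨r1, r2, r3⟩ := ev_graft_of_notMem (k := k) i o F hF r hir
      obtain ⟨l1, l2⟩ := hl hil hnd.1
      have e2 : eps (tau i o (ev k r)) = tau i o (eps (ev k r)) := by
        rw [eps_tau, r2, map_zero, sub_zero]
      have f2 : pd i (eps (ev k r)) = 0 := by rw [← neg_eq_zero, ← eps_pd, r2, map_zero]
      refine ⟨?_, by simp only [BTree.graft, BTree.degree, l2, r3]; ring⟩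
      rw [BTree.degreeAfter, if_pos hil, mul_add, sg_add]
      cases g with
      | circ =>
        rw [BTree.graft, ev, ev, r1, e2, subst_mul_of_left i o _ hs
          (((isPar_ev r).eps).1) f2, ← l1, smul_mul_assoc, smul_smul, mul_comm]
        congr 2
        exact sg_congr k ⟨-d, by ring⟩
      | circOp =>
        rw [BTree.graft, ev, ev, r1, map_neg, map_smul, subst_mul_of_left i o _ hs
          ((isPar_ev r).1) r2, ← eps_subst, ← l1, map_smul, smul_mul_assoc, smul_smul, smul_smul,
          smul_neg, smul_smul, l2]
        congr 2
        rw [sg_add, mul_add, sg_add, mul_one]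
        ring
      | bul =>
        rw [BTree.graft, ev, ev, r1, map_smul, subst_mul_of_left i o _ hs
          ((isPar_ev r).1) r2, ← l1, smul_mul_assoc, smul_smul, smul_smul,
          smul_smul, l2]
        congr 1
        rw [sg_add, mul_add, sg_add, mul_one]
        ring
    · have hir : i ∈ r.leaves := by simpa [BTree.leaves, hil] using hi
      obtain ⟨r1, r2⟩ := hr hir hnd.2.1
      obtain ⟨l1, l2, l3⟩ := ev_graft_of_notMem (k := k) i o F hF l hil
      have e1 : eps (tau i o (ev k l)) = tau i o (eps (ev k l)) := by
        rw [eps_tau, l2, map_zero, sub_zero]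
      have f1 : pd i (eps (ev k l)) = 0 := by rw [← neg_eq_zero, ← eps_pd, l2, map_zero]
      refine ⟨?_, by simp only [BTree.graft, BTree.degree, r2, l3]; ring⟩
      rw [BTree.degreeAfter, if_neg hil]
      cases g with
      | circ =>
        rw [BTree.graft, ev, ev, l1, subst_mul_of_right i o _ l2, ← eps_subst, ← r1, map_smul,
          mul_smul_comm]
      | circOp =>
        rw [BTree.graft, ev, ev, l1, l3, map_neg, map_smul, subst_mul_of_right i o _ f1, ← r1,
          mul_smul_comm, smul_neg, smul_comm, e1]
      | bul =>
        rw [BTree.graft, ev, ev, l1, l3, map_smul, subst_mul_of_right i o _ l2, ← r1,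
          mul_smul_comm, smul_comm]

end Evaluation

/-! ## Monomials -/

section Monomials

variable {k : Type u} [Field k]

open CliffordAlgebra (involute)

/-- Induction peels off the first factors until the two neighbours that are exchanged stand in
front. -/
theorem prod_ofFn_comp_swap {A : Type*} [Ring A] [Algebra k A] {n : ℕ} (a : Fin (n + 1) → A)
    (i : Fin n) (c : k) (h : a i.succ * a i.castSucc = c • (a i.castSucc * a i.succ)) :
    (List.ofFn fun j => a (Equiv.swap i.castSucc i.succ j)).prod = c • (List.ofFn a).prod := by
  induction n with
  | zero => exact i.elim0
  | succ n ih =>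
    refine Fin.cases (fun h => ?_) (fun i h => ?_) i h
    · rw [List.ofFn_succ, List.ofFn_succ, List.ofFn_succ, List.ofFn_succ]
      simp only [List.prod_cons, ← mul_assoc]
      have h0 : Equiv.swap (Fin.castSucc 0) (Fin.succ 0) (0 : Fin (n + 2)) = Fin.succ 0 :=
        Equiv.swap_apply_left _ _
      have h1 : Equiv.swap (Fin.castSucc 0) (Fin.succ 0) (Fin.succ 0 : Fin (n + 2)) = 0 :=
        Equiv.swap_apply_right _ _
      have h2 : ∀ j : Fin n, Equiv.swap (Fin.castSucc 0) (Fin.succ 0) (j.succ.succ : Fin (n + 2)) =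
          j.succ.succ := fun j => Equiv.swap_apply_of_ne_of_ne (Fin.succ_ne_zero _)
            (fun h => Fin.succ_ne_zero j (Fin.succ_injective _ h))
      simp only [h0, h1, h2]
      have h' : a (Fin.succ 0) * a 0 = c • (a 0 * a (Fin.succ 0)) := h
      rw [h', smul_mul_assoc]
    · rw [List.ofFn_succ, List.ofFn_succ (f := a)]
      have h0 : Equiv.swap (Fin.castSucc i.succ) i.succ.succ (0 : Fin (n + 2)) = 0 :=
        Equiv.swap_apply_of_ne_of_ne (by rw [← Fin.succ_castSucc]; exact (Fin.succ_ne_zero _).symm)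
          (Fin.succ_ne_zero _).symm
      have h1 : ∀ j : Fin (n + 1), Equiv.swap (Fin.castSucc i.succ) i.succ.succ j.succ =
          (Equiv.swap i.castSucc i.succ j).succ := fun j => by
        rw [← Fin.succ_castSucc, (Fin.succ_injective _).swap_apply]
      simp only [List.prod_cons, h0, h1]
      rw [ih (fun j => a j.succ) i (by rw [Fin.succ_castSucc]; exact h), mul_smul_comm]

theorem koszulSign_swap {n : ℕ} (i : Fin n) (ε : Fin (n + 1) → ZMod 2) :
    koszulSign (Equiv.swap i.castSucc i.succ) ε =
      if ε i.castSucc = 1 ∧ ε i.succ = 1 then -1 else 1 := by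
  have hlt : i.castSucc < i.succ := Fin.castSucc_lt_succ
  rw [koszulSign, Finset.prod_eq_single i.castSucc, Finset.prod_eq_single i.succ]
  · simp [hlt]
  · intro j _ hj
    refine if_neg ?_
    rintro ⟨h1, h2, -⟩
    rw [Equiv.swap_apply_left, Equiv.swap_apply_of_ne_of_ne h1.ne' hj] at h2
    simp only [Fin.lt_def, Fin.val_castSucc, Fin.val_succ] at h1 h2
    omega
  · simp
  · intro j _ hj
    refine Finset.prod_eq_one fun l _ => if_neg ?_
    rintro ⟨h1, h2, -⟩
    have hj' : (j : ℕ) ≠ i := fun h => hj (Fin.ext h)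
    by_cases hj2 : j = i.succ
    · subst hj2
      rw [Equiv.swap_apply_right, Equiv.swap_apply_of_ne_of_ne (hlt.trans h1).ne' h1.ne'] at h2
      simp only [Fin.lt_def, Fin.val_castSucc, Fin.val_succ] at h1 h2
      omega
    · rw [Equiv.swap_apply_of_ne_of_ne hj hj2] at h2
      have hj3 : (j : ℕ) ≠ i + 1 := fun h => hj2 (Fin.ext h)
      by_cases hl1 : l = i.castSucc
      · subst hl1
        rw [Equiv.swap_apply_left] at h2
        simp only [Fin.lt_def, Fin.val_castSucc, Fin.val_succ] at h1 h2
        omega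
      · by_cases hl2 : l = i.succ
        · subst hl2
          rw [Equiv.swap_apply_right] at h2
          simp only [Fin.lt_def, Fin.val_castSucc, Fin.val_succ] at h1 h2
          omega
        · rw [Equiv.swap_apply_of_ne_of_ne hl1 hl2] at h2
          exact absurd h1 h2.le.not_gt
  · simp

/-- The permutations are generated, as a monoid, by the adjacent transpositions. -/
theorem perm_induction {P : ∀ n, Equiv.Perm (Fin n) → Prop} (one : ∀ n, P n 1)
    (mul : ∀ n σ τ, P n σ → P n τ → P n (σ * τ))
    (swap : ∀ n (i : Fin n), P (n + 1) (Equiv.swap i.castSucc i.succ)) {n : ℕ}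
    (σ : Equiv.Perm (Fin n)) : P n σ := by
  cases n with
  | zero =>
    rw [Subsingleton.elim σ 1]
    exact one 0
  | succ n =>
    have h : σ ∈ Submonoid.closure (Set.range fun i : Fin n => Equiv.swap i.castSucc i.succ) := by
      rw [Equiv.Perm.mclosure_swap_castSucc_succ]
      trivial
    induction h using Submonoid.closure_induction with
    | mem x hx => obtain ⟨i, rfl⟩ := hx; exact swap n i
    | one => exact one _
    | mul x y _ _ hx hy => exact mul _ _ _ hx hy

variable (k) in
/-- The generator `ξ i` if `ε i = 1`, and `1` otherwise. -/
def factor {X : Type} (ε : X → ZMod 2) (i : X) : Lam k X := if ε i = 1 then xi i else 1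

variable (k) in
/-- The product of the generators `ξ i` with `ε i = 1`, over the list `L`. -/
def monoList {X : Type} (ε : X → ZMod 2) (L : List X) : Lam k X :=
  (L.map (factor k ε)).prod

variable (k) in
/-- The monomial with exponents `ε`. -/
def mono {n : ℕ} (ε : Fin n → ZMod 2) : Lam k (Fin n) := monoList k ε (List.finRange n)

theorem mono_eq_ofFn {n : ℕ} (ε : Fin n → ZMod 2) :
    mono k ε = (List.ofFn (factor k ε)).prod := by
  rw [mono, monoList, List.ofFn_eq_map]

theorem map_xi {X Y : Type} (f : X → Y) (x : X) :
    ExteriorAlgebra.map (Finsupp.lmapDomain k k f) (xi x) = xi (f x) := by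
  simp [xi]

theorem xi_mul_xi {X : Type} (x y : X) : (xi x : Lam k X) * xi y = -(xi y * xi x) :=
  eq_neg_of_add_eq_zero_left (ExteriorAlgebra.ι_add_mul_swap _ _)

/-- Both sides are compatible with products of permutations, by `koszulSign_mul`. It remains to
treat adjacent transpositions, where two neighbouring factors are exchanged and a sign appears only
if both are generators. -/
theorem map_mono {n : ℕ} (σ : Equiv.Perm (Fin n)) : ∀ ε : Fin n → ZMod 2,
    ExteriorAlgebra.map (Finsupp.lmapDomain k k σ) (mono k ε) =
      ((koszulSign σ ε : ℤˣ) : ℤ) • mono k (fun i => ε (σ.symm i)) := by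
  induction σ using perm_induction with
  | one n =>
    intro ε
    rw [koszulSign_one]
    have : Finsupp.lmapDomain k k ((1 : Equiv.Perm (Fin n)) : Fin n → Fin n) = LinearMap.id := by
      refine Finsupp.lhom_ext fun x c => ?_
      simp
    rw [this]
    simp only [ExteriorAlgebra.map_id, Units.val_one, one_smul]
    rfl
  | mul n σ τ hσ hτ =>
    intro ε
    have : Finsupp.lmapDomain k k ((σ * τ : Equiv.Perm (Fin n)) : Fin n → Fin n) =
        Finsupp.lmapDomain k k σ ∘ₗ Finsupp.lmapDomain k k τ := by
      refine Finsupp.lhom_ext fun x c => ?_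
      simp
    rw [this, ← ExteriorAlgebra.map_comp_map, AlgHom.comp_apply, hτ, map_zsmul, hσ,
      koszulSign_mul, smul_smul, mul_comm, Units.val_mul]
    rfl
  | swap n i =>
    intro ε
    rw [mono_eq_ofFn, mono_eq_ofFn, map_list_prod, List.map_ofFn]
    have h := prod_ofFn_comp_swap (k := k)
      (factor k fun j => ε ((Equiv.swap i.castSucc i.succ).symm j)) i
      (((koszulSign (Equiv.swap i.castSucc i.succ) ε : ℤˣ) : ℤ) : k) (by
        rw [koszulSign_swap]
        simp only [factor, Equiv.symm_swap, Equiv.swap_apply_left, Equiv.swap_apply_right]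
        by_cases h1 : ε i.castSucc = 1 <;> by_cases h2 : ε i.succ = 1 <;>
          simp [h1, h2, xi_mul_xi i.succ])
    rw [Int.cast_smul_eq_zsmul] at h
    rw [← h]
    congr 2
    funext j
    simp only [factor, Function.comp_apply, Equiv.symm_apply_apply]
    split_ifs <;> simp [map_xi]

theorem pd_xi_mul_of_ne {X : Type} [DecidableEq X] {i j : X} (h : i ≠ j) (p : Lam k X) :
    pd j (xi i * p) = -(xi i * pd j p) := by
  rw [pd_mul, pd_xi, if_neg h, zero_mul, zero_add, xi, involute_ι', neg_mul]

theorem pd_monoList {X : Type} [DecidableEq X] (ε : X → ZMod 2) {i : X} {L : List X}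
    (hi : i ∉ L) : pd i (monoList k ε L) = 0 := by
  induction L with
  | nil => simp [monoList, pd]
  | cons j L ih =>
    rw [List.mem_cons, not_or] at hi
    have h : monoList k ε (j :: L) = (if ε j = 1 then xi j else 1) * monoList k ε L := by
      simp [monoList, factor]
    rw [h]
    split_ifs
    · rw [pd_xi_mul_of_ne (Ne.symm hi.1), ih hi.2, mul_zero, neg_zero]
    · rw [one_mul, ih hi.2]

/-- The coefficient functional of a monomial, as an iterated derivative. -/
def coefList {X : Type} (ε : X → ZMod 2) : List X → (Lam k X →ₗ[k] k)
  | [] => (ExteriorAlgebra.algebraMapInv : Lam k X →ₐ[k] k).toLinearMap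
  | i :: L => coefList ε L ∘ₗ if ε i = 1 then pd i else LinearMap.id

theorem coefList_xi_mul {X : Type} [DecidableEq X] (ε : X → ZMod 2) {i : X} {L : List X}
    (hi : i ∉ L) (p : Lam k X) : coefList ε L (xi i * p) = 0 := by
  induction L generalizing p with
  | nil => simp [coefList, xi, ExteriorAlgebra.algebraMapInv]
  | cons j L ih =>
    rw [List.mem_cons, not_or] at hi
    rw [coefList, LinearMap.comp_apply]
    split_ifs
    · rw [pd_xi_mul_of_ne hi.1, map_neg, ih hi.2, neg_zero]
    · exact ih hi.2 p

/-- Iterated derivatives are dual to monomials: a derivative in a missing generator gives zero, and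
a generator that is not differentiated survives until the constant term is taken. In particular
distinct monomials are linearly independent. -/
theorem coefList_monoList {X : Type} [DecidableEq X] (ε δ : X → ZMod 2) {L : List X}
    (hL : L.Nodup) :
    coefList ε L (monoList k δ L) = if ∀ i ∈ L, ε i = δ i then 1 else 0 := by
  induction L with
  | nil => simp [coefList, monoList]
  | cons i L ih =>
    rw [List.nodup_cons] at hL
    have h : monoList k δ (i :: L) = (if δ i = 1 then xi i else 1) * monoList k δ L := by
      simp [monoList, factor]
    have hε : ε i = 0 ∨ ε i = 1 := by generalize ε i = p; revert p; decide
    have hδ : δ i = 0 ∨ δ i = 1 := by generalize δ i = p; revert p; decide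
    rw [h, coefList, LinearMap.comp_apply]
    rcases hε with hε | hε <;> rcases hδ with hδ | hδ
    · simp [hε, hδ, ih hL.2]
    · simp [hε, hδ, coefList_xi_mul ε hL.1]
    · simp [hε, hδ, pd_monoList δ hL.1]
    · simp only [hε, hδ, if_true, pd_mul, pd_xi, one_mul, pd_monoList δ hL.1, mul_zero, add_zero,
        ih hL.2, List.forall_mem_cons, true_and]

/-- The coefficient of the monomial with exponents `ε`. -/
def coef {n : ℕ} (ε : Fin n → ZMod 2) : Lam k (Fin n) →ₗ[k] k := coefList ε (List.finRange n)

theorem coef_mono {n : ℕ} (ε δ : Fin n → ZMod 2) :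
    coef ε (mono k δ) = if ε = δ then 1 else 0 := by
  rw [coef, mono, coefList_monoList _ _ (List.nodup_finRange n)]
  simp [funext_iff]

theorem mono_cons {n : ℕ} (e : ZMod 2) (ε : Fin n → ZMod 2) :
    mono k (Fin.cons e ε : Fin (n + 1) → ZMod 2) =
      (if e = 1 then xi 0 else 1) *
        ExteriorAlgebra.map (Finsupp.lmapDomain k k Fin.succ) (mono k ε) := by
  rw [mono_eq_ofFn, mono_eq_ofFn, List.ofFn_succ, List.prod_cons, map_list_prod, List.map_ofFn]
  congr 3
  funext i
  simp only [factor, Function.comp_apply, Fin.cons_succ]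
  split_ifs <;> simp [map_xi]

/-- The number of ones. -/
def weight {n : ℕ} (ε : Fin n → ZMod 2) : ℕ := ∑ i, (ε i).val

theorem weight_cons {n : ℕ} (e : ZMod 2) (ε : Fin n → ZMod 2) :
    weight (Fin.cons e ε : Fin (n + 1) → ZMod 2) = e.val + weight ε := by
  rw [weight, Fin.sum_univ_succ]
  simp [weight]

theorem weight_comp {n : ℕ} (ε : Fin n → ZMod 2) (σ : Equiv.Perm (Fin n)) :
    weight (fun i => ε (σ i)) = weight ε := Equiv.sum_comp σ fun i => (ε i).val

theorem involute_mono {n : ℕ} (ε : Fin n → ZMod 2) :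
    involute (mono k ε) = sg k (weight ε) • mono k ε := by
  induction n with
  | zero => simp [mono, monoList, weight, sg_zero]
  | succ n ih =>
    rw [← Fin.cons_self_tail ε, mono_cons, map_mul, ← map_involute, ih, map_smul, weight_cons]
    have h : ε 0 = 0 ∨ ε 0 = 1 := by generalize ε 0 = p; revert p; decide
    rcases h with h | h
    · simp [h]
    · simp [h, xi, sg_add, sg_one, ZMod.val_one]

end Monomials

/-! ## The relations of the Koszul dual operad -/

section Relations

variable {k : Type u} [Field k]

instance : DecidableEq Gen
  | .circ, .circ => isTrue rfl
  | .circ, .circOp => isFalse (by simp)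
  | .circ, .bul => isFalse (by simp)
  | .circOp, .circ => isFalse (by simp)
  | .circOp, .circOp => isTrue rfl
  | .circOp, .bul => isFalse (by simp)
  | .bul, .circ => isFalse (by simp)
  | .bul, .circOp => isFalse (by simp)
  | .bul, .bul => isTrue rfl

variable (k) in
/-- The Koszul dual of the operad of pre-Lie² algebras. -/
abbrev dualOperad : QuadraticData k Gen := (preLieSqOperad k).koszulDual

/-- The value of a combination of trees in the exterior algebra. -/
def evSpan (n : ℕ) : TreeSpan k Gen n →ₗ[k] Lam k (Fin n) :=
  Finsupp.linearCombination k fun t => ev k t.1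

theorem evSpan_single {n : ℕ} (t : LTree Gen n) (c : k) :
    evSpan n (Finsupp.single t c) = c • ev k t.1 := Finsupp.linearCombination_single _ _ _

theorem evSpan_perm {n : ℕ} (σ : Equiv.Perm (Fin n)) (x : TreeSpan k Gen n) :
    evSpan n (TreeSpan.perm σ x) =
      ExteriorAlgebra.map (Finsupp.lmapDomain k k σ) (evSpan n x) := by
  induction x using Finsupp.induction_linear with
  | zero => simp
  | add a b ha hb => simp only [map_add, ha, hb]
  | single t c => rw [TreeSpan.perm_single, evSpan_single, evSpan_single, map_smul, ← ev_map]; rfl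

/-- The minus sign reflects that the parity of a value exceeds the degree of the tree by one. -/
theorem evSpan_sign {n : ℕ} (x : TreeSpan k Gen n) :
    evSpan n (TreeSpan.sign codeg n x) = -CliffordAlgebra.involute (evSpan n x) := by
  induction x using Finsupp.induction_linear with
  | zero => simp
  | add a b ha hb => simp only [map_add, ha, hb]; abel
  | single t c =>
    rw [TreeSpan.sign_single, evSpan_single, evSpan_single, map_smul, involute_ev, sg_add, sg_one,
      mul_neg_one, neg_smul, smul_neg, neg_neg, mul_smul]
    rfl

/-- The value of `o` at `i` is irrelevant because `subst` kills that generator; this is why `o` is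
only constrained away from `i`, where `outerLabel` is defined. -/
theorem evSpan_comp {n m : ℕ} (i : Fin (n + 1)) (o : Fin (n + 1) → Fin (n + m))
    (ho : ∀ j (h : j ≠ i), o j = LTree.outerLabel m i j h) (x : TreeSpan k Gen (n + 1))
    (y : TreeSpan k Gen m) :
    evSpan (n + m) (TreeSpan.comp codeg i x y) =
      subst i o (ExteriorAlgebra.map (Finsupp.lmapDomain k k (LTree.innerLabel i)) (evSpan m y))
        (evSpan (n + 1) x) := by
  have hadd : ∀ (s s' : Lam k (Fin (n + m))) p,
      subst i o (s + s') p = subst i o s p + subst i o s' p := fun s s' p => by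
    simp only [subst_apply, map_add, mul_add]; abel
  have hsmul : ∀ (c : k) (s : Lam k (Fin (n + m))) p,
      subst i o (c • s) p = c • subst i o s p := fun c s p => by
    simp only [subst_apply, map_smul, mul_smul_comm, smul_add]
  induction x using Finsupp.induction_linear with
  | zero => simp
  | add a b ha hb => simp only [map_add, LinearMap.add_apply, ha, hb]
  | single t c =>
    induction y using Finsupp.induction_linear with
    | zero => simp [subst_apply]
    | add a b ha hb => simp only [map_add, hadd, ha, hb]
    | single s d =>
      have h := (ev_graft_of_mem (k := k) i o (LTree.compAt i s.1) (fun j hj => by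
        rw [LTree.compAt, dif_neg hj, ho j hj]) t.1 (t.2.2 i) t.2.1).1
      have hi : LTree.compAt i s.1 i = s.1.map (LTree.innerLabel i) := by simp [LTree.compAt]
      rw [hi, BTree.degree_map, ev_map] at h
      rw [TreeSpan.comp_single, evSpan_single, evSpan_single, evSpan_single, map_smul, map_smul,
        hsmul, ← h, smul_smul, smul_smul, mul_assoc]
      rfl

theorem LTree.isEmpty_zero {O : Type} : IsEmpty (LTree O 0) := by
  refine ⟨fun t => ?_⟩
  have h : ∀ t : BTree O (Fin 0), False := fun t => by
    induction t with
    | leaf x => exact x.elim0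
    | node _ _ _ h _ => exact h
  exact h t.1

/-- A total labelling needs some value at `i`, and `Fin (n + m)` might be empty. The tree `s` rules
this out by forcing `m > 0`. -/
theorem exists_outerLabel {n : ℕ} (m : ℕ) (i : Fin (n + 1)) (s : LTree Gen m) :
    ∃ o : Fin (n + 1) → Fin (n + m), ∀ j (h : j ≠ i), o j = LTree.outerLabel m i j h := by
  classical
  cases m with
  | zero => exact (LTree.isEmpty_zero.false s).elim
  | succ m =>
    exact ⟨fun j => if h : j = i then 0 else LTree.outerLabel _ i j h, fun j h => dif_neg h⟩

/-- The value of a relabelling or of a composition depends only on the values of its constituents.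
If there are no trees with `m` leaves, the second factor is zero anyway. -/
theorem isIdeal_ker_evSpan :
    TreeSpan.IsIdeal (k := k) codeg fun n => LinearMap.ker (evSpan n) where
  perm_mem σ x hx := by
    rw [LinearMap.mem_ker] at hx ⊢
    rw [evSpan_perm, hx, map_zero]
  comp_left {n m} i x hx y := by
    rw [LinearMap.mem_ker] at hx ⊢
    by_cases hm : Nonempty (LTree Gen m)
    · obtain ⟨o, ho⟩ := exists_outerLabel m i hm.some
      rw [evSpan_comp i o ho, hx, map_zero]
    · rw [not_nonempty_iff] at hm
      rw [Subsingleton.elim y 0, map_zero, map_zero]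
  comp_right {n m} i x y hy := by
    rw [LinearMap.mem_ker] at hy ⊢
    by_cases hm : Nonempty (LTree Gen m)
    · obtain ⟨o, ho⟩ := exists_outerLabel m i hm.some
      rw [evSpan_comp i o ho, hy]
      simp [subst_apply]
    · rw [not_nonempty_iff] at hm
      rw [Subsingleton.elim y 0, map_zero, map_zero]

variable (k) in
/-- The values of the basis trees of the free operad in arity three. -/
def basisValue (c : Gen × Gen × Fin 3) : Lam k (Fin 3) :=
  ev k (.node c.1 (.node c.2.1 (.leaf (c.2.2 + 1)) (.leaf (c.2.2 + 2))) (.leaf c.2.2))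

theorem ev_node_swap (g : Gen) {X : Type} (l r : X) :
    ev k (.node g (.leaf l) (.leaf r)) = -ev k (.node g.swap (.leaf r) (.leaf l)) := by
  cases g
  · simp [Gen.swap, ev, eps_xi, BTree.degree, sg_zero]
  · simp [Gen.swap, ev, eps_xi, BTree.degree, sg_zero]
  · simp only [Gen.swap, ev, BTree.degree, sg_zero, one_smul]
    exact xi_mul_xi l r

theorem ev_node_congr (g : Gen) {X : Type} {l l' r r' : BTree Gen X} {a b : k}
    (hl : ev k l = a • ev k l') (hr : ev k r = b • ev k r')
    (hd : l.degree codeg = l'.degree codeg) :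
    ev k (.node g l r) = (a * b) • ev k (.node g l' r') := by
  cases g <;> simp only [ev, hl, hr, hd, map_smul, smul_mul_smul_comm, smul_neg] <;>
    rw [smul_comm]

/-- The odd generator of the leaf is moved past the value of the other subtree. The signs in the
definition of `ev` are such that only `-1` remains, the sign of the transposition in `E^* ⊗ sgn₂`.
-/
theorem ev_node_leaf_node (g h : Gen) {X : Type} (l i j : X) :
    ev k (.node g (.leaf l) (.node h (.leaf i) (.leaf j))) =
      -ev k (.node g.swap (.node h (.leaf i) (.leaf j)) (.leaf l)) := by
  have hx := (isPar_ev (k := k) (.leaf l)).2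
  have h1 := hx _ _ (isPar_ev (k := k) (.node h (.leaf i) (.leaf j))).1
  have h2 := hx _ _ (isPar_ev (k := k) (.node h (.leaf i) (.leaf j))).eps.1
  have hl : (BTree.leaf l : BTree Gen X).degree codeg = 0 := rfl
  have he : eps (ev k (.leaf l : BTree Gen X)) = 1 := eps_xi l
  rw [hl, zero_add, one_mul] at h1 h2
  rw [sg_add, sg_one, mul_neg_one, neg_smul] at h1
  rw [sg_add, sg_add, sg_one, mul_neg_one, mul_neg_one, neg_neg] at h2
  generalize (BTree.node h (.leaf i) (.leaf j) : BTree Gen X) = t at *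
  generalize (BTree.leaf l : BTree Gen X) = s at *
  cases g
  · rw [Gen.swap, ev, ev, h2, neg_neg]
  · rw [Gen.swap, ev, ev, he, hl, sg_zero, one_smul, one_mul, mul_one]
  · rw [Gen.swap, ev, ev, h1, hl, sg_zero, one_smul]

/-- A tree with three leaves has one of two shapes, and the symmetry of the generators brings each
to the form used as a basis of the free operad. The values obey the same symmetry, so they depend
only on the coordinates. -/
theorem ev_eq_comb (t : LTree Gen 3) :
    ev k t.1 = Finsupp.linearCombination k (basisValue k)
      (TreeSpan.combTree k Gen.swap (fun _ => -1) t.1) := by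
  have hpos : ∀ t : BTree Gen (Fin 3), 1 ≤ t.leaves.length := fun t => by
    induction t with
    | leaf x => simp [BTree.leaves]
    | node _ _ _ h _ => rw [BTree.leaves, List.length_append]; omega
  have hlen : t.1.leaves.length = 3 := by
    have h := List.toFinset_card_of_nodup t.2.1
    have h' : t.1.leaves.toFinset = Finset.univ := by
      ext x
      simp [t.2.2 x]
    rw [← h, h']
    rfl
  -- For three distinct labels modulo 3, the pair at the inner vertex is either in cyclic order or
  -- in the reverse order relative to the outer label.
  have key : ∀ i j l : Fin 3, [i, j, l].Nodup →
      (j = i + 1 → i = l + 1 ∧ j = l + 2) ∧ (j ≠ i + 1 → i = l + 2 ∧ j = l + 1) := by decide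
  have left : ∀ g h (i j l : Fin 3), [i, j, l].Nodup →
      ev k (.node g (.node h (.leaf i) (.leaf j)) (.leaf l)) =
        Finsupp.linearCombination k (basisValue k)
          (TreeSpan.combTree k Gen.swap (fun _ => -1)
            (.node g (.node h (.leaf i) (.leaf j)) (.leaf l))) := by
    intro g h i j l hn
    rw [TreeSpan.combTree]
    split_ifs with hij
    · obtain ⟨rfl, rfl⟩ := (key i j l hn).1 hij
      rw [Finsupp.linearCombination_single, one_smul]
      rfl
    · obtain ⟨rfl, rfl⟩ := (key i j l hn).2 hij
      rw [Finsupp.linearCombination_single]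
      have := ev_node_congr (k := k) g (r := .leaf l) (r' := .leaf l) (a := -1) (b := 1)
        (by rw [neg_one_smul]; exact ev_node_swap h (l + 2) (l + 1)) (one_smul _ _).symm
        (by cases h <;> rfl)
      rw [this]
      simp [basisValue]
  obtain ⟨t, hnd, hmem⟩ := t
  simp only at hlen ⊢
  rcases t with x | ⟨g, l, r⟩
  · simp [BTree.leaves] at hlen
  · rw [BTree.leaves, List.length_append] at hlen
    have hl := hpos l
    have hr := hpos r
    rcases l with l | ⟨h, l1, l2⟩
    · rcases r with r | ⟨h, r1, r2⟩
      · simp [BTree.leaves] at hlen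
      · rcases r1 with i | ⟨_, a, b⟩
        · rcases r2 with j | ⟨_, a, b⟩
          · have hn : [i, j, l].Nodup := by
              have : [l, i, j].Nodup := hnd
              exact (List.perm_append_comm (l₁ := [l]) (l₂ := [i, j])).nodup_iff.1 this
            rw [ev_node_leaf_node, left _ _ _ _ _ hn]
            simp only [TreeSpan.combTree]
            split_ifs <;> simp
          · have := hpos a
            have := hpos b
            simp only [BTree.leaves, List.length_append, List.length_singleton] at hlen
            omega
        · have := hpos a
          have := hpos b
          have := hpos r2
          simp only [BTree.leaves, List.length_append, List.length_singleton] at hlen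
          omega
    · have := hpos l1
      have := hpos l2
      simp only [BTree.leaves, List.length_append] at hlen
      rcases l1 with i | ⟨_, a, b⟩
      · rcases l2 with j | ⟨_, a, b⟩
        · rcases r with r | ⟨_, a, b⟩
          · exact left g h i j r hnd
          · have := hpos a
            have := hpos b
            simp only [BTree.leaves, List.length_append, List.length_singleton] at hlen
            omega
        · have := hpos a
          have := hpos b
          simp only [BTree.leaves, List.length_append, List.length_singleton] at hlen
          omega
      · have := hpos a
        have := hpos b
        simp only [BTree.leaves, List.length_append] at hlen
        omega

theorem evSpan_three (x : TreeSpan k Gen 3) :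
    evSpan 3 x = ∑ c, TreeSpan.comb Gen.swap (fun _ => -1) x c • basisValue k c := by
  have h : evSpan 3 x =
      Finsupp.linearCombination k (basisValue k) (TreeSpan.comb Gen.swap (fun _ => -1) x) := by
    induction x using Finsupp.induction_linear with
    | zero => simp
    | add a b ha hb => simp only [map_add, ha, hb]
    | single t c =>
      rw [evSpan_single, TreeSpan.comb, Finsupp.linearCombination_single, map_smul, ev_eq_comb]
  rw [h, Finsupp.linearCombination_apply, Finsupp.sum_fintype _ _ (by simp)]

/-- The monomials that span the values of trees in arity three. -/
abbrev Word : Type := Fin 3 ⊕ Fin 3 ⊕ Unit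

variable (k) in
/-- The value of a word. -/
def Word.val : Word → Lam k (Fin 3)
  | .inl i => xi i
  | .inr (.inl i) => xi i * xi (i + 1)
  | .inr (.inr _) => xi 0 * xi 1 * xi 2

/-- The exponents of a word. -/
def Word.exps : Word → Fin 3 → ZMod 2
  | .inl i, j => if j = i then 1 else 0
  | .inr (.inl i), j => if j = i + 2 then 0 else 1
  | .inr (.inr _), _ => 1

/-- The sign that relates a word to the ordered monomial. -/
def Word.sign (w : Word) : ℤ := if w = .inr (.inl 2) then -1 else 1

/-- Words list their generators in cyclic order, so `ξ_2 ξ_0` is the only one that differs in sign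
from the sorted monomial. -/
theorem Word.val_eq (w : Word) : w.val k = (w.sign : k) • mono k w.exps := by
  rcases w with i | i | i
  · fin_cases i <;> simp [Word.val, Word.sign, Word.exps, mono_eq_ofFn, factor, List.ofFn_succ]
  · fin_cases i
    · simp [Word.val, Word.sign, Word.exps, mono_eq_ofFn, factor, List.ofFn_succ]
    · simp [Word.val, Word.sign, Word.exps, mono_eq_ofFn, factor, List.ofFn_succ]
    · simpa [Word.val, Word.sign, Word.exps, mono_eq_ofFn, factor, List.ofFn_succ] using
        xi_mul_xi (k := k) (2 : Fin 3) 0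
  · simp [Word.val, Word.sign, Word.exps, mono_eq_ofFn, factor, List.ofFn_succ, mul_assoc]

theorem Word.exps_injective : ∀ w w' : Word, w.exps = w'.exps → w = w' := by decide

/-- The coefficients of the values of the basis trees at the words. -/
def Word.coeff : Word → Gen × Gen × Fin 3 → ℤ
  | .inl i, (.circ, .circ, l) => if i = l + 1 then 1 else 0
  | .inl i, (.circ, .circOp, l) => if i = l + 2 then -1 else 0
  | .inl i, (.circOp, .circ, l) => if i = l then -1 else 0
  | .inl i, (.circOp, .circOp, l) => if i = l then 1 else 0
  | .inr (.inl i), (.circ, .bul, l) => if i = l + 1 then 1 else 0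
  | .inr (.inl i), (.circOp, .bul, l) => if i = l + 1 then 0 else 1
  | .inr (.inl i), (.bul, .circ, l) => if i = l then -1 else 0
  | .inr (.inl i), (.bul, .circOp, l) => if i = l + 2 then -1 else 0
  | .inr (.inr _), (.bul, .bul, _) => -1
  | _, _ => 0

theorem involute_xi {X : Type} (x : X) :
    CliffordAlgebra.involute (xi x : Lam k X) = -xi x := involute_ι' _

/-- A finite computation over the 27 basis trees of the free operad in arity three. -/
theorem basisValue_eq (c : Gen × Gen × Fin 3) :
    basisValue k c = ∑ w : Word, (w.coeff c : k) • w.val k := by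
  obtain ⟨g, h, l⟩ := c
  have h3 : (-1 : ℤ).negOnePow = -1 := by decide
  have h10 := xi_mul_xi (k := k) (1 : Fin 3) 0
  have h21 := xi_mul_xi (k := k) (2 : Fin 3) 1
  have h02 := xi_mul_xi (k := k) (0 : Fin 3) 2
  have h120 : (xi 1 * xi 2 * xi 0 : Lam k (Fin 3)) = xi 0 * xi 1 * xi 2 := by
    rw [mul_assoc, xi_mul_xi 2 0, mul_neg, ← mul_assoc, h10, neg_mul, neg_neg]
  have h201 : (xi 2 * xi 0 * xi 1 : Lam k (Fin 3)) = xi 0 * xi 1 * xi 2 := by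
    rw [xi_mul_xi 2 0, neg_mul, mul_assoc, h21, mul_neg, neg_neg, mul_assoc]
  cases g <;> cases h <;> fin_cases l <;>
    simp [basisValue, ev, Fintype.sum_sum_type, Fin.sum_univ_three, Word.coeff, Word.val, eps_xi,
      eps_mul, BTree.degree, sg, h3, codeg, Gen.deg, involute_xi, add_mul, h10, h21, h02, h120,
      h201] <;> abel

/-- The coefficient of the value of a combination of trees at a word. -/
def wordCoef (w : Word) (x : TreeSpan k Gen 3) : k :=
  ∑ c, TreeSpan.comb Gen.swap (fun _ => -1) x c * (w.coeff c : k)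

theorem evSpan_eq_sum_word (x : TreeSpan k Gen 3) :
    evSpan 3 x = ∑ w : Word, wordCoef w x • w.val k := by
  simp only [evSpan_three, basisValue_eq, wordCoef, Finset.smul_sum, Finset.sum_smul, smul_smul]
  exact Finset.sum_comm

theorem wordCoef_eq_zero {x : TreeSpan k Gen 3} (hx : evSpan 3 x = 0) (w : Word) :
    wordCoef w x = 0 := by
  have h := congrArg (coef w.exps) hx
  rw [evSpan_eq_sum_word, map_sum, map_zero, Finset.sum_eq_single w] at h
  · rw [Word.val_eq, map_smul, map_smul, coef_mono, if_pos rfl] at h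
    have hs : (w.sign : k) ≠ 0 := by rw [Word.sign]; split_ifs <;> simp
    simpa [hs] using h
  · intro w' _ hw
    rw [Word.val_eq, map_smul, map_smul, coef_mono, if_neg, smul_zero, smul_zero]
    exact fun h => hw (Word.exps_injective _ _ h).symm
  · simp

/-- The coordinates of the tree `g(h(i, j), l)`. -/
def leftCoord (g h : Gen) (i j l : Fin 3) (c : Gen × Gen × Fin 3) : ℤ :=
  if j = i + 1 then (if (g, h, l) = c then 1 else 0) else if (g, h.swap, l) = c then 1 else 0

theorem comb_leftComb (g h : Gen) (σ τ : Equiv.Perm (Fin 3)) (c : Gen × Gen × Fin 3) :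
    TreeSpan.comb Gen.swap (fun _ => 1)
      (TreeSpan.perm τ (Finsupp.single (LTree.leftComb g h σ) (1 : k))) c =
      (leftCoord g h (τ (σ 0)) (τ (σ 1)) (τ (σ 2)) c : k) := by
  rw [TreeSpan.perm_single, TreeSpan.comb, Finsupp.linearCombination_single, one_smul]
  simp only [LTree.perm, LTree.leftComb, BTree.map, BTree.graft, TreeSpan.combTree, leftCoord]
  split_ifs with h1 h2 h2 <;> simp [h2]

theorem comb_rightComb (g h : Gen) (σ τ : Equiv.Perm (Fin 3)) (c : Gen × Gen × Fin 3) :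
    TreeSpan.comb Gen.swap (fun _ => 1)
      (TreeSpan.perm τ (Finsupp.single (LTree.rightComb g h σ) (1 : k))) c =
      (leftCoord g.swap h (τ (σ 1)) (τ (σ 2)) (τ (σ 0)) c : k) := by
  rw [TreeSpan.perm_single, TreeSpan.comb, Finsupp.linearCombination_single, one_smul]
  simp only [LTree.perm, LTree.rightComb, BTree.map, BTree.graft, TreeSpan.combTree, leftCoord]
  split_ifs with h1 h2 h2 <;> simp [h2]

/-- The coordinates of the relabelled relations of pre-Lie² algebras. -/
def relCoord (r : Fin 3) (i j l : Fin 3) (c : Gen × Gen × Fin 3) : ℤ :=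
  match r with
  | 0 => leftCoord .circ .circ i j l c - leftCoord .circOp .circ j l i c -
      leftCoord .circ .circ i l j c + leftCoord .circOp .circ l j i c
  | 1 => leftCoord .bul .bul i j l c + leftCoord .bul .bul j l i c + leftCoord .bul .bul l i j c
  | 2 => leftCoord .circ .bul i j l c + leftCoord .circOp .bul j l i c +
      leftCoord .circOp .bul i l j c - leftCoord .bul .circ i l j c - leftCoord .bul .circ j l i c

theorem comb_rel {r : TreeSpan k Gen 3} (hr : r ∈ (preLieSqOperad k).rel) :
    ∃ a : Fin 3, ∀ (τ : Equiv.Perm (Fin 3)) (c : Gen × Gen × Fin 3),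
      TreeSpan.comb Gen.swap (fun _ => 1) (TreeSpan.perm τ r) c =
        (relCoord a (τ 0) (τ 1) (τ 2) c : k) := by
  rcases hr with rfl | rfl | rfl
  · refine ⟨0, fun τ c => ?_⟩
    simp only [map_add, map_sub, Finsupp.add_apply, Finsupp.sub_apply, comb_leftComb,
      comb_rightComb, relCoord]
    push_cast
    rfl
  · refine ⟨1, fun τ c => ?_⟩
    simp only [map_add, Finsupp.add_apply, comb_leftComb, relCoord]
    push_cast
    rfl
  · refine ⟨2, fun τ c => ?_⟩
    simp only [map_add, map_sub, Finsupp.add_apply, Finsupp.sub_apply, comb_leftComb,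
      comb_rightComb, relCoord]
    push_cast
    rfl

theorem exists_comb_rel (a : Fin 3) : ∃ r ∈ (preLieSqOperad k).rel,
    ∀ (τ : Equiv.Perm (Fin 3)) (c : Gen × Gen × Fin 3),
      TreeSpan.comb Gen.swap (fun _ => 1) (TreeSpan.perm τ r) c =
        (relCoord a (τ 0) (τ 1) (τ 2) c : k) := by
  fin_cases a
  · refine ⟨_, Or.inl rfl, fun τ c => ?_⟩
    simp only [map_add, map_sub, Finsupp.add_apply, Finsupp.sub_apply, comb_leftComb,
      comb_rightComb, relCoord]
    push_cast
    rfl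
  · refine ⟨_, Or.inr (Or.inl rfl), fun τ c => ?_⟩
    simp only [map_add, Finsupp.add_apply, comb_leftComb, relCoord]
    push_cast
    rfl
  · refine ⟨_, Or.inr (Or.inr rfl), fun τ c => ?_⟩
    simp only [map_add, map_sub, Finsupp.add_apply, Finsupp.sub_apply, comb_leftComb,
      comb_rightComb, relCoord]
    push_cast
    rfl

/-- The Koszul sign in the pairing of the free operads. -/
def pairSign (c : Gen × Gen × Fin 3) : ℤ := if c.1 = .bul ∧ c.2.1 = .bul then -1 else 1

/-- The computation that identifies the dual operad: a relabelled relation, paired with the Koszul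
sign, is a coefficient functional of the evaluation. The overall sign is encoded as `1 - 2 * s`. -/
theorem relCoord_eq_coeff : ∀ a i j l : Fin 3, [i, j, l].Nodup →
    ∃ w : Word, ∃ s : Fin 2, ∀ c, pairSign c * relCoord a i j l c = (1 - 2 * s : ℤ) * w.coeff c := by
  decide

/-- The converse, for which cyclic relabellings suffice. The two lemmas show that the annihilator of
the relations is cut out by the vanishing of the seven coefficients. -/
theorem coeff_eq_relCoord : ∀ w : Word, ∃ a i : Fin 3,
    ∀ c, w.coeff c = pairSign c * relCoord a i (i + 1) (i + 2) c := by
  decide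

end Relations

/-! ### Evaluation descends to the Koszul dual operad -/

section IdealBound

variable {k : Type u} [Field k]

theorem pairing_eq (x y : TreeSpan k Gen 3) : (preLieSqOperad k).pairing x y =
    ∑ c, TreeSpan.comb Gen.swap (fun _ => -1) x c *
      ((pairSign c : k) * TreeSpan.comb Gen.swap (fun _ => 1) y c) := by
  refine Finset.sum_congr rfl fun c _ => ?_
  have h : ((((preLieSqOperad k).deg c.2.1 * (preLieSqOperad k).deg c.1).negOnePow : ℤ) : k) =
      (pairSign c : k) := by
    obtain ⟨g, h, l⟩ := c
    congr 1
    cases g <;> cases h <;> rfl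
  rw [h, mul_comm (pairSign c : k), mul_assoc]
  rfl

/-- If the value is zero, every word coefficient vanishes by independence of the monomials, and the
pairing with any relabelled relation is such a coefficient up to sign. All rewriting rules for trees
come from this lemma. -/
theorem mem_rel_of_evSpan_eq_zero {x : TreeSpan k Gen 3} {d : ℤ}
    (hd : x ∈ TreeSpan.homogeneous k codeg 3 d) (hx : evSpan 3 x = 0) : x ∈ (dualOperad k).rel := by
  refine ⟨⟨d, hd⟩, fun r hr τ => ?_⟩
  obtain ⟨a, ha⟩ := comb_rel hr
  have hn : [τ 0, τ 1, τ 2].Nodup := by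
    have : ([0, 1, 2] : List (Fin 3)).Nodup := by decide
    exact this.map τ.injective
  obtain ⟨w, s, hw⟩ := relCoord_eq_coeff a _ _ _ hn
  have h : (preLieSqOperad k).pairing x (TreeSpan.perm τ r) =
      ((1 - 2 * s : ℤ) : k) * wordCoef w x := by
    rw [pairing_eq, wordCoef, Finset.mul_sum]
    refine Finset.sum_congr rfl fun c _ => ?_
    rw [ha, ← Int.cast_mul, hw, Int.cast_mul]
    ring
  rw [h, wordCoef_eq_zero hx, mul_zero]

theorem evSpan_of_mem_rel {x : TreeSpan k Gen 3} (hx : x ∈ (dualOperad k).rel) :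
    evSpan 3 x = 0 := by
  rw [evSpan_eq_sum_word]
  refine Finset.sum_eq_zero fun w _ => ?_
  obtain ⟨a, i, hw⟩ := coeff_eq_relCoord w
  obtain ⟨r, hr, ha⟩ := exists_comb_rel (k := k) a
  -- The rotation by `i`, which realises the cyclic relabelling supplied by `coeff_eq_relCoord`.
  obtain ⟨τ, h0, h1, h2⟩ : ∃ τ : Equiv.Perm (Fin 3), τ 0 = i ∧ τ 1 = i + 1 ∧ τ 2 = i + 2 :=
    ⟨Equiv.addLeft i, by simp, by simp, by simp⟩
  have h := hx.2 r hr τ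
  have : wordCoef w x = (preLieSqOperad k).pairing x (TreeSpan.perm τ r) := by
    rw [pairing_eq, wordCoef]
    refine Finset.sum_congr rfl fun c _ => ?_
    rw [ha, ← Int.cast_mul, hw, h0, h1, h2]
  rw [this, h, zero_smul]

/-- The kernel is an ideal, so only the relators need to be checked: the symmetry of the generators,
and the annihilator of the relations. -/
theorem ideal_le_ker_evSpan (n : ℕ) : (dualOperad k).ideal n ≤ LinearMap.ker (evSpan n) := by
  intro x hx
  refine (dualOperad k).mem_ideal.1 hx (fun n => LinearMap.ker (evSpan n)) isIdeal_ker_evSpan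
    fun m y hy => ?_
  cases hy with
  | symm g =>
    rw [LinearMap.mem_ker, map_sub, evSpan_single, evSpan_single, one_smul, sub_eq_zero]
    have := ev_node_swap (k := k) g (1 : Fin 2) 0
    refine this.trans ?_
    rw [← neg_one_smul k]
    congr 1
    change (-1 : k) = (((-1 : ℤˣ) : ℤ) : k)
    simp
  | rel r hr => exact evSpan_of_mem_rel hr

/-! ## Identities among trees with arbitrary labels -/

/-- Relabelling of the leaves of standard trees. -/
def relabel {m : ℕ} {X : Type} (f : Fin m → X) : TreeSpan k Gen m →ₗ[k] (BTree Gen X →₀ k) :=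
  Finsupp.lmapDomain k k fun t => t.1.map f

theorem relabel_single {m : ℕ} {X : Type} (f : Fin m → X) (t : LTree Gen m) (c : k) :
    relabel f (Finsupp.single t c) = Finsupp.single (t.1.map f) c := by
  simp [relabel]

variable (k) in
/-- The combinations of trees with labels in `X` that vanish in every algebra over the operad. -/
def identities (X : Type) : Submodule k (BTree Gen X →₀ k) :=
  ⨆ (m : ℕ) (f : Fin m → X), ((dualOperad k).ideal m).map (relabel f)

theorem relabel_mem {m : ℕ} {X : Type} (f : Fin m → X) {x : TreeSpan k Gen m}
    (hx : x ∈ (dualOperad k).ideal m) : relabel f x ∈ identities k X :=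
  Submodule.mem_iSup_of_mem m (Submodule.mem_iSup_of_mem f (Submodule.mem_map_of_mem hx))

theorem identities_induction {X : Type} {P : (BTree Gen X →₀ k) → Prop}
    (h : ∀ m (f : Fin m → X) x, x ∈ (dualOperad k).ideal m → P (relabel f x)) (zero : P 0)
    (add : ∀ x y, P x → P y → P (x + y)) {z : BTree Gen X →₀ k} (hz : z ∈ identities k X) :
    P z := by
  refine Submodule.iSup_induction _ (motive := P) hz (fun m y hy => ?_) zero add
  refine Submodule.iSup_induction _ (motive := P) hy (fun f y hy => ?_) zero add
  obtain ⟨x, hx, rfl⟩ := hy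
  exact h m f x hx

open Classical in
/-- The projection to the trees in which every label occurs exactly once. -/
def multilinearPart (k : Type u) [Field k] (n : ℕ) :
    (BTree Gen (Fin n) →₀ k) →ₗ[k] TreeSpan k Gen n :=
  Finsupp.linearCombination k fun t =>
    if h : t.IsMultilinear then Finsupp.single (⟨t, h⟩ : LTree Gen n) 1 else 0

theorem multilinearPart_of (n : ℕ) (t : LTree Gen n) (c : k) :
    multilinearPart k n (Finsupp.single t.1 c) = Finsupp.single t c := by
  rw [multilinearPart, Finsupp.linearCombination_single, dif_pos t.2]
  change c • (Finsupp.single t 1 : TreeSpan k Gen n) = _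
  rw [Finsupp.smul_single, smul_eq_mul, mul_one]

theorem multilinearPart_of_not {n : ℕ} {t : BTree Gen (Fin n)} (ht : ¬ t.IsMultilinear) (c : k) :
    multilinearPart k n (Finsupp.single t c) = 0 := by
  rw [multilinearPart, Finsupp.linearCombination_single, dif_neg ht, smul_zero]

/-- This returns from identities with arbitrary labels to the ideal. A bijective relabelling is a
permutation; a relabelling that is not bijective produces no tree with every label exactly once, so
its contribution is zero. -/
theorem multilinearPart_mem {n : ℕ} {z : BTree Gen (Fin n) →₀ k} (hz : z ∈ identities k (Fin n)) :
    multilinearPart k n z ∈ (dualOperad k).ideal n := by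
  refine identities_induction (P := fun z => multilinearPart k n z ∈ (dualOperad k).ideal n)
    (fun m f x hx => ?_) (by simp) (fun x y hx hy => by rw [map_add]; exact add_mem hx hy) hz
  by_cases hf : Function.Bijective f
  · have hmn : m = n := by simpa using Fintype.card_of_bijective hf
    subst hmn
    have : multilinearPart k m ∘ₗ relabel f = TreeSpan.perm (Equiv.ofBijective f hf) :=
      Finsupp.lhom_ext fun t c => by
        rw [LinearMap.comp_apply, relabel_single, TreeSpan.perm_single]
        exact multilinearPart_of _ (LTree.perm (Equiv.ofBijective f hf) t) c
    rw [← LinearMap.comp_apply, this]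
    exact (dualOperad k).isIdeal_ideal.perm_mem _ _ hx
  · have : multilinearPart k n ∘ₗ relabel f = 0 := by
      refine Finsupp.lhom_ext fun t c => ?_
      rw [LinearMap.comp_apply, relabel_single, multilinearPart_of_not, LinearMap.zero_apply]
      rintro ⟨h1, h2⟩
      rw [BTree.leaves_map] at h1 h2
      refine hf ⟨fun a b hab => ?_, fun y => ?_⟩
      · exact List.inj_on_of_nodup_map h1 (t.2.2 a) (t.2.2 b) hab
      · obtain ⟨a, -, ha⟩ := List.mem_map.1 (h2 y)
        exact ⟨a, ha⟩
    rw [← LinearMap.comp_apply, this]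
    exact zero_mem _

end IdealBound

/-! ### Substitution of arbitrary trees into the relations, and the rewriting rules -/

section Substitution

variable {k : Type u} [Field k] {X : Type}

theorem BTree.map_graft {O X Y Z : Type} (F : X → BTree O Y) (f : Y → Z) (t : BTree O X) :
    (t.graft F).map f = t.graft fun x => (F x).map f := by
  induction t with
  | leaf x => rfl
  | node g l r hl hr =>
    change BTree.node g ((l.graft F).map f) ((r.graft F).map f) = _
    rw [hl, hr]
    rfl

theorem BTree.graft_map {O X Y Z : Type} (f : X → Y) (F : Y → BTree O Z) (t : BTree O X) :
    (t.map f).graft F = t.graft fun x => F (f x) := by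
  induction t with
  | leaf x => rfl
  | node g l r hl hr =>
    change BTree.node g ((l.map f).graft F) ((r.map f).graft F) = _
    rw [hl, hr]
    rfl

theorem BTree.graft_leaf {O X Y : Type} (f : X → Y) (t : BTree O X) :
    (t.graft fun x => .leaf (f x)) = t.map f := rfl

/-- Every tree is a relabelling of one whose leaves are numbered without repetition. This reduces
substitution of arbitrary trees to operadic composition. -/
theorem BTree.exists_label {O X : Type} (t : BTree O X) :
    ∃ (m : ℕ) (s : LTree O (m + 1)) (α : Fin (m + 1) → X), s.1.map α = t := by
  induction t with
  | leaf x =>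
    exact ⟨0, ⟨.leaf 0, by simp [IsMultilinear, leaves, Fin.forall_fin_one]⟩, fun _ => x, rfl⟩
  | node g l r hl hr =>
    obtain ⟨a, l, α, rfl⟩ := hl
    obtain ⟨b, r, β, rfl⟩ := hr
    refine ⟨(a + 1) + b, ⟨.node g (l.1.map (Fin.castAdd (b + 1))) (r.1.map (Fin.natAdd (a + 1))),
      ?_, fun x => ?_⟩, Fin.append (m := a + 1) (n := b + 1) α β, ?_⟩
    · rw [leaves, leaves_map, leaves_map, List.nodup_append']
      refine ⟨l.2.1.map (Fin.castAdd_injective _ _), r.2.1.map (Fin.natAdd_injective _ _), ?_⟩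
      intro x hx hx'
      obtain ⟨y, -, rfl⟩ := List.mem_map.1 hx
      obtain ⟨z, -, hz⟩ := List.mem_map.1 hx'
      have := congrArg Fin.val hz
      simp only [Fin.val_natAdd, Fin.val_castAdd] at this
      omega
    · rw [leaves, leaves_map, leaves_map, List.mem_append]
      refine Fin.addCases (m := a + 1) (n := b + 1) (fun y => ?_) (fun y => ?_) x
      · exact Or.inl (List.mem_map_of_mem (l.2.2 y))
      · exact Or.inr (List.mem_map_of_mem (r.2.2 y))
    · change BTree.node g ((l.1.map _).map _) ((r.1.map _).map _) = _
      rw [map_map, map_map]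
      congr 2
      · exact funext fun y => Fin.append_left α β y
      · exact funext fun y => Fin.append_right α β y

/-- The relabelling depends on the labels and the position only, not on the two trees, so it can be
applied to linear combinations. -/
theorem exists_comp_map {n m : ℕ} (i : Fin (n + 1)) (φ : Fin (n + 1) → X) (α : Fin m → X) :
    ∃ f : Fin (n + m) → X, ∀ (t : LTree Gen (n + 1)) (s : LTree Gen m),
      (LTree.comp i t s).1.map f =
        t.1.graft (Function.update (fun j => .leaf (φ j)) i (s.1.map α)) := by
  refine ⟨fun x => if h : (x : ℕ) < i then φ ⟨x, by omega⟩
    else if h' : (x : ℕ) < i + m then α ⟨x - i, by omega⟩ else φ ⟨x + 1 - m, by omega⟩,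
    fun t s => ?_⟩
  rw [LTree.comp, BTree.map_graft]
  congr 1
  funext j
  by_cases hj : j = i
  · subst hj
    rw [Function.update_self, LTree.compAt, dif_pos rfl, BTree.map_map]
    congr 1
    funext l
    have hl := l.2
    simp [LTree.innerLabel]
  · rw [Function.update_of_ne hj, LTree.compAt, dif_neg hj]
    have hne : (j : ℕ) ≠ i := fun h' => hj (Fin.ext h')
    change BTree.leaf _ = BTree.leaf _
    congr 1
    rw [LTree.outerLabel]
    by_cases hlt : j < i
    · have : (j : ℕ) < i := hlt
      simp [hlt]
    · have h1 : ¬ (j : ℕ) < i := hlt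
      have h2 : ¬ ((j : ℕ) - 1 + m < i) ∨ m = 0 := by omega
      simp only [hlt, dif_neg, not_false_eq_true]
      have h3 : ¬ ((j : ℕ) - 1 + m < i) := by omega
      have h4 : ¬ ((j : ℕ) - 1 + m < i + m) := by omega
      rw [dif_neg h3, dif_neg h4]
      congr 1
      exact Fin.ext (by simp only; omega)

/-- Substitution of a tree for a leaf in the elements of the ideal of relations. -/
theorem graft_mem {n : ℕ} (i : Fin (n + 1)) (φ : Fin (n + 1) → X) (B : BTree Gen X)
    {x : TreeSpan k Gen (n + 1)} (hx : x ∈ (dualOperad k).ideal (n + 1)) :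
    Finsupp.linearCombination k (fun t : LTree Gen (n + 1) =>
      (Finsupp.single (t.1.graft (Function.update (fun j => .leaf (φ j)) i B))
        (sg k (B.degree codeg * t.1.degreeAfter codeg i)) : BTree Gen X →₀ k)) x ∈
      identities k X := by
  obtain ⟨m, s, α, rfl⟩ := B.exists_label
  obtain ⟨f, hf⟩ := exists_comp_map (m := m + 1) i φ α
  have h : relabel f (TreeSpan.comp codeg i x (Finsupp.single s 1)) ∈ identities k X :=
    relabel_mem f ((dualOperad k).isIdeal_ideal.comp_left i x hx (Finsupp.single s 1))
  convert h using 1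
  refine LinearMap.congr_fun (g := relabel f ∘ₗ (TreeSpan.comp codeg i).flip (Finsupp.single s 1))
    (Finsupp.lhom_ext fun t c => ?_) x
  rw [Finsupp.linearCombination_single, LinearMap.comp_apply, LinearMap.flip_apply,
    TreeSpan.comp_single, relabel_single, hf, Finsupp.smul_single, smul_eq_mul, one_mul,
    BTree.degree_map]
  rfl

/-- Substitution of elements of the ideal of relations for a leaf of a tree. -/
theorem graft_ideal_mem {n m : ℕ} (i : Fin (n + 1)) (φ : Fin (n + 1) → X) (α : Fin m → X)
    (t : LTree Gen (n + 1)) (ht : t.1.degreeAfter codeg i = 0) {x : TreeSpan k Gen m}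
    (hx : x ∈ (dualOperad k).ideal m) :
    Finsupp.lmapDomain k k (fun s : LTree Gen m =>
      t.1.graft (Function.update (fun j => .leaf (φ j)) i (s.1.map α))) x ∈ identities k X := by
  obtain ⟨f, hf⟩ := exists_comp_map (m := m) i φ α
  have h : relabel f (TreeSpan.comp codeg i (Finsupp.single t 1) x) ∈ identities k X :=
    relabel_mem f ((dualOperad k).isIdeal_ideal.comp_right i (Finsupp.single t 1) x hx)
  convert h using 1
  refine LinearMap.congr_fun (g := relabel f ∘ₗ TreeSpan.comp codeg i (Finsupp.single t 1))
    (Finsupp.lhom_ext fun s c => ?_) x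
  rw [Finsupp.lmapDomain_apply, Finsupp.mapDomain_single, LinearMap.comp_apply,
    TreeSpan.comp_single, relabel_single, hf, ht]
  simp

/-- The linear map `t ↦ g(t, y)` for a leaf `y`. -/
def nodeLeaf (k : Type u) [Field k] (g : Gen) (y : X) : (BTree Gen X →₀ k) →ₗ[k] (BTree Gen X →₀ k) :=
  Finsupp.lmapDomain k k fun t => .node g t (.leaf y)

/-- The linear map `t ↦ g(l, t)`. -/
def nodeRight (k : Type u) [Field k] (g : Gen) (l : BTree Gen X) :
    (BTree Gen X →₀ k) →ₗ[k] (BTree Gen X →₀ k) :=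
  Finsupp.lmapDomain k k fun t => .node g l t

theorem nodeLeaf_single (g : Gen) (y : X) (t : BTree Gen X) (c : k) :
    nodeLeaf k g y (Finsupp.single t c) = Finsupp.single (.node g t (.leaf y)) c := by
  simp [nodeLeaf]

theorem nodeRight_single (g : Gen) (l t : BTree Gen X) (c : k) :
    nodeRight k g l (Finsupp.single t c) = Finsupp.single (.node g l t) c := by
  simp [nodeRight]

theorem nodeLeaf_mem (g : Gen) (y : X) {z : BTree Gen X →₀ k} (hz : z ∈ identities k X) :
    nodeLeaf k g y z ∈ identities k X := by
  refine identities_induction (P := fun z => nodeLeaf k g y z ∈ identities k X)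
    (fun m f x hx => ?_) (by simp) (fun x y hx hy => by rw [map_add]; exact add_mem hx hy) hz
  have h := graft_ideal_mem (0 : Fin 2) (fun _ => y) f (LTree.corolla g)
    (by simp [LTree.corolla, BTree.degreeAfter, BTree.leaves, BTree.degree]) hx
  convert h using 1
  rw [nodeLeaf, relabel, ← LinearMap.comp_apply, ← Finsupp.lmapDomain_comp]
  rfl

theorem nodeRight_mem (g : Gen) (l : BTree Gen X) {z : BTree Gen X →₀ k}
    (hz : z ∈ identities k X) : nodeRight k g l z ∈ identities k X := by
  obtain ⟨a, l, β, rfl⟩ := l.exists_label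
  refine identities_induction (P := fun z => nodeRight k g (l.1.map β) z ∈ identities k X)
    (fun m f x hx => ?_) (by simp) (fun x y hx hy => by rw [map_add]; exact add_mem hx hy) hz
  have hlast : Fin.last (a + 1) ∉ (l.1.map Fin.castSucc).leaves := fun h => by
    rw [BTree.leaves_map] at h
    obtain ⟨b, -, hb⟩ := List.mem_map.1 h
    exact (Fin.castSucc_lt_last b).ne hb
  have h := graft_ideal_mem (Fin.last (a + 1)) (Fin.snoc β (β 0) : Fin (a + 2) → X) f
    (⟨.node g (l.1.map Fin.castSucc) (.leaf (Fin.last (a + 1))), by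
      rw [BTree.leaves, List.nodup_append']
      refine ⟨?_, by simp [BTree.leaves], by simpa [BTree.leaves] using hlast⟩
      rw [BTree.leaves_map]
      exact l.2.1.map (Fin.castSucc_injective _), fun x => by
      rw [BTree.leaves, List.mem_append, BTree.leaves_map]
      refine Fin.lastCases (Or.inr (by simp [BTree.leaves])) (fun y => ?_) x
      exact Or.inl (List.mem_map_of_mem (l.2.2 y))⟩)
    (by simp [BTree.degreeAfter, hlast]) hx
  convert h using 1
  rw [nodeRight, relabel, ← LinearMap.comp_apply, ← Finsupp.lmapDomain_comp]
  congr 2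
  funext s
  simp only [Function.comp_apply, BTree.graft, Function.update_self, BTree.graft_map]
  congr 1
  rw [← BTree.graft_leaf]
  congr 1
  funext j
  rw [Function.update_of_ne (Fin.castSucc_lt_last j).ne, Fin.snoc_castSucc]

/-- Substitution of `A`, `y` and `z` for the leaves of left combs. -/
theorem exists_left_subst (A : BTree Gen X) (y z : X) :
    ∃ Θ : TreeSpan k Gen 3 →ₗ[k] (BTree Gen X →₀ k),
      (∀ x ∈ (dualOperad k).ideal 3, Θ x ∈ identities k X) ∧
      (∀ g h c, Θ (Finsupp.single (LTree.leftComb g h 1) c) =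
        Finsupp.single (.node g (.node h A (.leaf y)) (.leaf z)) c) ∧
      (∀ g h c, Θ (Finsupp.single (LTree.leftComb g h (Equiv.swap 1 2)) c) =
        Finsupp.single (.node g (.node h A (.leaf z)) (.leaf y)) c) := by
  refine ⟨_, fun x hx => graft_mem (0 : Fin 3) ![y, y, z] A hx, fun g h c => ?_, fun g h c => ?_⟩
  · rw [Finsupp.linearCombination_single]
    simp [LTree.leftComb, LTree.perm, BTree.map, BTree.graft, BTree.degreeAfter, BTree.leaves,
      BTree.degree, sg_zero]
  · rw [Finsupp.linearCombination_single]
    simp [LTree.leftComb, LTree.perm, BTree.map, BTree.graft, BTree.degreeAfter, BTree.leaves,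
      BTree.degree, sg_zero, Equiv.swap_apply_of_ne_of_ne]

/-- Substitution of `A`, `B` and `y` for the leaves of combs. -/
theorem exists_comb_subst (A B : BTree Gen X) (y : X) :
    ∃ Θ : TreeSpan k Gen 3 →ₗ[k] (BTree Gen X →₀ k),
      (∀ x ∈ (dualOperad k).ideal 3, Θ x ∈ identities k X) ∧
      (∀ g h c, Θ (Finsupp.single (LTree.leftComb g h 1) c) =
        Finsupp.single (.node g (.node h A B) (.leaf y)) c) ∧
      (∀ g h c, Θ (Finsupp.single (LTree.rightComb g h 1) c) =
        Finsupp.single (.node g A (.node h B (.leaf y))) (sg k (A.degree codeg * codeg h) * c)) := by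
  obtain ⟨m, b, β, rfl⟩ := B.exists_label
  -- After `B` is inserted at the middle leaf, its leaves have the numbers `1` to `m + 1`; the last
  -- leaf is `y`. The leaf `0` also gets `y`, but will be replaced by `A`.
  let φ : Fin (2 + m + 1) → X := fun x =>
    if h : 1 ≤ (x : ℕ) ∧ (x : ℕ) < m + 2 then β ⟨x - 1, by omega⟩ else y
  have hφ : ∀ l : Fin (m + 1), φ (LTree.innerLabel (n := 2) 1 l) = β l := fun l => by
    have hl := l.2
    simp only [φ, LTree.innerLabel]
    rw [dif_pos ⟨by simp, by simp; omega⟩]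
    simp
  have hlast : φ (Fin.last (2 + m)) = y := dif_neg fun h => by
    simp only [Fin.val_last] at h
    omega
  have hgraft : (b.1.map (LTree.innerLabel (n := 2) (m := m + 1) 1)).graft
      (Function.update (fun j => .leaf (φ j)) (0 : Fin (2 + m + 1)) A) = b.1.map β := by
    rw [BTree.graft_map, ← BTree.graft_leaf]
    congr 1
    funext l
    rw [Function.update_of_ne, hφ]
    intro h
    have := congrArg Fin.val h
    simp [LTree.innerLabel] at this
  have hmem : (0 : Fin (2 + m + 1)) ∉ (b.1.map (LTree.innerLabel (n := 2) (m := m + 1) 1)).leaves := by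
    rw [BTree.leaves_map]
    intro h
    obtain ⟨l, -, hl⟩ := List.mem_map.1 h
    have := congrArg Fin.val hl
    simp [LTree.innerLabel] at this
  have h0 : ∀ h, LTree.outerLabel (n := 2) (m + 1) 1 0 h = (0 : Fin (2 + m + 1)) := fun h => by
    simp [LTree.outerLabel]
  have h2 : ∀ h, LTree.outerLabel (n := 2) (m + 1) 1 2 h = Fin.last (2 + m) := fun h => by
    refine Fin.ext ?_
    simp [LTree.outerLabel]
    omega
  have hl : ∀ g h, (LTree.comp 1 (LTree.leftComb g h 1) b).1 =
      .node g (.node h (.leaf (0 : Fin (2 + m + 1))) (b.1.map (LTree.innerLabel 1)))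
        (.leaf (Fin.last (2 + m))) := fun g h => by
    simp [LTree.comp, LTree.leftComb, LTree.perm, BTree.map, BTree.graft, LTree.compAt, h0, h2]
  have hr : ∀ g h, (LTree.comp 1 (LTree.rightComb g h 1) b).1 =
      .node g (.leaf (0 : Fin (2 + m + 1))) (.node h (b.1.map (LTree.innerLabel 1))
        (.leaf (Fin.last (2 + m)))) := fun g h => by
    simp [LTree.comp, LTree.rightComb, LTree.perm, BTree.map, BTree.graft, LTree.compAt, h0, h2]
  have hne : Fin.last (2 + m) ≠ 0 := fun h => by
    have := congrArg Fin.val h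
    simp at this
  let Γ : TreeSpan k Gen (2 + m + 1) →ₗ[k] (BTree Gen X →₀ k) := Finsupp.linearCombination k
    fun t => Finsupp.single (t.1.graft (Function.update (fun j => .leaf (φ j)) 0 A))
      (sg k (A.degree codeg * t.1.degreeAfter codeg 0))
  have hΓ : ∀ t c, Γ (Finsupp.single t c) = c • Finsupp.single (t.1.graft (Function.update
      (fun j => .leaf (φ j)) 0 A)) (sg k (A.degree codeg * t.1.degreeAfter codeg 0)) :=
    fun t c => Finsupp.linearCombination_single _ _ _
  -- The prefactor cancels the sign by which `A` passes the decorations of `B`. In a right comb `A`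
  -- also passes the inner generator, which leaves the sign in the last clause.
  refine ⟨sg k (A.degree codeg * b.1.degree codeg) • Γ ∘ₗ
    (TreeSpan.comp (m := m + 1) codeg (1 : Fin 3)).flip (Finsupp.single b 1),
    fun x hx => ?_, fun g h c => ?_, fun g h c => ?_⟩
  · exact Submodule.smul_mem _ _ (graft_mem (n := 2 + m) 0 φ A
      ((dualOperad k).isIdeal_ideal.comp_left 1 x hx (Finsupp.single b 1)))
  · rw [LinearMap.smul_apply, LinearMap.comp_apply, LinearMap.flip_apply, TreeSpan.comp_single,
      hΓ, hl]
    simp only [BTree.graft, hgraft, Function.update_self, Function.update_of_ne hne, hlast,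
      BTree.degreeAfter, BTree.leaves, List.mem_append, List.mem_singleton, true_or, if_true,
      Finsupp.smul_single, smul_eq_mul, BTree.degree, BTree.degree_map, zero_add, add_zero]
    congr 1
    have : BTree.degreeAfter codeg 1 (LTree.leftComb g h 1).1 = 0 := by
      simp [LTree.leftComb, LTree.perm, BTree.map, BTree.graft, BTree.degreeAfter, BTree.leaves,
        BTree.degree]
    rw [this]
    simp only [mul_zero, Int.negOnePow_zero, Units.val_one, Int.cast_one, mul_one]
    rw [mul_left_comm, sg_mul_self, mul_one]
  · rw [LinearMap.smul_apply, LinearMap.comp_apply, LinearMap.flip_apply, TreeSpan.comp_single,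
      hΓ, hr]
    simp only [BTree.graft, hgraft, Function.update_self, Function.update_of_ne hne, hlast,
      BTree.degreeAfter, BTree.leaves, List.mem_singleton, if_true,
      Finsupp.smul_single, smul_eq_mul, BTree.degree, BTree.degree_map, zero_add, add_zero]
    congr 1
    have : BTree.degreeAfter codeg 1 (LTree.rightComb g h 1).1 = 0 := by
      simp [LTree.rightComb, LTree.perm, BTree.map, BTree.graft, BTree.degreeAfter, BTree.leaves,
        BTree.degree]
    rw [this]
    simp only [mul_zero, Int.negOnePow_zero, Units.val_one, Int.cast_one, mul_one]
    rw [mul_add, sg_add]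
    linear_combination (c * sg k (A.degree codeg * codeg h)) *
      sg_mul_self k (A.degree codeg * b.1.degree codeg)

/-! ## Combs -/

/-- Each two-term rewriting rule below is an equality of values in the exterior algebra. -/
theorem comb_mem_rel {g h g' h' : Gen} (hd : codeg g + codeg h = codeg g' + codeg h')
    {t t' : LTree Gen 3} (ht : t.degree codeg = codeg g + codeg h)
    (ht' : t'.degree codeg = codeg g' + codeg h') {c c' : k}
    (hev : c • ev k t.1 + c' • ev k t'.1 = 0) :
    Finsupp.single t c + Finsupp.single t' c' ∈ (dualOperad k).ideal 3 := by
  refine (dualOperad k).mem_ideal.2 fun I _ hI => hI 3 _ (.rel _ (mem_rel_of_evSpan_eq_zero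
    (d := codeg g + codeg h) ?_ ?_))
  · exact add_mem (Finsupp.single_mem_supported k _ ht)
      (Finsupp.single_mem_supported k _ (ht'.trans hd.symm))
  · rw [map_add, evSpan_single, evSpan_single, hev]

theorem degree_leftComb (g h : Gen) (σ : Equiv.Perm (Fin 3)) :
    (LTree.leftComb g h σ).degree codeg = codeg g + codeg h := by
  simp [LTree.leftComb, LTree.degree, LTree.perm, BTree.degree_map, BTree.degree]

theorem degree_rightComb (g h : Gen) (σ : Equiv.Perm (Fin 3)) :
    (LTree.rightComb g h σ).degree codeg = codeg g + codeg h := by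
  simp [LTree.rightComb, LTree.degree, LTree.perm, BTree.degree_map, BTree.degree]

theorem ev_leftComb (g h : Gen) (σ : Equiv.Perm (Fin 3)) : ev k (LTree.leftComb g h σ).1 =
    ev k (.node g (.node h (.leaf (σ 0)) (.leaf (σ 1))) (.leaf (σ 2))) := rfl

theorem ev_rightComb (g h : Gen) (σ : Equiv.Perm (Fin 3)) : ev k (LTree.rightComb g h σ).1 =
    ev k (.node g (.leaf (σ 0)) (.node h (.leaf (σ 1)) (.leaf (σ 2)))) := rfl

theorem right_circ_circ : Finsupp.single (LTree.rightComb .circ .circ 1) (1 : k) +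
    Finsupp.single (LTree.leftComb .circ .circ 1) (-1) ∈ (dualOperad k).ideal 3 := by
  refine comb_mem_rel (by rfl) (degree_rightComb _ _ _) (degree_leftComb _ _ _) ?_
  simp [ev_leftComb, ev_rightComb, ev, eps_xi]

theorem right_bul_circ : Finsupp.single (LTree.rightComb .bul .circ 1) (1 : k) +
    Finsupp.single (LTree.leftComb .circ .bul 1) (-1) ∈ (dualOperad k).ideal 3 := by
  refine comb_mem_rel (by rfl) (degree_rightComb _ _ _) (degree_leftComb _ _ _) ?_
  simp [ev_leftComb, ev_rightComb, ev, eps_xi, BTree.degree, sg_zero]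

theorem right_bul_bul : Finsupp.single (LTree.rightComb .bul .bul 1) (1 : k) +
    Finsupp.single (LTree.leftComb .bul .bul 1) 1 ∈ (dualOperad k).ideal 3 := by
  refine comb_mem_rel (by rfl) (degree_rightComb _ _ _) (degree_leftComb _ _ _) ?_
  simp [ev_leftComb, ev_rightComb, ev, BTree.degree, sg_zero, sg_neg k, sg_one k, codeg, Gen.deg,
    mul_assoc]

/-- The one rule with three terms: `eps` is a derivation, so `ξ_0 · eps (ξ_1 ξ_2) = ξ_0 ξ_2 - ξ_0
ξ_1`. -/
theorem right_circ_bul : Finsupp.single (LTree.rightComb .circ .bul 1) (1 : k) +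
    (Finsupp.single (LTree.leftComb .bul .circ 1) (-1) +
      Finsupp.single (LTree.leftComb .circ .bul 1) 1) ∈ (dualOperad k).ideal 3 := by
  refine (dualOperad k).mem_ideal.2 fun I _ hI => hI 3 _ (.rel _ (mem_rel_of_evSpan_eq_zero
    (d := codeg .circ + codeg .bul) ?_ ?_))
  · exact add_mem (Finsupp.single_mem_supported k _ (degree_rightComb _ _ _))
      (add_mem (Finsupp.single_mem_supported k _ (degree_leftComb _ _ _))
        (Finsupp.single_mem_supported k _ (degree_leftComb _ _ _)))
  · rw [map_add, map_add, evSpan_single, evSpan_single, evSpan_single]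
    simp [ev_leftComb, ev_rightComb, ev, eps_xi, eps_mul, BTree.degree, sg_zero, codeg, Gen.deg,
      involute_xi, mul_add]
    abel

/-- Rewrites an opposite product with a comb on the right so that the outermost step of the comb
becomes the outermost vertex. Comb steps never use `circOp`, so excluding it costs nothing. -/
theorem right_circOp (b : Gen) (hb : b ≠ .circOp) :
    Finsupp.single (LTree.rightComb .circOp b 1) (1 : k) +
      Finsupp.single (LTree.leftComb b .circOp 1) (-1) ∈ (dualOperad k).ideal 3 := by
  refine comb_mem_rel (add_comm _ _) (degree_rightComb _ _ _) (degree_leftComb _ _ _) ?_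
  cases b
  · simp [ev_leftComb, ev_rightComb, ev, eps_xi, BTree.degree, sg_zero]
  · exact absurd rfl hb
  · simp [ev_leftComb, ev_rightComb, ev, eps_xi, BTree.degree, sg_zero, codeg, Gen.deg]

/-- Together with the next two rules this exchanges two consecutive steps of a left comb. -/
theorem left_circ_circ_swap : Finsupp.single (LTree.leftComb .circ .circ 1) (1 : k) +
    Finsupp.single (LTree.leftComb .circ .circ (Equiv.swap 1 2)) (-1) ∈
      (dualOperad k).ideal 3 := by
  refine comb_mem_rel (by rfl) (degree_leftComb _ _ _) (degree_leftComb _ _ _) ?_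
  simp [ev_leftComb, ev, eps_xi, Equiv.swap_apply_of_ne_of_ne]

theorem left_circ_bul_swap : Finsupp.single (LTree.leftComb .circ .bul 1) (1 : k) +
    Finsupp.single (LTree.leftComb .bul .circ (Equiv.swap 1 2)) (-1) ∈
      (dualOperad k).ideal 3 := by
  refine comb_mem_rel (by rfl) (degree_leftComb _ _ _) (degree_leftComb _ _ _) ?_
  simp [ev_leftComb, ev, eps_xi, Equiv.swap_apply_of_ne_of_ne, BTree.degree, sg_zero, codeg,
    Gen.deg]

theorem left_bul_bul_swap : Finsupp.single (LTree.leftComb .bul .bul 1) (1 : k) +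
    Finsupp.single (LTree.leftComb .bul .bul (Equiv.swap 1 2)) 1 ∈
      (dualOperad k).ideal 3 := by
  refine comb_mem_rel (by rfl) (degree_leftComb _ _ _) (degree_leftComb _ _ _) ?_
  simp [ev_leftComb, ev, Equiv.swap_apply_of_ne_of_ne, BTree.degree, sg_zero, codeg,
    Gen.deg, sg_one k, sg_neg k, mul_assoc, xi_mul_xi (k := k) (2 : Fin 3) 1]

end Substitution

section Combs

variable {k : Type u} [Field k] {X : Type}

/-- The generator that a step of a comb applies. -/
def combGen (b : Bool) : Gen := if b then .bul else .circ

/-- The left comb that starts with the leaf `z` and in which the last list entry is applied first. -/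
def comb (z : X) : List (Bool × X) → BTree Gen X
  | [] => .leaf z
  | (b, y) :: ℓ => .node (combGen b) (comb z ℓ) (.leaf y)

variable (k X) in
/-- The combinations of trees that are congruent to combinations of combs. -/
def combSpan : Submodule k (BTree Gen X →₀ k) :=
  identities k X ⊔ Submodule.span k {x | ∃ z ℓ, x = Finsupp.single (comb z ℓ) 1}

theorem identities_le_combSpan : identities k X ≤ combSpan k X := le_sup_left

theorem comb_mem_combSpan (z : X) (ℓ : List (Bool × X)) (c : k) :
    Finsupp.single (comb z ℓ) c ∈ combSpan k X := by
  have : Finsupp.single (comb z ℓ) c = c • Finsupp.single (comb z ℓ) 1 := by simp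
  rw [this]
  exact Submodule.smul_mem _ _ (Submodule.mem_sup_right (Submodule.subset_span ⟨z, ℓ, rfl⟩))

theorem single_mem_of_one {S : Submodule k (BTree Gen X →₀ k)} {t : BTree Gen X}
    (h : Finsupp.single t 1 ∈ S) (c : k) : Finsupp.single t c ∈ S := by
  have : Finsupp.single t c = c • Finsupp.single t (1 : k) := by simp
  rw [this]
  exact Submodule.smul_mem _ _ h

/-- A linear map that preserves the identities and maps combs into `S` maps `combSpan` into `S`. -/
theorem map_combSpan {S : Submodule k (BTree Gen X →₀ k)} (hS : identities k X ≤ S)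
    (f : (BTree Gen X →₀ k) →ₗ[k] (BTree Gen X →₀ k))
    (hf : ∀ x ∈ identities k X, f x ∈ identities k X)
    (hc : ∀ z ℓ, f (Finsupp.single (comb z ℓ) 1) ∈ S) {x : BTree Gen X →₀ k}
    (hx : x ∈ combSpan k X) : f x ∈ S := by
  have h : combSpan k X ≤ S.comap f := by
    refine sup_le (fun x hx => hS (hf x hx)) (Submodule.span_le.2 ?_)
    rintro _ ⟨z, ℓ, rfl⟩
    exact hc z ℓ
  exact h hx

theorem nodeLeaf_combSpan (b : Bool) (y : X) {x : BTree Gen X →₀ k} (hx : x ∈ combSpan k X) :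
    nodeLeaf k (combGen b) y x ∈ combSpan k X := by
  refine map_combSpan identities_le_combSpan _ (fun x hx => nodeLeaf_mem _ _ hx) (fun z ℓ => ?_) hx
  rw [nodeLeaf_single]
  exact comb_mem_combSpan z ((b, y) :: ℓ) 1

theorem node_leaf_mem_combSpan (b : Bool) (y : X) {t : BTree Gen X}
    (h : Finsupp.single t (1 : k) ∈ combSpan k X) (c : k) :
    Finsupp.single (.node (combGen b) t (.leaf y)) c ∈ combSpan k X := by
  refine single_mem_of_one ?_ c
  rw [← nodeLeaf_single]
  exact nodeLeaf_combSpan b y h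

/-- Induction on the comb on the right: the rules for right combs move its outermost leaf to the
root, and the comb that remains on the right is shorter. -/
theorem node_comb_mem (l : BTree Gen X) (hl : Finsupp.single l (1 : k) ∈ combSpan k X) (z : X)
    (ℓ : List (Bool × X)) : ∀ b : Bool,
    Finsupp.single (.node (combGen b) l (comb z ℓ)) (1 : k) ∈ combSpan k X := by
  induction ℓ with
  | nil => exact fun b => node_leaf_mem_combSpan b z hl 1
  | cons p ℓ ih =>
    obtain ⟨b', y⟩ := p
    intro b
    obtain ⟨Θ, h1, h2, h3⟩ := exists_comb_subst (k := k) l (comb z ℓ) y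
    -- Substitution into a right comb produces a sign, which has to be divided out.
    have key : ∀ (a : k), a ≠ 0 → Finsupp.single (.node (combGen b) l (comb z ((b', y) :: ℓ))) a ∈
        combSpan k X → Finsupp.single (.node (combGen b) l (comb z ((b', y) :: ℓ))) 1 ∈
          combSpan k X := by
      intro a ha h
      have := Submodule.smul_mem _ a⁻¹ h
      rwa [Finsupp.smul_single, smul_eq_mul, inv_mul_cancel₀ ha] at this
    have left : ∀ (b₁ b₂ : Bool) (c : k),
        Θ (Finsupp.single (LTree.leftComb (combGen b₁) (combGen b₂) 1) c) ∈ combSpan k X := by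
      intro b₁ b₂ c
      rw [h2]
      exact node_leaf_mem_combSpan b₁ y (ih b₂) c
    have hs := sg_ne_zero k (l.degree codeg * codeg (combGen b'))
    have right : ∀ s, Finsupp.single (LTree.rightComb (combGen b) (combGen b') 1) (1 : k) + s ∈
        (dualOperad k).ideal 3 → Θ s ∈ combSpan k X →
        Finsupp.single (.node (combGen b) l (comb z ((b', y) :: ℓ))) (1 : k) ∈ combSpan k X := by
      intro s hs' hs''
      refine key _ hs ?_
      have h4 := sub_mem (identities_le_combSpan (h1 _ hs')) hs''
      rw [map_add, add_sub_cancel_right, h3, mul_one] at h4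
      exact h4
    cases b <;> cases b'
    · exact right _ right_circ_circ (left false false _)
    · refine right _ right_circ_bul ?_
      rw [map_add]
      exact add_mem (left true false _) (left false true _)
    · exact right _ right_bul_circ (left false true _)
    · exact right _ right_bul_bul (left true true _)

theorem node_mem_combSpan (b : Bool) (l r : BTree Gen X)
    (hl : Finsupp.single l (1 : k) ∈ combSpan k X) (hr : Finsupp.single r (1 : k) ∈ combSpan k X) :
    Finsupp.single (.node (combGen b) l r) (1 : k) ∈ combSpan k X := by
  rw [← nodeRight_single]
  refine map_combSpan identities_le_combSpan _ (fun x hx => nodeRight_mem _ _ hx) (fun z ℓ => ?_) hr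
  rw [nodeRight_single]
  exact node_comb_mem l hl z ℓ b

/-- The symmetry of the generators, with a tree substituted for the first input. -/
theorem swap_leaf_mem (g : Gen) (A : BTree Gen X) (y : X) :
    Finsupp.single (.node g (.leaf y) A) (1 : k) + Finsupp.single (.node g.swap A (.leaf y)) 1 ∈
      identities k X := by
  have h : Finsupp.single (LTree.corollaSwap g) 1 -
      Finsupp.single (LTree.corolla g.swap) (((-1 : ℤˣ) : ℤ) : k) ∈ (dualOperad k).ideal 2 :=
    (dualOperad k).mem_ideal.2 fun I _ h => h 2 _ (.symm g)
  have h' := graft_mem (0 : Fin 2) (fun _ => y) A h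
  rw [map_sub, Finsupp.linearCombination_single, Finsupp.linearCombination_single] at h'
  simpa [LTree.corolla, LTree.corollaSwap, BTree.graft, BTree.degreeAfter, BTree.leaves,
    BTree.degree, sg_zero] using h'

/-- For a single leaf on the right, the symmetry turns the opposite product into `circ`, which is
already covered. Longer combs are reduced by `right_circOp`. -/
theorem node_circOp_comb_mem (l : BTree Gen X) (hl : Finsupp.single l (1 : k) ∈ combSpan k X)
    (z : X) (ℓ : List (Bool × X)) :
    Finsupp.single (.node .circOp l (comb z ℓ)) (1 : k) ∈ combSpan k X := by
  induction ℓ with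
  | nil =>
    have h := sub_mem (identities_le_combSpan (swap_leaf_mem (k := k) .circ l z))
      (node_mem_combSpan false (.leaf z) l (comb_mem_combSpan z [] 1) hl)
    rwa [combGen, if_neg (by simp), add_sub_cancel_left] at h
  | cons p ℓ ih =>
    obtain ⟨b, y⟩ := p
    obtain ⟨Θ, h1, h2, h3⟩ := exists_comb_subst (k := k) l (comb z ℓ) y
    have h := h1 _ (right_circOp (k := k) (combGen b) (by cases b <;> simp [combGen]))
    rw [map_add, h2, h3] at h
    have h4 := sub_mem (identities_le_combSpan h) (node_leaf_mem_combSpan b y ih (-1))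
    rw [add_sub_cancel_right, mul_one] at h4
    have h5 := Submodule.smul_mem _ (sg k (l.degree codeg * codeg (combGen b))) h4
    rwa [Finsupp.smul_single, smul_eq_mul, sg_mul_self] at h5

/-- Structural induction: modulo the identities both subtrees may be taken to be combs. This is the
upper bound on the size of the dual operad. -/
theorem tree_mem_combSpan (t : BTree Gen X) : Finsupp.single t (1 : k) ∈ combSpan k X := by
  induction t with
  | leaf x => exact comb_mem_combSpan x [] 1
  | node g l r hl hr =>
    cases g with
    | circ => exact node_mem_combSpan false l r hl hr
    | bul => exact node_mem_combSpan true l r hl hr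
    | circOp =>
      rw [← nodeRight_single]
      refine map_combSpan identities_le_combSpan _ (fun x hx => nodeRight_mem _ _ hx)
        (fun z ℓ => ?_) hr
      rw [nodeRight_single]
      exact node_circOp_comb_mem l hl z ℓ

/-- It suffices to exchange neighbouring steps. The scalars are then products of signs, hence
nonzero. -/
theorem comb_perm {z : X} {ℓ ℓ' : List (Bool × X)} (h : ℓ.Perm ℓ') :
    ∃ c : k, c ≠ 0 ∧ Finsupp.single (comb z ℓ) 1 + Finsupp.single (comb z ℓ') c ∈
      identities k X := by
  induction h with
  | nil => exact ⟨-1, by simp, by rw [← Finsupp.single_add]; simp⟩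
  | cons p h ih =>
    obtain ⟨c, hc, ih⟩ := ih
    refine ⟨c, hc, ?_⟩
    have := nodeLeaf_mem (combGen p.1) p.2 ih
    rwa [map_add, nodeLeaf_single, nodeLeaf_single] at this
  | swap p q ℓ =>
    obtain ⟨b, y⟩ := q
    obtain ⟨b', y'⟩ := p
    change ∃ c : k, c ≠ 0 ∧
      (Finsupp.single (BTree.node (combGen b) (.node (combGen b') (comb z ℓ) (.leaf y'))
          (.leaf y)) (1 : k) +
        Finsupp.single (BTree.node (combGen b') (.node (combGen b) (comb z ℓ) (.leaf y))
          (.leaf y')) c : BTree Gen X →₀ k) ∈ identities k X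
    obtain ⟨Θ, h1, h2, h3⟩ := exists_left_subst (k := k) (comb z ℓ) y' y
    obtain ⟨Θ', h1', h2', h3'⟩ := exists_left_subst (k := k) (comb z ℓ) y y'
    cases b <;> cases b'
    · have := h1 _ left_circ_circ_swap
      rw [map_add, h2, h3] at this
      exact ⟨-1, by simp, this⟩
    · have := h1 _ left_circ_bul_swap
      rw [map_add, h2, h3] at this
      exact ⟨-1, by simp, this⟩
    -- The rule has `circ` outermost on its first term; here `bul` is outermost, so the rule is read
    -- backwards, with the two leaves interchanged.
    · have := Submodule.neg_mem _ (h1' _ left_circ_bul_swap)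
      rw [map_add, h2', h3', neg_add_rev, ← Finsupp.single_neg, ← Finsupp.single_neg, neg_neg] at this
      exact ⟨-1, by simp, this⟩
    · have := h1 _ left_bul_bul_swap
      rw [map_add, h2, h3] at this
      exact ⟨1, by simp, this⟩
  | trans _ _ ih ih' =>
    obtain ⟨c, hc, ih⟩ := ih
    obtain ⟨d, hd, ih'⟩ := ih'
    refine ⟨-(c * d), by simp [hc, hd], ?_⟩
    have := sub_mem ih (Submodule.smul_mem _ c ih')
    rw [smul_add, Finsupp.smul_single, Finsupp.smul_single, smul_eq_mul, smul_eq_mul, mul_one]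
      at this
    convert this using 1
    rw [Finsupp.single_neg]
    abel

end Combs

/-! ### Normal form of combs up to scalars -/

section CanonicalCombs

variable {k : Type u} [Field k]

theorem monoList_perm {X : Type} (ε : X → ZMod 2) {L L' : List X} (h : L.Perm L') :
    ∃ c : k, c ≠ 0 ∧ monoList k ε L = c • monoList k ε L' := by
  induction h with
  | nil => exact ⟨1, one_ne_zero, by simp⟩
  | cons x h ih =>
    obtain ⟨c, hc, ih⟩ := ih
    refine ⟨c, hc, ?_⟩
    rw [monoList, monoList] at *
    rw [List.map_cons, List.prod_cons, ih, List.map_cons, List.prod_cons, mul_smul_comm]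
  | swap x y L =>
    by_cases hxy : ε x = 1 ∧ ε y = 1
    · refine ⟨-1, by simp, ?_⟩
      simp only [monoList, List.map_cons, List.prod_cons, factor, hxy.1, hxy.2, if_true,
        ← mul_assoc]
      rw [xi_mul_xi y x, neg_mul, neg_one_smul]
    · refine ⟨1, one_ne_zero, ?_⟩
      simp only [monoList, List.map_cons, List.prod_cons, factor, one_smul]
      rcases not_and_or.1 hxy with h | h <;> simp [h]
  | trans _ _ ih ih' =>
    obtain ⟨c, hc, ih⟩ := ih
    obtain ⟨d, hd, ih'⟩ := ih'
    exact ⟨c * d, mul_ne_zero hc hd, by rw [ih, ih', smul_smul]⟩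

/-- A `circ` step multiplies by `eps ξ_y = 1` and a `bul` step multiplies by `ξ_y` up to sign, so
the value is the monomial in the initial leaf and the leaves attached by `bul`. -/
theorem ev_comb {X : Type} (ε : X → ZMod 2) {z : X} (hz : ε z = 1) (ℓ : List (Bool × X))
    (hℓ : ∀ p ∈ ℓ, p.1 = true ↔ ε p.2 = 1) :
    ∃ c : k, c ≠ 0 ∧ ev k (comb z ℓ) = c • monoList k ε (z :: ℓ.map Prod.snd) := by
  induction ℓ with
  | nil => exact ⟨1, one_ne_zero, by simp [comb, ev, monoList, factor, hz]⟩
  | cons p ℓ ih =>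
    obtain ⟨c, hc, ih⟩ := ih fun p hp => hℓ p (List.mem_cons_of_mem _ hp)
    obtain ⟨b, y⟩ := p
    have hp := hℓ (b, y) List.mem_cons_self
    have hper : (z :: ℓ.map Prod.snd ++ [y]).Perm (z :: y :: ℓ.map Prod.snd) := by
      rw [List.cons_append]
      exact (List.perm_append_singleton y _).cons z
    obtain ⟨d, hd, h⟩ := monoList_perm (k := k) ε hper
    have h' : monoList k ε (z :: ℓ.map Prod.snd ++ [y]) =
        monoList k ε (z :: ℓ.map Prod.snd) * factor k ε y := by simp [monoList, mul_assoc]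
    rw [h'] at h
    cases b with
    | false =>
      have hy : ε y ≠ 1 := fun h => by simpa using hp.2 h
      refine ⟨c * d, mul_ne_zero hc hd, ?_⟩
      rw [factor, if_neg hy, mul_one] at h
      simp only [comb, combGen, Bool.false_eq_true, if_false, ev, eps_xi, mul_one, ih,
        List.map_cons, h, smul_smul]
    | true =>
      have hy : ε y = 1 := hp.1 rfl
      refine ⟨sg k ((comb z ℓ).degree codeg) * (c * d),
        mul_ne_zero (sg_ne_zero _ _) (mul_ne_zero hc hd), ?_⟩
      rw [factor, if_pos hy] at h
      simp only [comb, combGen, if_true, ev, ih, List.map_cons, smul_mul_assoc, h, smul_smul]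

theorem leaves_comb {X : Type} (z : X) (ℓ : List (Bool × X)) :
    ((comb z ℓ).leaves).Perm (z :: ℓ.map Prod.snd) := by
  induction ℓ with
  | nil => simp [comb, BTree.leaves]
  | cons p ℓ ih =>
    obtain ⟨b, y⟩ := p
    rw [comb, BTree.leaves, BTree.leaves, List.map_cons]
    exact (List.perm_append_singleton y _).trans ((ih.cons y).trans (List.Perm.swap z y _))

/-- The list that makes `comb z` the standard comb with exponents `ε`. -/
def combList {n : ℕ} (z : Fin n) (ε : Fin n → ZMod 2) : List (Bool × Fin n) :=
  ((List.finRange n).filter (· ≠ z)).map fun y => (decide (ε y = 1), y)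

theorem mem_combList {n : ℕ} (z : Fin n) (ε : Fin n → ZMod 2) (b : Bool) (y : Fin n) :
    (b, y) ∈ combList z ε ↔ y ≠ z ∧ b = decide (ε y = 1) := by
  simp only [combList, List.mem_map, List.mem_filter, List.mem_finRange, true_and,
    decide_eq_true_eq, Prod.mk.injEq]
  constructor
  · rintro ⟨a, h, rfl, rfl⟩
    exact ⟨h, rfl⟩
  · rintro ⟨h, rfl⟩
    exact ⟨y, h, rfl, rfl⟩

theorem nodup_combList {n : ℕ} (z : Fin n) (ε : Fin n → ZMod 2) : (combList z ε).Nodup :=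
  ((List.nodup_finRange n).filter _).map fun _ _ h => (Prod.mk.inj h).2

theorem perm_combList {n : ℕ} {z : Fin n} {ε : Fin n → ZMod 2} {ℓ : List (Bool × Fin n)}
    (hℓ : ℓ.Nodup) (h : ∀ b y, (b, y) ∈ ℓ ↔ y ≠ z ∧ b = decide (ε y = 1)) :
    ℓ.Perm (combList z ε) :=
  (List.perm_ext_iff_of_nodup hℓ (nodup_combList z ε)).2 fun ⟨b, y⟩ => by
    rw [h, mem_combList]

theorem cons_combList_perm {n : ℕ} (z : Fin n) (ε : Fin n → ZMod 2) :
    (z :: (combList z ε).map Prod.snd).Perm (List.finRange n) := by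
  have h : (combList z ε).map Prod.snd = (List.finRange n).filter (· ≠ z) := by
    rw [combList, List.map_map]
    exact List.map_id _
  rw [h]
  refine (List.perm_ext_iff_of_nodup ?_ (List.nodup_finRange n)).2 fun y => ?_
  · exact List.nodup_cons.2 ⟨by simp, (List.nodup_finRange n).filter _⟩
  · by_cases hy : y = z <;> simp [hy]

theorem isMultilinear_comb {n : ℕ} (z : Fin n) (ε : Fin n → ZMod 2) :
    (comb z (combList z ε)).IsMultilinear := by
  have h := (leaves_comb z (combList z ε)).trans (cons_combList_perm z ε)
  exact ⟨h.nodup_iff.2 (List.nodup_finRange n), fun x => h.mem_iff.2 (List.mem_finRange x)⟩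

/-- The comb with exponents `ε` that starts with the leaf `z`. -/
def standardComb {n : ℕ} (z : Fin n) (ε : Fin n → ZMod 2) : LTree Gen n :=
  ⟨comb z (combList z ε), isMultilinear_comb z ε⟩

theorem multilinearPart_comb {n : ℕ} (z : Fin n) (ε : Fin n → ZMod 2) (c : k) :
    multilinearPart k n (Finsupp.single (comb z (combList z ε)) c) =
      Finsupp.single (standardComb z ε) c :=
  multilinearPart_of n (standardComb z ε) c

theorem exists_ev_comb {n : ℕ} {z : Fin n} {ε : Fin n → ZMod 2} (hz : ε z = 1) :
    ∃ c : k, c ≠ 0 ∧ ev k (comb z (combList z ε)) = c • mono k ε := by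
  obtain ⟨c, hc, h⟩ := ev_comb (k := k) ε hz (combList z ε) fun p hp => by
    obtain ⟨b, y⟩ := p
    rw [((mem_combList z ε b y).1 hp).2]
    simp
  obtain ⟨d, hd, h'⟩ := monoList_perm (k := k) ε (cons_combList_perm z ε)
  exact ⟨c * d, mul_ne_zero hc hd, by rw [h, h', smul_smul, mono]⟩

/-- The last list entry is the innermost step. There the symmetry of `bul` exchanges the two leaves,
and the outer steps preserve identities. -/
theorem comb_exchange {X : Type} (z z' : X) (ℓ : List (Bool × X)) :
    Finsupp.single (comb z (ℓ ++ [(true, z')])) (1 : k) +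
      Finsupp.single (comb z' (ℓ ++ [(true, z)])) 1 ∈ identities k X := by
  induction ℓ with
  | nil => exact swap_leaf_mem .bul (.leaf z') z
  | cons p ℓ ih =>
    have := nodeLeaf_mem (combGen p.1) p.2 ih
    rwa [map_add, nodeLeaf_single, nodeLeaf_single] at this

/-- Two combs that are proportional modulo the identities. -/
def Proportional (k : Type u) [Field k] {X : Type} (t s : BTree Gen X) : Prop :=
  ∃ c : k, Finsupp.single t 1 - Finsupp.single s c ∈ identities k X

theorem Proportional.trans {X : Type} {t s r : BTree Gen X} (h : Proportional k t s)
    (h' : Proportional k s r) : Proportional k t r := by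
  obtain ⟨c, h⟩ := h
  obtain ⟨d, h'⟩ := h'
  refine ⟨c * d, ?_⟩
  have := add_mem h (Submodule.smul_mem _ c h')
  rwa [smul_sub, Finsupp.smul_single, Finsupp.smul_single, smul_eq_mul, smul_eq_mul, mul_one,
    sub_add_sub_cancel] at this

theorem proportional_of_perm {X : Type} {z : X} {ℓ ℓ' : List (Bool × X)} (h : ℓ.Perm ℓ') :
    Proportional k (comb z ℓ) (comb z ℓ') := by
  obtain ⟨c, -, h⟩ := comb_perm (k := k) (z := z) h
  exact ⟨-c, by rwa [Finsupp.single_neg, sub_neg_eq_add]⟩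

theorem proportional_exchange {X : Type} (z z' : X) (ℓ : List (Bool × X)) :
    Proportional k (comb z (ℓ ++ [(true, z')])) (comb z' (ℓ ++ [(true, z)])) :=
  ⟨-1, by rw [Finsupp.single_neg, sub_neg_eq_add]; exact comb_exchange z z' ℓ⟩

/-- The step that attaches `z'` is moved to the innermost position, its leaf is exchanged with `z`,
and the steps are sorted again. Thus the normal form does not depend on the initial leaf. -/
theorem proportional_combList {n : ℕ} {z z' : Fin n} {ε : Fin n → ZMod 2} (hz : ε z = 1)
    (hz' : ε z' = 1) :
    Proportional k (comb z (combList z ε)) (comb z' (combList z' ε)) := by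
  by_cases h : z = z'
  · subst h
    exact proportional_of_perm (List.Perm.refl _)
  have key : ∀ a b : Fin n, a ≠ b → ε b = 1 →
      (((combList a ε).filter fun p => p.2 ≠ b) ++ [(true, b)]).Perm (combList a ε) := by
    intro a b hab hb
    refine perm_combList ?_ ?_
    · refine List.Nodup.append ((nodup_combList a ε).filter _) (by simp) ?_
      simp
    · intro c y
      by_cases hy : y = b
      · subst hy
        simp [hb, Ne.symm hab]
      · simp [hy, mem_combList]
  have e : ((combList z ε).filter fun p => p.2 ≠ z').Perm
      ((combList z' ε).filter fun p => p.2 ≠ z) := by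
    refine (List.perm_ext_iff_of_nodup ((nodup_combList z ε).filter _)
      ((nodup_combList z' ε).filter _)).2 fun ⟨b, y⟩ => ?_
    simp only [List.mem_filter, mem_combList, decide_eq_true_eq]
    tauto
  refine (proportional_of_perm (key z z' h hz').symm).trans
    ((proportional_exchange z z' _).trans (proportional_of_perm ?_))
  exact (e.append_right _).trans (key z' z (Ne.symm h) hz)

/-- The exponents are one at the initial leaf and at the leaves attached by `bul`; multilinearity
makes this description unambiguous. -/
theorem exists_proportional {n : ℕ} {z : Fin n} {ℓ : List (Bool × Fin n)}
    (h : (comb z ℓ).IsMultilinear) : ∃ ε : Fin n → ZMod 2, ε z = 1 ∧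
      Proportional k (comb z ℓ) (comb z (combList z ε)) := by
  classical
  have h1 : (z :: ℓ.map Prod.snd).Nodup := (leaves_comb z ℓ).nodup_iff.1 h.1
  have h2 : ∀ y, y ∈ z :: ℓ.map Prod.snd := fun y => (leaves_comb z ℓ).mem_iff.1 (h.2 y)
  obtain ⟨h3, h4⟩ := List.nodup_cons.1 h1
  have hinj := List.inj_on_of_nodup_map h4
  let ε : Fin n → ZMod 2 := fun y => if y = z ∨ (true, y) ∈ ℓ then 1 else 0
  have hε : ∀ y, y ≠ z → (ε y = 1 ↔ (true, y) ∈ ℓ) := fun y hy => by simp [ε, hy]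
  refine ⟨ε, by simp [ε], proportional_of_perm (perm_combList (List.Nodup.of_map _ h4) ?_)⟩
  intro b y
  constructor
  · intro hb
    have hy : y ≠ z := by
      rintro rfl
      exact h3 (List.mem_map_of_mem (f := Prod.snd) hb)
    refine ⟨hy, ?_⟩
    cases b with
    | true => simp [hε y hy, hb]
    | false =>
      have : (true, y) ∉ ℓ := fun h => by simpa using hinj h hb rfl
      simp [hε y hy, this]
  · rintro ⟨hy, rfl⟩
    have hm : y ∈ ℓ.map Prod.snd := (List.mem_cons.1 (h2 y)).resolve_left hy
    obtain ⟨⟨b, y'⟩, hb, rfl⟩ := List.mem_map.1 hm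
    cases b with
    | true => simpa [(hε y' hy).2 hb] using hb
    | false =>
      have : (true, y') ∉ ℓ := fun h => by simpa using hinj h hb rfl
      have h0 : ¬ ε y' = 1 := fun h => this ((hε y' hy).1 h)
      simpa [h0] using hb

end CanonicalCombs

/-! ## A basis of the Koszul dual operad -/

section DualBasis

variable (k : Type u) [Field k]

/-- The evaluation of operad elements in the exterior algebra. -/
def evOperad (n : ℕ) : (dualOperad k).operad n →ₗ[k] Lam k (Fin n) :=
  Submodule.liftQ _ (evSpan n) (ideal_le_ker_evSpan n)

/-- The functional that reads off the coefficient of the monomial with exponents `ε`. -/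
def coordinate {n : ℕ} (ε : Fin n → ZMod 2) : Module.Dual k ((dualOperad k).operad n) :=
  coef ε ∘ₗ evOperad k n

/-- A standard comb divided by the scalar in its value. The second clause holds for all admissible
initial leaves at once, because their combs are proportional. For `ε = 0` both clauses are vacuous
and zero is chosen. -/
theorem exists_basisElement {n : ℕ} (ε : Fin n → ZMod 2) : ∃ e : (dualOperad k).operad n,
    ((∃ z, ε z = 1) → evOperad k n e = mono k ε) ∧ ∀ z, ε z = 1 →
      ∃ c : k, ((dualOperad k).ideal n).mkQ
        (Finsupp.single (standardComb z ε) 1) = c • e := by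
  by_cases h : ∃ z, ε z = 1
  · obtain ⟨z, hz⟩ := h
    obtain ⟨c, hc, hev⟩ := exists_ev_comb (k := k) hz
    refine ⟨((dualOperad k).ideal n).mkQ
      (Finsupp.single (standardComb z ε) c⁻¹), fun _ => ?_,
      fun z' hz' => ?_⟩
    · rw [evOperad, Submodule.mkQ_apply, Submodule.liftQ_apply, evSpan_single, standardComb, hev,
        smul_smul, inv_mul_cancel₀ hc, one_smul]
    · obtain ⟨d, hd⟩ := proportional_combList (k := k) hz' hz
      refine ⟨d * c, ?_⟩
      have h' := multilinearPart_mem hd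
      rw [map_sub] at h'
      rw [multilinearPart_comb, multilinearPart_comb,
        ← Submodule.Quotient.mk_eq_zero, Submodule.Quotient.mk_sub, sub_eq_zero] at h'
      rw [Submodule.mkQ_apply, h', ← map_smul, Finsupp.smul_single, smul_eq_mul, mul_assoc,
        mul_inv_cancel₀ hc, mul_one]
      rfl
  · exact ⟨0, fun h' => absurd h' h, fun z hz => absurd ⟨z, hz⟩ h⟩

/-- The basis element that evaluates to the monomial with exponents `ε ≠ 0`. -/
def basisElement {n : ℕ} (ε : Fin n → ZMod 2) : (dualOperad k).operad n :=
  (exists_basisElement k ε).choose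

theorem zmod_two_ne_one {a : ZMod 2} : a ≠ 1 ↔ a = 0 := by
  revert a
  decide

theorem exists_eq_one {n : ℕ} {ε : Fin n → ZMod 2} (h : ε ≠ 0) : ∃ z, ε z = 1 := by
  by_contra hc
  push Not at hc
  exact h (funext fun z => zmod_two_ne_one.1 (hc z))

theorem evOperad_basisElement {n : ℕ} {ε : Fin n → ZMod 2} (h : ε ≠ 0) :
    evOperad k n (basisElement k ε) = mono k ε :=
  (exists_basisElement k ε).choose_spec.1 (exists_eq_one h)

theorem coordinate_basisElement {n : ℕ} (ε : Fin n → ZMod 2) {δ : Fin n → ZMod 2} (h : δ ≠ 0) :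
    coordinate k ε (basisElement k δ) = if ε = δ then 1 else 0 := by
  rw [coordinate, LinearMap.comp_apply, evOperad_basisElement k h, coef_mono]

theorem mkQ_comb_mem {n : ℕ} {z : Fin n} {ℓ : List (Bool × Fin n)} :
    ((dualOperad k).ideal n).mkQ (multilinearPart k n (Finsupp.single (comb z ℓ) 1)) ∈
      Submodule.span k {x | ∃ ε : Fin n → ZMod 2, ε ≠ 0 ∧ x = basisElement k ε} := by
  by_cases h : (comb z ℓ).IsMultilinear
  · obtain ⟨ε, hz, c, hc⟩ := exists_proportional (k := k) h
    obtain ⟨d, hd⟩ := (exists_basisElement k ε).choose_spec.2 z hz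
    have h' := multilinearPart_mem hc
    rw [map_sub, ← Submodule.Quotient.mk_eq_zero, Submodule.Quotient.mk_sub, sub_eq_zero] at h'
    rw [Submodule.mkQ_apply, h', multilinearPart_comb]
    have e2 : (Finsupp.single (standardComb z ε) c :
        TreeSpan k Gen n) = c • Finsupp.single (standardComb z ε) 1 :=
      by simp
    rw [← Submodule.mkQ_apply, e2, map_smul, hd]
    refine Submodule.smul_mem _ _ (Submodule.smul_mem _ _ (Submodule.subset_span ⟨ε, ?_, rfl⟩))
    rintro rfl
    exact zero_ne_one hz
  · rw [multilinearPart_of_not h, map_zero]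
    exact zero_mem _

/-- Trees reduce to combs with arbitrary labels, only multilinear combs survive the projection, and
each of these is proportional to a standard comb. -/
theorem span_basisElement (n : ℕ) :
    Submodule.span k {x | ∃ ε : Fin n → ZMod 2, ε ≠ 0 ∧ x = basisElement k ε} = ⊤ := by
  set S := Submodule.span k {x | ∃ ε : Fin n → ZMod 2, ε ≠ 0 ∧ x = basisElement k ε}
  have hle : combSpan k (Fin n) ≤
      S.comap (((dualOperad k).ideal n).mkQ ∘ₗ multilinearPart k n) := by
    refine sup_le (fun x hx => ?_) (Submodule.span_le.2 ?_)
    · rw [Submodule.mem_comap, LinearMap.comp_apply, Submodule.mkQ_apply,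
        (Submodule.Quotient.mk_eq_zero _).2 (multilinearPart_mem hx)]
      exact zero_mem _
    · rintro _ ⟨z, ℓ, rfl⟩
      exact mkQ_comb_mem k
  rw [eq_top_iff]
  rintro x -
  obtain ⟨x, rfl⟩ := Submodule.mkQ_surjective _ x
  induction x using Finsupp.induction_linear with
  | zero => simp
  | add a b ha hb => rw [map_add]; exact add_mem ha hb
  | single t c =>
    have h := hle (single_mem_of_one (tree_mem_combSpan (k := k) t.1) c)
    rwa [Submodule.mem_comap, LinearMap.comp_apply, multilinearPart_of] at h

theorem dual_ext {n : ℕ} {M : Type*} [AddCommGroup M] [Module k M]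
    {f g : (dualOperad k).operad n →ₗ[k] M}
    (h : ∀ ε : Fin n → ZMod 2, ε ≠ 0 → f (basisElement k ε) = g (basisElement k ε)) : f = g := by
  refine LinearMap.ext_on (span_basisElement k n) ?_
  rintro _ ⟨ε, hε, rfl⟩
  exact h ε hε

/-- The constant monomial occurs in no value. This is the algebraic counterpart of dividing by the
tensors that lie in `V`. -/
theorem coordinate_zero (n : ℕ) : coordinate k (0 : Fin n → ZMod 2) = 0 :=
  dual_ext k fun ε hε => by rw [coordinate_basisElement k _ hε, if_neg (Ne.symm hε)]; rfl

theorem eq_sum_coordinate {n : ℕ} (φ : Module.Dual k ((dualOperad k).operad n)) :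
    φ = ∑ ε, φ (basisElement k ε) • coordinate k ε := by
  refine dual_ext k fun δ hδ => ?_
  simp only [LinearMap.sum_apply, LinearMap.smul_apply, coordinate_basisElement k _ hδ,
    smul_eq_mul, mul_ite, mul_one, mul_zero]
  simp

/-- Elements of the operad are determined by their values in the exterior algebra. -/
theorem evOperad_injective (n : ℕ) : Function.Injective (evOperad k n) := by
  -- The identity is a combination of the coordinates, and the coordinates factor through
  -- `evOperad`.
  have h : LinearMap.id = ∑ ε : Fin n → ZMod 2,
      (coordinate k ε).smulRight (if ε = 0 then 0 else basisElement k ε) := by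
    refine dual_ext k fun δ hδ => ?_
    simp only [LinearMap.sum_apply, LinearMap.smulRight_apply, coordinate_basisElement k _ hδ,
      ite_smul, zero_smul, one_smul, LinearMap.id_apply]
    simp [hδ]
  intro x y hxy
  rw [← LinearMap.id_apply (R := k) x, ← LinearMap.id_apply (R := k) y, h]
  simp only [LinearMap.sum_apply, LinearMap.smulRight_apply, coordinate, LinearMap.comp_apply, hxy]

end DualBasis

open CliffordAlgebra (involute)

/-! ### Group action and infinitesimal decomposition in coordinates -/

section Coordinates

variable {k : Type u} [Field k]

theorem evOperad_mk {n : ℕ} (x : TreeSpan k Gen n) :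
    evOperad k n (((dualOperad k).ideal n).mkQ x) = evSpan n x := rfl

theorem evOperad_perm {n : ℕ} (σ : Equiv.Perm (Fin n)) (x : (dualOperad k).operad n) :
    evOperad k n ((dualOperad k).operadRep n σ x) =
      ExteriorAlgebra.map (Finsupp.lmapDomain k k σ) (evOperad k n x) := by
  obtain ⟨x, rfl⟩ := Submodule.mkQ_surjective _ x
  exact evSpan_perm σ x

theorem evOperad_sign {n : ℕ} (x : (dualOperad k).operad n) :
    evOperad k n ((dualOperad k).operadSign n x) = -involute (evOperad k n x) := by
  obtain ⟨x, rfl⟩ := Submodule.mkQ_surjective _ x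
  exact evSpan_sign x

/-- The value of `g(1, 2)`. -/
def corollaValue (k : Type u) [Field k] (n : ℕ) : Gen → Lam k (Fin (n + 2))
  | .circ => xi 0
  | .circOp => -xi 1
  | .bul => xi 0 * xi 1

theorem evOperad_insertFirst {n : ℕ} (g : Gen) (x : (dualOperad k).operad (n + 1)) :
    evOperad k (n + 2) ((dualOperad k).insertFirst g n x) =
      subst 0 Fin.succ (corollaValue k n g) (evOperad k (n + 1) x) := by
  obtain ⟨x, rfl⟩ := Submodule.mkQ_surjective _ x
  have h := evSpan_comp (n := n) (m := 2) 0 Fin.succ (fun j h => Fin.ext (by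
    have : (j : ℕ) ≠ 0 := fun h' => h (Fin.ext h')
    simp [LTree.outerLabel]
    omega)) x (Finsupp.single (LTree.corolla g) (1 : k))
  refine h.trans ?_
  rw [evOperad_mk, evSpan_single, one_smul]
  congr 2
  have e0 : (LTree.innerLabel (n := n) (m := 2) 0 0) = 0 := Fin.ext (by simp [LTree.innerLabel])
  have e1 : (LTree.innerLabel (n := n) (m := 2) 0 1) = 1 := Fin.ext (by simp [LTree.innerLabel])
  cases g
  · simp only [LTree.corolla, ev, eps_xi, mul_one, map_xi, e0, corollaValue]
  · simp only [LTree.corolla, ev, eps_xi, one_mul, map_xi, e1, corollaValue, BTree.degree, sg_zero,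
      one_smul, map_neg]
  · simp only [LTree.corolla, ev, map_mul, map_xi, e0, e1, corollaValue, BTree.degree, sg_zero,
      one_smul]

theorem pd_map_succ {n : ℕ} (q : Lam k (Fin n)) :
    pd 0 (ExteriorAlgebra.map (Finsupp.lmapDomain k k Fin.succ) q) = 0 := by
  have h : (Finsupp.lapply 0 : (Fin (n + 1) →₀ k) →ₗ[k] k) ∘ₗ
      Finsupp.lmapDomain k k Fin.succ = 0 :=
    Finsupp.lhom_ext fun i c => by simp [Fin.succ_ne_zero]
  rw [pd, ← map_contractLeft, h, map_zero, LinearMap.zero_apply, map_zero]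

theorem tau_map_succ {n : ℕ} (q : Lam k (Fin n)) :
    tau (0 : Fin (n + 1)) Fin.succ (ExteriorAlgebra.map (Finsupp.lmapDomain k k Fin.succ) q) =
      ExteriorAlgebra.map (Finsupp.lmapDomain k k Fin.succ)
        (ExteriorAlgebra.map (Finsupp.lmapDomain k k Fin.succ) q) := by
  rw [tau, ← AlgHom.comp_apply, ← AlgHom.comp_apply, ExteriorAlgebra.map_comp_map,
    ExteriorAlgebra.map_comp_map]
  congr 2
  refine Finsupp.lhom_ext fun i c => ?_
  simp [relabelAway, Fin.succ_ne_zero]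

variable (k) in
/-- The monomial with exponents `T`, with the first two generators left out. -/
def tailMono {n : ℕ} (T : Fin n → ZMod 2) : Lam k (Fin (n + 2)) :=
  ExteriorAlgebra.map (Finsupp.lmapDomain k k Fin.succ)
    (ExteriorAlgebra.map (Finsupp.lmapDomain k k Fin.succ) (mono k T))

theorem tailMono_mul_xi {n : ℕ} (T : Fin n → ZMod 2) (i : Fin (n + 2)) :
    tailMono k T * xi i = sg k (weight T) • (xi i * tailMono k T) := by
  have h : involute (tailMono k T) = sg k (weight T) • tailMono k T := by
    rw [tailMono, ← map_involute, ← map_involute, involute_mono, map_smul, map_smul]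
  rw [xi, ι_mul_comm, h, smul_mul_assoc, smul_smul, sg_mul_self, one_smul]

theorem mono_cons_cons {n : ℕ} (a b : ZMod 2) (T : Fin n → ZMod 2) :
    mono k (Fin.cons a (Fin.cons b T : Fin (n + 1) → ZMod 2) : Fin (n + 2) → ZMod 2) =
      (if a = 1 then xi 0 else 1) * ((if b = 1 then xi 1 else 1) * tailMono k T) := by
  rw [mono_cons, mono_cons, map_mul, tailMono]
  congr 2
  split_ifs
  · rw [map_xi]
    rfl
  · rw [map_one]

theorem subst_mono_zero {n : ℕ} (s : Lam k (Fin (n + 2))) (T : Fin n → ZMod 2) :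
    subst 0 Fin.succ s (mono k (Fin.cons 0 T : Fin (n + 1) → ZMod 2)) = tailMono k T * eps s := by
  rw [mono_cons, if_neg (by decide), one_mul, subst_apply, pd_map_succ, map_zero, map_zero,
    zero_mul, zero_add, tau_map_succ, tailMono]

theorem subst_mono_one {n : ℕ} (s : Lam k (Fin (n + 2))) (T : Fin n → ZMod 2) :
    subst 0 Fin.succ s (mono k (Fin.cons 1 T : Fin (n + 1) → ZMod 2)) =
      sg k (weight T) • (tailMono k T * s) := by
  rw [mono_cons, if_pos rfl, subst_apply, pd_mul, pd_map_succ, mul_zero, add_zero, pd_xi,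
    if_pos rfl, one_mul, map_mul, tau_xi, if_pos rfl, zero_mul, zero_mul, add_zero, tau_map_succ,
    ← map_involute, ← map_involute, involute_mono, map_smul, map_smul, smul_mul_assoc, tailMono]

theorem zmod_two_cases (a : ZMod 2) : a = 0 ∨ a = 1 := by
  revert a
  decide

/-- Inserting a generator at the first input replaces the first exponent by two. Here the second of
them is zero; for `circOp` the first is zero and a sign appears. For `bul`, exponent one becomes the
pair `1, 1`, while exponent zero gives the difference of `0, 1` and `1, 0`, because `eps (ξ_0 ξ_1) =
ξ_1 - ξ_0`. -/
theorem subst_circ {n : ℕ} (a : ZMod 2) (T : Fin n → ZMod 2) :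
    subst 0 Fin.succ (corollaValue k n .circ) (mono k (Fin.cons a T : Fin (n + 1) → ZMod 2)) =
      mono k (Fin.cons a (Fin.cons 0 T : Fin (n + 1) → ZMod 2) : Fin (n + 2) → ZMod 2) := by
  rcases zmod_two_cases a with rfl | rfl
  · rw [subst_mono_zero, mono_cons_cons, corollaValue, eps_xi]
    simp
  · rw [subst_mono_one, mono_cons_cons, corollaValue, tailMono_mul_xi, smul_smul, sg_mul_self]
    simp

theorem subst_circOp {n : ℕ} (a : ZMod 2) (T : Fin n → ZMod 2) :
    subst 0 Fin.succ (corollaValue k n .circOp) (mono k (Fin.cons a T : Fin (n + 1) → ZMod 2)) =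
      -mono k (Fin.cons 0 (Fin.cons a T : Fin (n + 1) → ZMod 2) : Fin (n + 2) → ZMod 2) := by
  rcases zmod_two_cases a with rfl | rfl
  · rw [subst_mono_zero, mono_cons_cons, corollaValue, map_neg, eps_xi]
    simp
  · rw [subst_mono_one, mono_cons_cons, corollaValue, mul_neg, tailMono_mul_xi, smul_neg, smul_smul,
      sg_mul_self]
    simp

theorem subst_bul_zero {n : ℕ} (T : Fin n → ZMod 2) :
    subst 0 Fin.succ (corollaValue k n .bul) (mono k (Fin.cons 0 T : Fin (n + 1) → ZMod 2)) =
      sg k (weight T) •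
        (mono k (Fin.cons 0 (Fin.cons 1 T : Fin (n + 1) → ZMod 2) : Fin (n + 2) → ZMod 2) -
        mono k (Fin.cons 1 (Fin.cons 0 T : Fin (n + 1) → ZMod 2) : Fin (n + 2) → ZMod 2)) := by
  have h : eps (xi 0 * xi 1 : Lam k (Fin (n + 2))) = xi 1 - xi 0 := by
    rw [eps_mul, eps_xi, eps_xi, one_mul, involute_xi, mul_one, sub_eq_add_neg]
  rw [subst_mono_zero, mono_cons_cons, mono_cons_cons, corollaValue, h, mul_sub, tailMono_mul_xi,
    tailMono_mul_xi, smul_sub]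
  simp

theorem subst_bul_one {n : ℕ} (T : Fin n → ZMod 2) :
    subst 0 Fin.succ (corollaValue k n .bul) (mono k (Fin.cons 1 T : Fin (n + 1) → ZMod 2)) =
      sg k (weight T) •
        mono k (Fin.cons 1 (Fin.cons 1 T : Fin (n + 1) → ZMod 2) : Fin (n + 2) → ZMod 2) := by
  rw [subst_mono_one, mono_cons_cons, corollaValue, ← mul_assoc, tailMono_mul_xi, smul_mul_assoc,
    mul_assoc (xi 0), tailMono_mul_xi, mul_smul_comm, smul_smul, sg_mul_self]
  simp

theorem coordinate_apply {n : ℕ} (ε : Fin n → ZMod 2) (x : (dualOperad k).operad n) :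
    coordinate k ε x = coef ε (evOperad k n x) := rfl

theorem koszulSign_symm {n : ℕ} (σ : Equiv.Perm (Fin n)) (ε : Fin n → ZMod 2) :
    koszulSign σ⁻¹ (fun i => ε (σ.symm i)) = koszulSign σ ε := by
  have h := koszulSign_mul σ⁻¹ σ ε
  rw [inv_mul_cancel, koszulSign_one] at h
  rw [← mul_left_inj (koszulSign σ ε), ← h, Int.units_mul_self]

/-- Dual to `map_mono`: the contragredient action applies the inverse permutation to monomials, and
its Koszul sign agrees with that of the permutation by `koszulSign_symm`. -/
theorem dual_coordinate {n : ℕ} (σ : Equiv.Perm (Fin n)) (ε : Fin n → ZMod 2) :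
    ((dualOperad k).operadRep n).dual σ (coordinate k ε) =
      (((koszulSign σ ε : ℤˣ) : ℤ) : k) • coordinate k (fun i => ε (σ.symm i)) := by
  refine dual_ext k fun δ hδ => ?_
  rw [Representation.dual_apply]
  change coordinate k ε ((dualOperad k).operadRep n σ⁻¹ (basisElement k δ)) =
    (((koszulSign σ ε : ℤˣ) : ℤ) : k) • coordinate k (fun i => ε (σ.symm i)) (basisElement k δ)
  rw [coordinate_basisElement k _ hδ, coordinate_apply, evOperad_perm, evOperad_basisElement k hδ,
    map_mono, map_zsmul, coef_mono, ← Int.cast_smul_eq_zsmul k]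
  have e : (ε = fun i => δ (σ⁻¹.symm i)) ↔ (fun i => ε (σ.symm i)) = δ := by
    constructor
    · rintro rfl
      funext i
      exact congrArg δ (σ.apply_symm_apply i)
    · rintro rfl
      funext i
      exact congrArg ε (σ.symm_apply_apply i).symm
  by_cases h : (fun i => ε (σ.symm i)) = δ
  · rw [if_pos (e.2 h), if_pos h, ← h, koszulSign_symm]
  · rw [if_neg (fun h' => h (e.1 h')), if_neg h, smul_zero, smul_zero]

theorem decompose_apply (g : Gen) {n : ℕ} (φ : Module.Dual k ((dualOperad k).operad (n + 2)))
    (x : (dualOperad k).operad (n + 1)) :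
    (preLieSqOperad k).decompose g n φ x =
      φ ((dualOperad k).insertFirst g n
        (((dualOperad k).operadSign (n + 1) ^ ((preLieSqOperad k).deg g).natAbs.succ) x)) := rfl

/-- For a generator of degree zero `operadSign` is applied once and leaves a sign; for `bul` it is
applied twice and disappears. -/
theorem decompose_coordinate (g : Gen) (hg : g ≠ .bul) {n : ℕ} (E : Fin (n + 2) → ZMod 2)
    {δ : Fin (n + 1) → ZMod 2} (hδ : δ ≠ 0) :
    (preLieSqOperad k).decompose g n (coordinate k E) (basisElement k δ) =
      sg k (weight δ + 1) *
        coef E (subst 0 Fin.succ (corollaValue k n g) (mono k δ)) := by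
  have h : ((preLieSqOperad k).deg g).natAbs.succ = 1 := by
    cases g
    · rfl
    · rfl
    · exact absurd rfl hg
  rw [decompose_apply, h, pow_one, coordinate_apply, evOperad_insertFirst, evOperad_sign,
    evOperad_basisElement k hδ, involute_mono, ← neg_smul, map_smul, map_smul, smul_eq_mul, sg_add,
    sg_one, mul_neg_one]

theorem decompose_bul_coordinate {n : ℕ} (E : Fin (n + 2) → ZMod 2)
    {δ : Fin (n + 1) → ZMod 2} (hδ : δ ≠ 0) :
    (preLieSqOperad k).decompose .bul n (coordinate k E) (basisElement k δ) =
        coef E (subst 0 Fin.succ (corollaValue k n .bul) (mono k δ)) := by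
  have h : ((preLieSqOperad k).deg .bul).natAbs.succ = 2 := rfl
  rw [decompose_apply, h, pow_two, coordinate_apply, evOperad_insertFirst, Module.End.mul_apply,
    evOperad_sign, evOperad_sign, evOperad_basisElement k hδ, map_neg involute, neg_neg, involute_involute']

theorem exists_cons {n : ℕ} (δ : Fin (n + 1) → ZMod 2) :
    ∃ (e : ZMod 2) (S : Fin n → ZMod 2), δ = Fin.cons e S :=
  ⟨δ 0, Fin.tail δ, (Fin.cons_self_tail δ).symm⟩

/-- Transpose of `subst_circ`: the coordinate with exponents `a, b, T` is hit only when `b = 0`, and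
then only by the monomial `a, T`. -/
theorem decompose_circ {n : ℕ} (a b : ZMod 2) (T : Fin n → ZMod 2) :
    (preLieSqOperad k).decompose .circ n
      (coordinate k (Fin.cons a (Fin.cons b T : Fin (n + 1) → ZMod 2) : Fin (n + 2) → ZMod 2)) =
    (if b = 0 then sg k (weight (Fin.cons a T : Fin (n + 1) → ZMod 2) + 1) else 0) •
      coordinate k (Fin.cons a T : Fin (n + 1) → ZMod 2) := by
  refine dual_ext k fun δ hδ => ?_
  obtain ⟨e, S, rfl⟩ := exists_cons δ
  rw [LinearMap.smul_apply, decompose_coordinate _ (by simp) _ hδ, subst_circ,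
    coordinate_basisElement k _ hδ, coef_mono, smul_eq_mul]
  simp only [Fin.cons_inj]
  by_cases h : a = e ∧ T = S
  · obtain ⟨rfl, rfl⟩ := h
    by_cases hb : b = 0 <;> simp [hb]
  · by_cases hb : b = 0 <;> simp [hb, h]

theorem decompose_circOp {n : ℕ} (a b : ZMod 2) (T : Fin n → ZMod 2) :
    (preLieSqOperad k).decompose .circOp n
      (coordinate k (Fin.cons a (Fin.cons b T : Fin (n + 1) → ZMod 2) : Fin (n + 2) → ZMod 2)) =
    (if a = 0 then sg k (weight (Fin.cons b T : Fin (n + 1) → ZMod 2)) else 0) •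
      coordinate k (Fin.cons b T : Fin (n + 1) → ZMod 2) := by
  refine dual_ext k fun δ hδ => ?_
  obtain ⟨e, S, rfl⟩ := exists_cons δ
  rw [LinearMap.smul_apply, decompose_coordinate _ (by simp) _ hδ, subst_circOp,
    coordinate_basisElement k _ hδ, map_neg, coef_mono, smul_eq_mul, sg_add, sg_one]
  simp only [Fin.cons_inj]
  by_cases h : b = e ∧ T = S
  · obtain ⟨rfl, rfl⟩ := h
    by_cases ha : a = 0 <;> simp [ha]
  · by_cases ha : a = 0 <;> simp [ha, h]

/-- The product `a * b` covers all cases: `1, 1` comes from exponent one, `0, 1` and `1, 0` come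
from exponent zero with opposite signs, and `0, 0` does not occur, having coefficient zero. -/
theorem decompose_bul {n : ℕ} (a b : ZMod 2) (T : Fin n → ZMod 2) :
    (preLieSqOperad k).decompose .bul n
      (coordinate k (Fin.cons a (Fin.cons b T : Fin (n + 1) → ZMod 2) : Fin (n + 2) → ZMod 2)) =
    (if b = 1 then sg k (weight T) else if a = 1 then -sg k (weight T) else 0) •
      coordinate k (Fin.cons (a * b) T : Fin (n + 1) → ZMod 2) := by
  refine dual_ext k fun δ hδ => ?_
  obtain ⟨e, S, rfl⟩ := exists_cons δ
  rw [LinearMap.smul_apply, decompose_bul_coordinate _ hδ, coordinate_basisElement k _ hδ,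
    smul_eq_mul]
  rcases zmod_two_cases e with rfl | rfl
  · rw [subst_bul_zero, map_smul, map_sub, coef_mono, coef_mono]
    simp only [Fin.cons_inj]
    by_cases hS : T = S
    · subst hS
      rcases zmod_two_cases a with rfl | rfl <;> rcases zmod_two_cases b with rfl | rfl <;> simp
    · simp [hS]
  · rw [subst_bul_one, map_smul, coef_mono]
    simp only [Fin.cons_inj]
    by_cases hS : T = S
    · subst hS
      rcases zmod_two_cases a with rfl | rfl <;> rcases zmod_two_cases b with rfl | rfl <;> simp
    · simp [hS]

end Coordinates

/-! ## Degrees -/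

section Degrees

variable {k : Type u} [Field k]

/-- The homomorphism that multiplies all generators by `c`. -/
def scale {X : Type} (c : k) : Lam k X →ₐ[k] Lam k X := ExteriorAlgebra.map (c • LinearMap.id)

theorem contractLeft_scale {X : Type} (c : k) (d : Module.Dual k (X →₀ k)) (a : Lam k X) :
    CliffordAlgebra.contractLeft d (scale c a) =
      c • scale c (CliffordAlgebra.contractLeft d a) := by
  have h : d ∘ₗ (c • LinearMap.id) = c • d := LinearMap.ext fun m => map_smul d c m
  rw [scale, ← map_contractLeft, h, map_smul, LinearMap.smul_apply, map_smul]

/-- Rescaling all generators detects polynomial degree: a tree of degree `-d` has a value of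
polynomial degree `d + 1`. The factor `eps` lowers this degree by one, which requires dividing by
`c`. -/
theorem scale_ev {X : Type} {c : k} (hc : c ≠ 0) (t : BTree Gen X) :
    ∃ d : ℕ, t.degree codeg = -d ∧ scale c (ev k t) = c ^ (d + 1) • ev k t := by
  induction t with
  | leaf x =>
    refine ⟨0, by simp [BTree.degree], ?_⟩
    rw [ev, xi, scale, ExteriorAlgebra.map_apply_ι, zero_add, pow_one, ← map_smul]
    rfl
  | node g l r hl hr =>
    obtain ⟨d, hd, hl⟩ := hl
    obtain ⟨e, he, hr⟩ := hr
    have hl' : scale c (eps (ev k l)) = c ^ d • eps (ev k l) := by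
      refine smul_right_injective _ hc ?_
      change c • scale c (eps (ev k l)) = c • c ^ d • eps (ev k l)
      rw [eps, ← contractLeft_scale, hl, map_smul, smul_smul, pow_succ']
    have hr' : scale c (eps (ev k r)) = c ^ e • eps (ev k r) := by
      refine smul_right_injective _ hc ?_
      change c • scale c (eps (ev k r)) = c • c ^ e • eps (ev k r)
      rw [eps, ← contractLeft_scale, hr, map_smul, smul_smul, pow_succ']
    cases g with
    | circ =>
      refine ⟨d + e, by simp [BTree.degree, hd, he, codeg, Gen.deg]; ring, ?_⟩
      rw [ev, map_mul, hl, hr', smul_mul_smul_comm]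
      congr 1
      ring
    | circOp =>
      refine ⟨d + e, by simp [BTree.degree, hd, he, codeg, Gen.deg]; ring, ?_⟩
      rw [ev, map_neg, map_smul, map_mul, hl', hr, smul_mul_smul_comm, smul_neg, smul_comm]
      congr 3
      ring
    | bul =>
      refine ⟨d + e + 1, by simp [BTree.degree, hd, he, codeg, Gen.deg]; ring, ?_⟩
      rw [ev, map_smul, map_mul, hl, hr, smul_mul_smul_comm, smul_comm]
      congr 2
      ring

theorem coefList_scale {X : Type} (ε : X → ZMod 2) (L : List X) (c : k) (p : Lam k X) :
    coefList ε L (scale c p) = c ^ (L.map fun i => (ε i).val).sum * coefList ε L p := by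
  induction L generalizing p with
  | nil =>
    rw [coefList, List.map_nil, List.sum_nil, pow_zero, one_mul, AlgHom.toLinearMap_apply,
      AlgHom.toLinearMap_apply, ← AlgHom.comp_apply]
    congr 1
    refine ExteriorAlgebra.hom_ext (LinearMap.ext fun m => ?_)
    simp [scale, ExteriorAlgebra.algebraMapInv]
  | cons i L ih =>
    rw [coefList, LinearMap.comp_apply, LinearMap.comp_apply, List.map_cons, List.sum_cons]
    by_cases h : ε i = 1
    · have e : (1 : ZMod 2).val = 1 := rfl
      rw [if_pos h, pd, contractLeft_scale, map_smul, ih, h, e, pow_add, pow_one, smul_eq_mul,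
        mul_assoc]
    · rw [if_neg h, zmod_two_ne_one.1 h, LinearMap.id_apply, LinearMap.id_apply, ih, ZMod.val_zero,
        zero_add]

theorem coef_scale {n : ℕ} (ε : Fin n → ZMod 2) (c : k) (p : Lam k (Fin n)) :
    coef ε (scale c p) = c ^ weight ε * coef ε p := by
  rw [coef, coefList_scale, weight, ← List.sum_ofFn, List.ofFn_eq_map]

/-- A nonzero coefficient is scaled both by `2 ^ (d + 1)` and by `2 ^ weight ε`. In characteristic
zero this forces the exponents to agree. -/
theorem degree_of_coef_ne_zero [CharZero k] {n : ℕ} {ε : Fin n → ZMod 2} {t : BTree Gen (Fin n)}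
    (h : coef ε (ev k t) ≠ 0) : t.degree codeg = 1 - weight ε := by
  obtain ⟨d, hd, h'⟩ := scale_ev (k := k) two_ne_zero t
  have e := coef_scale ε 2 (ev k t)
  rw [h', map_smul, smul_eq_mul] at e
  have e' := mul_right_cancel₀ h e
  have e'' : d + 1 = weight ε := by
    have : ((2 ^ (d + 1) : ℕ) : k) = ((2 ^ weight ε : ℕ) : k) := by push_cast; exact e'
    exact Nat.pow_right_injective le_rfl (Nat.cast_injective this)
  rw [hd, ← e'']
  push_cast
  ring

theorem coordinate_mem [CharZero k] {n : ℕ} (ε : Fin n → ZMod 2) :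
    coordinate k ε ∈ (dualOperad k).dualDeg n (weight ε - 1) := by
  intro t ht
  by_contra h
  refine ht ?_
  have h' : coef ε (ev k t.1) ≠ 0 := by
    rwa [coordinate_apply, ← Submodule.mkQ_apply, evOperad_mk, evSpan_single, one_smul] at h
  refine (degree_of_coef_ne_zero h').trans ?_
  ring

/-- The functional is tested on the standard comb, a single tree of degree `1 - weight ε` whose
class is a nonzero multiple of the basis element. -/
theorem weight_of_mem_dualDeg [CharZero k] {n : ℕ} {e : ℤ}
    {φ : Module.Dual k ((dualOperad k).operad n)} (hφ : φ ∈ (dualOperad k).dualDeg n e)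
    {ε : Fin n → ZMod 2} (hε : ε ≠ 0) (h : φ (basisElement k ε) ≠ 0) :
    (weight ε : ℤ) = e + 1 := by
  obtain ⟨z, hz⟩ := exists_eq_one hε
  obtain ⟨c, hc, hev⟩ := exists_ev_comb (k := k) hz
  have hdeg : (comb z (combList z ε)).degree codeg = 1 - weight ε := by
    refine degree_of_coef_ne_zero (k := k) ?_
    rw [hev, map_smul, coef_mono, if_pos rfl, smul_eq_mul, mul_one]
    exact hc
  have hmk : ((dualOperad k).ideal n).mkQ (Finsupp.single (standardComb z ε) 1) =
      c • basisElement k ε := by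
    refine evOperad_injective k n ?_
    rw [map_smul, evOperad_basisElement k hε, evOperad_mk, evSpan_single, one_smul, standardComb,
      hev]
  by_contra hne
  have := hφ (standardComb z ε) fun h' => hne (by
    have h'' : (comb z (combList z ε)).degree codeg = -e := h'
    rw [hdeg] at h''
    linarith)
  rw [← Submodule.mkQ_apply, hmk, map_smul, smul_eq_mul] at this
  exact (mul_ne_zero hc h) this

end Degrees

/-! ## Gradings -/

section GradingSigns

variable {k : Type u} [Field k] {W : Type v} [AddCommGroup W] [Module k W] (𝒲 : Grading k W)

theorem Grading.sign_of_mem {i : ℤ} {w : W} (hw : w ∈ 𝒲.deg i) : 𝒲.sign w = sg k i • w := by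
  rw [Grading.sign, LinearMap.sub_apply, 𝒲.proj_of_mem 0 hw, 𝒲.proj_of_mem 1 hw]
  rcases Int.even_or_odd i with h | h
  · have h0 : (i : ZMod 2) = 0 := (ZMod.intCast_zmod_eq_zero_iff_dvd i 2).2 h.two_dvd
    rw [sg_even k h, h0]
    simp
  · obtain ⟨j, rfl⟩ := h
    have h0 : ((2 * j + 1 : ℤ) : ZMod 2) = 1 := by
      push_cast
      rw [show (2 : ZMod 2) = 0 from rfl]
      simp
    rw [sg_odd k ⟨j, rfl⟩, h0]
    simp

theorem Grading.sign_sign (w : W) : 𝒲.sign (𝒲.sign w) = w := by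
  have : 𝒲.sign ∘ₗ 𝒲.sign = LinearMap.id := 𝒲.hom_ext fun i w hw => by
    rw [LinearMap.comp_apply, 𝒲.sign_of_mem hw, map_smul, 𝒲.sign_of_mem hw, smul_smul, sg_mul_self,
      one_smul, LinearMap.id_apply]
  exact LinearMap.congr_fun this w

theorem Grading.sign_proj (p : ZMod 2) (w : W) :
    𝒲.sign (𝒲.proj p w) = (if p = 1 then -1 else 1 : k) • 𝒲.proj p w := by
  rw [Grading.sign, LinearMap.sub_apply, 𝒲.proj_proj, 𝒲.proj_proj]
  rcases zmod_two_cases p with rfl | rfl <;> simp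

theorem Grading.sign_shift (m : ℤ) (w : W) : (𝒲.shift m).sign w = sg k m • 𝒲.sign w := by
  have : (𝒲.shift m).sign = sg k m • 𝒲.sign := 𝒲.hom_ext fun i w hw => by
    have hw' : w ∈ (𝒲.shift m).deg (i - m) := by
      change w ∈ 𝒲.deg (i - m + m)
      rwa [sub_add_cancel]
    rw [LinearMap.smul_apply, 𝒲.sign_of_mem hw, (𝒲.shift m).sign_of_mem hw', smul_smul, ← sg_add]
    congr 1
    exact sg_congr k ⟨-m, by ring⟩
  rw [this, LinearMap.smul_apply]

theorem Grading.hom_ext₂ {X : Type w} [AddCommGroup X] [Module k X] {f g : W →ₗ[k] W →ₗ[k] X}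
    (h : ∀ i j, ∀ a ∈ 𝒲.deg i, ∀ b ∈ 𝒲.deg j, f a b = g a b) : f = g :=
  𝒲.hom_ext fun i a ha => 𝒲.hom_ext fun j b hb => h i j a ha b hb

theorem Grading.flip_of_mem {X : Type w} [AddCommGroup X] [Module k X] (f : W →ₗ[k] W →ₗ[k] X)
    {i j : ℤ} {a b : W} (ha : a ∈ 𝒲.deg i) (hb : b ∈ 𝒲.deg j) :
    𝒲.flip f a b = sg k (i * j) • f b a := by
  have h : 𝒲.flip f a b = f b (𝒲.proj 0 a) + f (𝒲.sign b) (𝒲.proj 1 a) := rfl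
  rw [h, 𝒲.proj_of_mem 0 ha, 𝒲.proj_of_mem 1 ha, 𝒲.sign_of_mem hb]
  rcases Int.even_or_odd i with hi | hi
  · have h0 : (i : ZMod 2) = 0 := (ZMod.intCast_zmod_eq_zero_iff_dvd i 2).2 hi.two_dvd
    rw [h0, sg_even k (hi.mul_right j)]
    simp
  · have h0 : (i : ZMod 2) = 1 := by
      obtain ⟨l, rfl⟩ := hi
      push_cast
      rw [show (2 : ZMod 2) = 0 from rfl]
      simp
    obtain ⟨l, rfl⟩ := hi
    rw [h0, sg_congr k (i := (2 * l + 1) * j) (j := j) ⟨l * j, by ring⟩]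
    simp

end GradingSigns

/-! ## Signs of permutations -/

section PermutationSigns

/-- The sign by which factors of parities `δ i` jump over the preceding factors with
parities `ε`. -/
def crossSign {n : ℕ} (ε δ : Fin n → ZMod 2) : ℤˣ :=
  ∏ i, ∏ j, if i < j ∧ ε j = 1 ∧ δ i = 1 then -1 else 1

theorem prod_prod_eq {n : ℕ} (F : Fin n → Fin n → ℤˣ) (hF : ∀ i, F i i = 1) :
    ∏ i, ∏ j, F i j = ∏ i, ∏ j, if i < j then F i j * F j i else 1 := by
  have h1 : ∀ i j, F i j = (if i < j then F i j else 1) * (if j < i then F i j else 1) := by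
    intro i j
    rcases lt_trichotomy i j with h | h | h
    · simp [h, h.le]
    · subst h; simp [hF]
    · simp [h, h.le]
  have h2 : ∏ i, ∏ j, F i j = (∏ i, ∏ j, if i < j then F i j else 1) *
      ∏ i, ∏ j, if j < i then F i j else 1 := by
    simp only [← Finset.prod_mul_distrib]
    exact Finset.prod_congr rfl fun i _ => Finset.prod_congr rfl fun j _ => h1 i j
  rw [h2, Finset.prod_comm (f := fun i j => if j < i then F i j else 1)]
  simp only [← Finset.prod_mul_distrib]
  refine Finset.prod_congr rfl fun i _ => Finset.prod_congr rfl fun j _ => ?_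
  split_ifs <;> simp

/-- Here `η` are the parities in `(V ⊕ V[-1])[1]`, `ε` those of the symbols `Π`, and `η + ε` those
of the entries in `V[1]`. Separating the symbols from the entries costs `crossSign`, and permuting
before or after the separation must agree. The identity is checked for each pair of indices, over
all parities. -/
theorem crossSign_perm {n : ℕ} (σ : Equiv.Perm (Fin n)) (ε η : Fin n → ZMod 2) :
    koszulSign σ η * crossSign (fun i => ε (σ.symm i)) (fun i => η (σ.symm i) + ε (σ.symm i)) =
      crossSign ε (fun i => η i + ε i) * koszulSign σ ε * koszulSign σ (fun i => η i + ε i) := by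
  have h : crossSign (fun i => ε (σ.symm i)) (fun i => η (σ.symm i) + ε (σ.symm i)) =
      ∏ i, ∏ j, if σ i < σ j ∧ ε j = 1 ∧ η i + ε i = 1 then -1 else 1 := by
    rw [crossSign, ← Equiv.prod_comp σ]
    refine Finset.prod_congr rfl fun i _ => ?_
    rw [← Equiv.prod_comp σ]
    simp
  rw [h, crossSign, koszulSign, koszulSign, koszulSign]
  simp only [← Finset.prod_mul_distrib]
  refine (prod_prod_eq _ (by simp)).trans (Eq.trans ?_ (prod_prod_eq _ (by simp)).symm)
  refine Finset.prod_congr rfl fun i _ => Finset.prod_congr rfl fun j _ => ?_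
  by_cases hij : i < j
  · have hne : σ i ≠ σ j := fun h => hij.ne (σ.injective h)
    rw [if_pos hij, if_pos hij]
    generalize ε i = a, ε j = b, η i = c, η j = d
    rcases lt_or_gt_of_ne hne with h | h
    · simp only [hij, h, not_lt.2 hij.le, not_lt.2 h.le, true_and, false_and, if_false]
      revert a b c d
      decide
    · simp only [hij, h, not_lt.2 hij.le, not_lt.2 h.le, true_and, false_and, if_false]
      revert a b c d
      decide
  · rw [if_neg hij, if_neg hij]

/-- The sum of the exponents after the index `i`. -/
def weightAfter {n : ℕ} (ε : Fin n → ZMod 2) (i : Fin n) : ℕ :=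
  ∑ j, if i < j then (ε j).val else 0

theorem weightAfter_cons_zero {n : ℕ} (e : ZMod 2) (ε : Fin n → ZMod 2) :
    weightAfter (Fin.cons e ε : Fin (n + 1) → ZMod 2) 0 = weight ε := by
  rw [weightAfter, Fin.sum_univ_succ]
  simp [weight]

theorem weightAfter_cons_succ {n : ℕ} (e : ZMod 2) (ε : Fin n → ZMod 2) (i : Fin n) :
    weightAfter (Fin.cons e ε : Fin (n + 1) → ZMod 2) i.succ = weightAfter ε i := by
  rw [weightAfter, Fin.sum_univ_succ]
  simp [weightAfter]

end PermutationSigns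

/-! ## The comparison map -/

section Comparison

variable {k : Type u} [Field k] {V : Type v} [AddCommGroup V] [Module k V] (𝒱 : Grading k V)

/-- The grading of `(V ⊕ V[-1])[1]`. -/
abbrev shiftedDouble : Grading k (V × V) := (PreLieSq.double 𝒱).shift 1

variable (k V) in
/-- The components of an element of `V ⊕ V[-1]`. -/
def part (e : ZMod 2) : V × V →ₗ[k] V :=
  if e = 1 then LinearMap.snd k V V else LinearMap.fst k V V

variable (k V) in
/-- The inclusions of the summands of `V ⊕ V[-1]`. -/
def inject (e : ZMod 2) : V →ₗ[k] V × V :=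
  if e = 1 then LinearMap.inr k V V else LinearMap.inl k V V

theorem part_inject (e e' : ZMod 2) (x : V) :
    part k V e (inject k V e' x) = if e = e' then x else 0 := by
  rcases zmod_two_cases e with rfl | rfl <;> rcases zmod_two_cases e' with rfl | rfl <;>
    simp [part, inject]

theorem sum_inject_part (x : V × V) : ∑ e, inject k V e (part k V e x) = x := by
  rw [show (∑ e : ZMod 2, inject k V e (part k V e x)) = inject k V 0 (part k V 0 x) +
    inject k V 1 (part k V 1 x) from Fin.sum_univ_two _]
  simp [part, inject]

theorem part_mem {i : ℤ} {w : V × V} (hw : w ∈ (shiftedDouble 𝒱).deg i) (e : ZMod 2) :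
    part k V e w ∈ (𝒱.shift 1).deg (i - e.val) := by
  obtain ⟨h1, h2⟩ := hw
  rcases zmod_two_cases e with rfl | rfl
  · have : (i - ((0 : ZMod 2).val : ℤ)) = i := by simp
    rw [this]
    exact h1
  · have e1 : i - ((1 : ZMod 2).val : ℤ) + 1 = i + 1 + -1 := by
      rw [show (1 : ZMod 2).val = 1 from rfl]
      push_cast
      ring
    change w.2 ∈ 𝒱.deg (i - ((1 : ZMod 2).val : ℤ) + 1)
    rw [e1]
    exact h2

theorem inject_mem {i : ℤ} {x : V} (hx : x ∈ (𝒱.shift 1).deg i) (e : ZMod 2) :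
    inject k V e x ∈ (shiftedDouble 𝒱).deg (i + e.val) := by
  rcases zmod_two_cases e with rfl | rfl
  · have : (i + ((0 : ZMod 2).val : ℤ)) = i := by simp
    rw [this]
    exact ⟨hx, zero_mem _⟩
  · refine ⟨zero_mem _, ?_⟩
    have e1 : i + ((1 : ZMod 2).val : ℤ) + 1 + -1 = i + 1 := by
      rw [show (1 : ZMod 2).val = 1 from rfl]
      push_cast
      ring
    change x ∈ 𝒱.deg (i + ((1 : ZMod 2).val : ℤ) + 1 + -1)
    rw [e1]
    exact hx

/-- Removing the symbol `Π` changes the parity by `e`. -/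
theorem part_proj (e p : ZMod 2) (w : V × V) :
    part k V e ((shiftedDouble 𝒱).proj p w) = (𝒱.shift 1).proj (p + e) (part k V e w) := by
  have : part k V e ∘ₗ (shiftedDouble 𝒱).proj p = (𝒱.shift 1).proj (p + e) ∘ₗ part k V e := by
    refine (shiftedDouble 𝒱).hom_ext fun i w hw => ?_
    rw [LinearMap.comp_apply, LinearMap.comp_apply, (shiftedDouble 𝒱).proj_of_mem p hw,
      (𝒱.shift 1).proj_of_mem _ (part_mem 𝒱 hw e), apply_ite (part k V e), map_zero]
    refine if_congr ?_ rfl rfl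
    push_cast
    rw [ZMod.natCast_zmod_val]
    generalize (i : ZMod 2) = j
    revert e p j
    decide
  exact LinearMap.congr_fun this w

/-- The power of the grading involution of `V[1]` with exponent `weightAfter ε i`. -/
def twist {n : ℕ} (ε : Fin n → ZMod 2) (i : Fin n) : V →ₗ[k] V :=
  (𝒱.shift 1).sign ^ weightAfter ε i

theorem twist_twist {n : ℕ} (ε : Fin n → ZMod 2) (i : Fin n) (x : V) :
    twist 𝒱 ε i (twist 𝒱 ε i x) = x := by
  have h : (𝒱.shift 1).sign * (𝒱.shift 1).sign = 1 :=
    LinearMap.ext fun x => (𝒱.shift 1).sign_sign x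
  rw [twist, ← Module.End.mul_apply, ← (Commute.refl _).mul_pow, h, one_pow, Module.End.one_apply]

theorem twist_mem {n : ℕ} (ε : Fin n → ZMod 2) (i : Fin n) {d : ℤ} {x : V}
    (hx : x ∈ (𝒱.shift 1).deg d) : twist 𝒱 ε i x ∈ (𝒱.shift 1).deg d := by
  rw [twist]
  induction weightAfter ε i with
  | zero => exact hx
  | succ m ih =>
    rw [pow_succ', Module.End.mul_apply, (𝒱.shift 1).sign_of_mem ih]
    exact Submodule.smul_mem _ _ ih

theorem twist_proj {n : ℕ} (ε : Fin n → ZMod 2) (i : Fin n) (d : ZMod 2) (x : V) :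
    twist 𝒱 ε i ((𝒱.shift 1).proj d x) =
      (((∏ j, if i < j ∧ ε j = 1 ∧ d = 1 then -1 else 1 : ℤˣ) : ℤ) : k) •
        (𝒱.shift 1).proj d x := by
  have h : ∀ m : ℕ, ((𝒱.shift 1).sign ^ m) ((𝒱.shift 1).proj d x) =
      ((if d = 1 then -1 else 1 : k) ^ m) • (𝒱.shift 1).proj d x := by
    intro m
    induction m with
    | zero => simp
    | succ m ih =>
      rw [pow_succ', Module.End.mul_apply, ih, map_smul, Grading.sign_proj, smul_smul, pow_succ]
  rw [twist, h, weightAfter, ← Finset.prod_pow_eq_pow_sum]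
  congr 1
  push_cast
  refine Finset.prod_congr rfl fun j _ => ?_
  generalize ε j = a
  rcases zmod_two_cases a with rfl | rfl <;> by_cases hij : i < j <;> by_cases hd : d = 1 <;>
    simp [hij, hd, show (1 : ZMod 2).val = 1 from rfl]

theorem tprod_twist {n : ℕ} (ε δ : Fin n → ZMod 2) (x : Fin n → V) :
    PiTensorProduct.tprod k (fun i => twist 𝒱 ε i ((𝒱.shift 1).proj (δ i) (x i))) =
      (((crossSign ε δ : ℤˣ) : ℤ) : k) •
        PiTensorProduct.tprod k (fun i => (𝒱.shift 1).proj (δ i) (x i)) := by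
  simp only [twist_proj]
  rw [MultilinearMap.map_smul_univ, crossSign]
  push_cast
  rfl

variable (k V) in
/-- The tensor product of a functional and a tensor, as a chain. -/
def pureChain (n : ℕ) : Module.Dual k ((dualOperad k).operad n) →ₗ[k] (⨂[k] _ : Fin n, V) →ₗ[k]
    (preLieSqOperad k).PreChains V n :=
  TensorProduct.mk k (Module.Dual k ((dualOperad k).operad n)) (⨂[k] _ : Fin n, V)

theorem preChains_ext {n : ℕ} {M : Type*} [AddCommGroup M] [Module k M]
    {f g : (preLieSqOperad k).PreChains V n →ₗ[k] M}
    (h : ∀ φ v, f (pureChain k V n φ (PiTensorProduct.tprod k v)) =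
      g (pureChain k V n φ (PiTensorProduct.tprod k v))) : f = g :=
  TensorProduct.ext (LinearMap.ext fun φ => PiTensorProduct.ext (MultilinearMap.ext fun v => h φ v))

variable (k) in
/-- The sign of the component with exponents `ε` of the comparison map. -/
def compSign {n : ℕ} (ε : Fin n → ZMod 2) : k := sg k (n + (weight ε).choose 2)

theorem compSign_mul_self {n : ℕ} (ε : Fin n → ZMod 2) : compSign k ε * compSign k ε = 1 :=
  sg_mul_self _ _

/-- The comparison map from `(V ⊕ V[-1])[1]^{⊗ n}`. -/
def toPre (n : ℕ) : (⨂[k] _ : Fin n, V × V) →ₗ[k] (preLieSqOperad k).PreChains V n :=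
  ∑ ε : Fin n → ZMod 2, compSign k ε • (pureChain k V n (coordinate k ε) ∘ₗ
    PiTensorProduct.map fun i => twist 𝒱 ε i ∘ₗ part k V (ε i))

theorem toPre_tprod {n : ℕ} (w : Fin n → V × V) :
    toPre 𝒱 n (PiTensorProduct.tprod k w) = ∑ ε : Fin n → ZMod 2, compSign k ε •
      pureChain k V n (coordinate k ε)
        (PiTensorProduct.tprod k fun i => twist 𝒱 ε i (part k V (ε i) (w i))) := by
  simp [toPre, PiTensorProduct.map_tprod]

/-- The map in the opposite direction. -/
def fromPre (n : ℕ) : (preLieSqOperad k).PreChains V n →ₗ[k] (⨂[k] _ : Fin n, V × V) :=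
  TensorProduct.lift (∑ ε : Fin n → ZMod 2, if ε = 0 then 0 else compSign k ε •
    (Module.Dual.eval k _ (basisElement k ε)).smulRight
      (PiTensorProduct.map fun i => inject k V (ε i) ∘ₗ twist 𝒱 ε i))

theorem fromPre_pureChain {n : ℕ} (φ : Module.Dual k ((dualOperad k).operad n)) (v : Fin n → V) :
    fromPre 𝒱 n (pureChain k V n φ (PiTensorProduct.tprod k v)) =
      ∑ ε : Fin n → ZMod 2, if ε = 0 then 0 else (compSign k ε * φ (basisElement k ε)) •
        PiTensorProduct.tprod k fun i => inject k V (ε i) (twist 𝒱 ε i (v i)) := by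
  refine (TensorProduct.lift.tmul φ (PiTensorProduct.tprod k v)).trans ?_
  rw [LinearMap.sum_apply, LinearMap.sum_apply]
  refine Finset.sum_congr rfl fun ε _ => ?_
  split_ifs with h
  · rfl
  · simp [PiTensorProduct.map_tprod, smul_smul]

theorem toPre_inject {n : ℕ} (ε : Fin n → ZMod 2) (v : Fin n → V) :
    toPre 𝒱 n (PiTensorProduct.tprod k fun i => inject k V (ε i) (v i)) = compSign k ε •
      pureChain k V n (coordinate k ε) (PiTensorProduct.tprod k fun i => twist 𝒱 ε i (v i)) := by
  rw [toPre_tprod, Finset.sum_eq_single ε]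
  · simp [part_inject]
  · intro δ _ hδ
    obtain ⟨i, hi⟩ := Function.ne_iff.1 hδ
    have : (PiTensorProduct.tprod k
        fun i => twist 𝒱 δ i (part k V (δ i) (inject k V (ε i) (v i)))) = 0 :=
      MultilinearMap.map_coord_zero _ i (by rw [part_inject, if_neg hi, map_zero])
    rw [this, map_zero, smul_zero]
  · simp

/-- The omitted term `ε = 0` does no harm, since its coordinate functional is zero. -/
theorem toPre_fromPre {n : ℕ} (x : (preLieSqOperad k).PreChains V n) :
    toPre 𝒱 n (fromPre 𝒱 n x) = x := by
  have : toPre 𝒱 n ∘ₗ fromPre 𝒱 n = LinearMap.id := preChains_ext fun φ v => by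
    rw [LinearMap.comp_apply, fromPre_pureChain, map_sum, LinearMap.id_apply]
    conv_rhs => rw [eq_sum_coordinate k φ, map_sum, LinearMap.sum_apply]
    refine Finset.sum_congr rfl fun ε _ => ?_
    split_ifs with h
    · rw [h, coordinate_zero]
      simp
    · rw [map_smul, toPre_inject, smul_smul, mul_right_comm, compSign_mul_self, one_mul, map_smul,
        LinearMap.smul_apply]
      simp only [twist_twist]
  exact LinearMap.congr_fun this x

/-- The tensor is split into its components by the position of the symbols `Π`. All of them are
recovered except `ε = 0`, which is the projection to the tensors in `V`. -/
theorem fromPre_toPre {n : ℕ} (t : ⨂[k] _ : Fin n, V × V) :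
    fromPre 𝒱 n (toPre 𝒱 n t) =
      t - PiTensorProduct.map (fun _ => LinearMap.inl k V V)
        (PiTensorProduct.map (fun _ => LinearMap.fst k V V) t) := by
  have : fromPre 𝒱 n ∘ₗ toPre 𝒱 n = LinearMap.id -
      PiTensorProduct.map (fun _ => LinearMap.inl k V V) ∘ₗ
        PiTensorProduct.map (fun _ => LinearMap.fst k V V) := by
    refine PiTensorProduct.ext (MultilinearMap.ext fun w => ?_)
    simp only [LinearMap.compMultilinearMap_apply, LinearMap.comp_apply, LinearMap.sub_apply,
      LinearMap.id_apply, PiTensorProduct.map_tprod]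
    have h1 : ∀ ε : Fin n → ZMod 2, fromPre 𝒱 n (pureChain k V n (coordinate k ε)
        (PiTensorProduct.tprod k fun i => twist 𝒱 ε i (part k V (ε i) (w i)))) =
        if ε = 0 then 0 else compSign k ε • PiTensorProduct.tprod k
          fun i => inject k V (ε i) (part k V (ε i) (w i)) := by
      intro ε
      rw [fromPre_pureChain, Finset.sum_eq_single ε]
      · split_ifs with h
        · rfl
        · rw [coordinate_basisElement k _ h, if_pos rfl, mul_one]
          simp only [twist_twist]
      · intro δ _ hδ
        split_ifs with h
        · rfl
        · rw [coordinate_basisElement k _ h, if_neg (Ne.symm hδ), mul_zero, zero_smul]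
      · simp
    have h2 : PiTensorProduct.tprod k w = ∑ ε : Fin n → ZMod 2,
        PiTensorProduct.tprod k fun i => inject k V (ε i) (part k V (ε i) (w i)) := by
      rw [← MultilinearMap.map_sum (PiTensorProduct.tprod k)
        (fun i e => inject k V e (part k V e (w i)))]
      simp only [sum_inject_part]
    have h3 : (PiTensorProduct.tprod k fun i => LinearMap.inl k V V (LinearMap.fst k V V (w i))) =
        PiTensorProduct.tprod k fun i => inject k V ((0 : Fin n → ZMod 2) i)
          (part k V ((0 : Fin n → ZMod 2) i) (w i)) := by
      simp [inject, part]
    rw [toPre_tprod, map_sum, h3, h2, eq_sub_iff_add_eq]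
    simp only [map_smul, h1]
    rw [← Finset.sum_erase_add _ _ (Finset.mem_univ (0 : Fin n → ZMod 2)),
      ← Finset.sum_erase_add (a := (0 : Fin n → ZMod 2)) _ (fun ε : Fin n → ZMod 2 =>
        PiTensorProduct.tprod k fun i => inject k V (ε i) (part k V (ε i) (w i)))
        (Finset.mem_univ _)]
    rw [if_pos rfl, smul_zero, add_zero]
    congr 1
    refine Finset.sum_congr rfl fun ε hε => ?_
    rw [if_neg (Finset.ne_of_mem_erase hε), smul_smul, compSign_mul_self, one_smul]
  exact LinearMap.congr_fun this t

theorem toPre_inl {n : ℕ} (t : ⨂[k] _ : Fin n, V) :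
    toPre 𝒱 n (PiTensorProduct.map (fun _ => LinearMap.inl k V V) t) = 0 := by
  have : toPre 𝒱 n ∘ₗ PiTensorProduct.map (fun _ => LinearMap.inl k V V) = 0 := by
    refine PiTensorProduct.ext (MultilinearMap.ext fun v => ?_)
    simp only [LinearMap.compMultilinearMap_apply, LinearMap.comp_apply, PiTensorProduct.map_tprod]
    have h := toPre_inject 𝒱 (0 : Fin n → ZMod 2) v
    rw [coordinate_zero, map_zero, LinearMap.zero_apply, smul_zero] at h
    exact h
  exact LinearMap.congr_fun this t

theorem chainRep_pureChain {n : ℕ} (σ : Equiv.Perm (Fin n))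
    (φ : Module.Dual k ((dualOperad k).operad n)) (t : ⨂[k] _ : Fin n, V) :
    (preLieSqOperad k).chainRep 𝒱 n σ (pureChain k V n φ t) =
      pureChain k V n (((dualOperad k).operadRep n).dual σ φ) (koszulRep (𝒱.shift 1) n σ t) := rfl

/-- The Koszul sign of the full tensor splits into that of the functional and that of the entries;
the twists supply the two crossing signs required by `crossSign_perm`. -/
theorem toPre_koszulRep {n : ℕ} (σ : Equiv.Perm (Fin n)) (t : ⨂[k] _ : Fin n, V × V) :
    toPre 𝒱 n (koszulRep (shiftedDouble 𝒱) n σ t) =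
      (preLieSqOperad k).chainRep 𝒱 n σ (toPre 𝒱 n t) := by
  have : toPre 𝒱 n ∘ₗ koszulAct (shiftedDouble 𝒱) n σ =
      (preLieSqOperad k).chainRep 𝒱 n σ ∘ₗ toPre 𝒱 n := by
    refine koszul_ext (shiftedDouble 𝒱) fun η w => ?_
    -- The sum over exponents on one side is reindexed by transporting them along `σ`; then the
    -- terms agree one by one.
    rw [LinearMap.comp_apply, koszulAct_tprod, LinearMap.comp_apply, map_smul, toPre_tprod,
      toPre_tprod, map_sum, Finset.smul_sum,
      ← Equiv.sum_comp (Equiv.arrowCongr σ (Equiv.refl (ZMod 2)))]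
    refine Finset.sum_congr rfl fun ε _ => ?_
    have hc : compSign k (fun i => ε (σ.symm i)) = compSign k ε := by
      rw [compSign, compSign, weight_comp ε σ.symm]
    have he : Equiv.arrowCongr σ (Equiv.refl (ZMod 2)) ε = fun i => ε (σ.symm i) := rfl
    rw [he, hc, map_smul, chainRep_pureChain, dual_coordinate]
    simp only [part_proj]
    rw [tprod_twist 𝒱 (fun i => ε (σ.symm i)) (fun i => η (σ.symm i) + ε (σ.symm i))
      (fun i => part k V (ε (σ.symm i)) (w (σ.symm i))),
      tprod_twist 𝒱 ε (fun i => η i + ε i) (fun i => part k V (ε i) (w i)), map_smul, map_smul]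
    have hk := koszulAct_tprod (𝒱.shift 1) σ (fun i => η i + ε i) (fun i => part k V (ε i) (w i))
    have hk' : ∀ (c : k) (x : ⨂[k] _ : Fin n, V), koszulRep (𝒱.shift 1) n σ (c • x) =
      c • koszulAct (𝒱.shift 1) n σ x := fun c x => map_smul (koszulAct (𝒱.shift 1) n σ) c x
    rw [hk', hk]
    simp only [LinearMap.smul_apply, map_smul, smul_smul]
    congr 1
    have := congrArg (fun u : ℤˣ => ((u : ℤ) : k)) (crossSign_perm σ ε η)
    push_cast at this
    linear_combination compSign k ε * this
  exact LinearMap.congr_fun this t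

end Comparison

/-! ### Signs of the operations and components of the double bracket -/

section Operations

variable {k : Type u} [Field k] {V : Type v} [AddCommGroup V] [Module k V] {𝒱 : Grading k V}
  (A : PreLieSq 𝒱)

theorem zsmul_units_eq (u : ℤ) (x : V) : u.negOnePow • x = sg k u • x := by
  rw [Units.smul_def, sg, Int.cast_smul_eq_zsmul]

namespace PreLieSq

theorem sign_circ (a b : V) : 𝒱.sign (A.circ a b) = A.circ (𝒱.sign a) (𝒱.sign b) := by
  have : A.circ.compr₂ 𝒱.sign = A.circ.compl₁₂ 𝒱.sign 𝒱.sign :=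
    𝒱.hom_ext₂ fun i j a ha b hb => by
      rw [LinearMap.compr₂_apply, LinearMap.compl₁₂_apply, 𝒱.sign_of_mem ha, 𝒱.sign_of_mem hb,
        𝒱.sign_of_mem (A.circ_mem i j a ha b hb), map_smul, map_smul, LinearMap.smul_apply,
        smul_smul, sg_add, mul_comm]
  exact LinearMap.congr_fun₂ this a b

theorem sign_bul (a b : V) : 𝒱.sign (A.bul a b) = -A.bul (𝒱.sign a) (𝒱.sign b) := by
  have : A.bul.compr₂ 𝒱.sign = -A.bul.compl₁₂ 𝒱.sign 𝒱.sign :=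
    𝒱.hom_ext₂ fun i j a ha b hb => by
      rw [LinearMap.compr₂_apply, LinearMap.neg_apply, LinearMap.neg_apply,
        LinearMap.compl₁₂_apply, 𝒱.sign_of_mem ha, 𝒱.sign_of_mem hb,
        𝒱.sign_of_mem (A.bul_mem i j a ha b hb), map_smul, map_smul, LinearMap.smul_apply,
        smul_smul, sg_add, sg_add, sg_one, mul_neg_one, neg_smul, mul_comm]
  exact LinearMap.congr_fun₂ this a b

theorem sign_flip_circ (a b : V) :
    𝒱.sign (𝒱.flip A.circ a b) = 𝒱.flip A.circ (𝒱.sign a) (𝒱.sign b) := by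
  have : (𝒱.flip A.circ).compr₂ 𝒱.sign = (𝒱.flip A.circ).compl₁₂ 𝒱.sign 𝒱.sign :=
    𝒱.hom_ext₂ fun i j a ha b hb => by
      rw [LinearMap.compr₂_apply, LinearMap.compl₁₂_apply, 𝒱.flip_of_mem _ ha hb, map_smul,
        A.sign_circ, 𝒱.sign_of_mem ha, 𝒱.sign_of_mem hb, map_smul, map_smul, map_smul, map_smul,
        LinearMap.smul_apply, LinearMap.smul_apply, 𝒱.flip_of_mem _ ha hb]
      simp only [smul_smul]
      congr 1
      ring
  exact LinearMap.congr_fun₂ this a b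

/-- The graded symmetry of the bracket in sign-free form: the flipped term of the double bracket is
just the bracket in the original order. -/
theorem flip_bul_sign (a b : V) : 𝒱.flip A.bul (𝒱.sign a) (𝒱.sign b) = A.bul a b := by
  have : (𝒱.flip A.bul).compl₁₂ 𝒱.sign 𝒱.sign = A.bul := 𝒱.hom_ext₂ fun i j a ha b hb => by
    have h := A.bul_symm i j a ha b hb
    rw [zsmul_units_eq (k := k), zsmul_units_eq (k := k), zsmul_units_eq (k := k), smul_smul] at h
    rw [LinearMap.compl₁₂_apply, 𝒱.sign_of_mem ha, 𝒱.sign_of_mem hb, map_smul, map_smul,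
      LinearMap.smul_apply, 𝒱.flip_of_mem _ ha hb, smul_smul, smul_smul, mul_assoc,
      mul_comm (sg k i), ← smul_smul, ← h, smul_smul, sg_mul_self, one_smul]
  exact LinearMap.congr_fun₂ this a b

theorem sign_double (x : V × V) : (double 𝒱).sign x = (𝒱.sign x.1, -𝒱.sign x.2) := by
  have : (double 𝒱).sign = 𝒱.sign.prodMap (-𝒱.sign) := (double 𝒱).hom_ext fun i w hw => by
    have h2 := 𝒱.sign_shift (-1) w.2
    rw [(𝒱.shift (-1)).sign_of_mem hw.2, sg_neg, sg_one, neg_one_smul] at h2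
    rw [(double 𝒱).sign_of_mem hw, LinearMap.prodMap_apply, 𝒱.sign_of_mem hw.1,
      LinearMap.neg_apply, ← h2]
    rfl
  rw [this]
  rfl

theorem part_zero_doubleBr (x y : V × V) : part k V 0 (A.doubleBr x y) =
    A.circ x.1 y.1 - 𝒱.flip A.circ x.1 y.1 - A.bul (𝒱.sign x.2) y.1 + A.bul x.1 y.2 := by
  simp [doubleBr, part, lieBr, flip_bul_sign]

theorem part_one_doubleBr (x y : V × V) : part k V 1 (A.doubleBr x y) =
    A.circ x.2 y.1 - 𝒱.flip A.circ (𝒱.sign x.1) y.2 + A.bul x.2 y.2 := by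
  simp [doubleBr, part]

end PreLieSq

end Operations

/-! ## Compatibility with the differentials -/

section Intertwining

variable {k : Type u} [Field k] {V : Type v} [AddCommGroup V] [Module k V] {𝒱 : Grading k V}
  (A : PreLieSq 𝒱)

theorem sum_zmod_two {M : Type*} [AddCommMonoid M] (F : ZMod 2 → M) : ∑ e, F e = F 0 + F 1 :=
  Fin.sum_univ_two F

theorem sum_cons {n : ℕ} {M : Type*} [AddCommMonoid M] (F : (Fin (n + 1) → ZMod 2) → M) :
    ∑ ε, F ε = ∑ T : Fin n → ZMod 2, (F (Fin.cons 0 T) + F (Fin.cons 1 T)) := by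
  rw [← Equiv.sum_comp (Fin.consEquiv fun _ : Fin (n + 1) => ZMod 2), Fintype.sum_prod_type_right]
  refine Finset.sum_congr rfl fun T _ => ?_
  exact sum_zmod_two _

/-- By Pascal's rule, a further exponent one raises the binomial coefficient by `weight T`. This is
the sign of a leading symbol `Π` passing the others; each additional factor contributes `-1` through
`n`. -/
theorem compSign_cons {n : ℕ} (e : ZMod 2) (T : Fin n → ZMod 2) :
    compSign k (Fin.cons e T : Fin (n + 1) → ZMod 2) =
      -((if e = 1 then sg k (weight T) else 1) * compSign k T) := by
  rw [compSign, compSign, weight_cons]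
  rcases zmod_two_cases e with rfl | rfl
  · rw [if_neg (by decide), one_mul, ZMod.val_zero, zero_add]
    push_cast
    rw [add_right_comm, sg_add, sg_one, mul_neg_one]
  · rw [if_pos rfl, show (1 : ZMod 2).val = 1 from rfl, add_comm 1, Nat.choose_succ_succ' _ 1,
      Nat.choose_one_right, ← sg_add, ← mul_neg_one, ← sg_one, ← sg_add]
    push_cast
    congr 1
    ring

variable (k) in
/-- The chain with the given first entry and the functional with exponents `e, T`. -/
def headChain {n : ℕ} (e : ZMod 2) (T : Fin n → ZMod 2) (u : Fin n → V) :
    V →ₗ[k] (preLieSqOperad k).PreChains V (n + 1) :=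
  pureChain k V (n + 1) (coordinate k (Fin.cons e T : Fin (n + 1) → ZMod 2)) ∘ₗ
    { toFun := fun x => PiTensorProduct.tprod k (Fin.cons x u : Fin (n + 1) → V)
      map_add' := fun x y => tprod_cons_add u x y
      map_smul' := fun c x => tprod_cons_smul u c x }

theorem headChain_apply {n : ℕ} (e : ZMod 2) (T : Fin n → ZMod 2) (u : Fin n → V) (x : V) :
    headChain k e T u x = pureChain k V (n + 1)
      (coordinate k (Fin.cons e T : Fin (n + 1) → ZMod 2))
      (PiTensorProduct.tprod k (Fin.cons x u : Fin (n + 1) → V)) := rfl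

theorem toPre_tprod_cons {n : ℕ} (x : V × V) (w : Fin n → V × V) :
    toPre 𝒱 (n + 1) (PiTensorProduct.tprod k (Fin.cons x w : Fin (n + 1) → V × V)) =
      ∑ T : Fin n → ZMod 2, ∑ e : ZMod 2, compSign k (Fin.cons e T : Fin (n + 1) → ZMod 2) •
        headChain k e T (fun i => twist 𝒱 T i (part k V (T i) (w i)))
          (((𝒱.shift 1).sign ^ weight T) (part k V e x)) := by
  rw [toPre_tprod, sum_cons]
  refine Finset.sum_congr rfl fun T _ => ?_
  refine Eq.trans ?_ (sum_zmod_two _).symm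
  have h : ∀ e : ZMod 2, (fun i => twist 𝒱 (Fin.cons e T : Fin (n + 1) → ZMod 2) i
      (part k V ((Fin.cons e T : Fin (n + 1) → ZMod 2) i)
        ((Fin.cons x w : Fin (n + 1) → V × V) i))) =
      (Fin.cons (((𝒱.shift 1).sign ^ weight T) (part k V e x))
        (fun i => twist 𝒱 T i (part k V (T i) (w i))) : Fin (n + 1) → V) := by
    intro e
    funext i
    refine Fin.cases ?_ (fun i => ?_) i
    · rw [Fin.cons_zero, Fin.cons_zero, Fin.cons_zero, twist, weightAfter_cons_zero]
    · rw [Fin.cons_succ, Fin.cons_succ, Fin.cons_succ, twist, weightAfter_cons_succ, twist]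
  rw [h, h]
  rfl

/-- The summand of the contraction that belongs to a generator. -/
def contractPart (g : Gen) (n : ℕ) : (preLieSqOperad k).PreChains V (n + 2) →ₗ[k]
    (preLieSqOperad k).PreChains V (n + 1) :=
  TensorProduct.map ((preLieSqOperad k).decompose g n) (mergeFirst (A.op g ∘ₗ 𝒱.sign) n)

theorem contractFirst_pureChain {n : ℕ} (φ : Module.Dual k ((dualOperad k).operad (n + 2)))
    (v : Fin (n + 2) → V) :
    (preLieSqOperad k).contractFirst 𝒱 A.op n
        (pureChain k V (n + 2) φ (PiTensorProduct.tprod k v)) =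
      ∑ g, pureChain k V (n + 1) ((preLieSqOperad k).decompose g n φ)
        (PiTensorProduct.tprod k
          (Fin.cons (A.op g (𝒱.sign (v 0)) (v 1)) fun i => v i.succ.succ : Fin (n + 1) → V)) := by
  have h : (preLieSqOperad k).contractFirst 𝒱 A.op n = ∑ g, contractPart A g n := rfl
  rw [h, LinearMap.sum_apply]
  refine Finset.sum_congr rfl fun g _ => ?_
  rw [← LinearMap.comp_apply (A.op g), ← mergeFirst_tprod]
  rfl

theorem sum_gen {M : Type*} [AddCommMonoid M] (F : Gen → M) :
    ∑ g, F g = F .circ + F .circOp + F .bul := by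
  change Multiset.sum (Multiset.map F (↑[Gen.circ, Gen.circOp, Gen.bul] : Multiset Gen)) = _
  simp [add_assoc]

/-- The operation for `bul` includes a sign of the first entry that cancels the sign of passing to
`V[1]`, so the plain bracket remains. -/
theorem contractFirst_cons_cons {n : ℕ} (a b : ZMod 2) (T : Fin n → ZMod 2) (x y : V)
    (u : Fin n → V) :
    (preLieSqOperad k).contractFirst 𝒱 A.op n
        (pureChain k V (n + 2)
          (coordinate k (Fin.cons a (Fin.cons b T : Fin (n + 1) → ZMod 2) : Fin (n + 2) → ZMod 2))
          (PiTensorProduct.tprod k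
            (Fin.cons x (Fin.cons y u : Fin (n + 1) → V) : Fin (n + 2) → V))) =
      (if b = 0 then sg k (weight (Fin.cons a T : Fin (n + 1) → ZMod 2) + 1) else 0) •
          headChain k a T u (A.circ (𝒱.sign x) y) +
        (if a = 0 then sg k (weight (Fin.cons b T : Fin (n + 1) → ZMod 2)) else 0) •
          headChain k b T u (𝒱.flip A.circ (𝒱.sign x) y) +
        (if b = 1 then sg k (weight T) else if a = 1 then -sg k (weight T) else 0) •
          headChain k (a * b) T u (A.bul x y) := by
  rw [contractFirst_pureChain, sum_gen, decompose_circ, decompose_circOp, decompose_bul]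
  simp only [map_smul, LinearMap.smul_apply, headChain_apply]
  have h : A.op .bul (𝒱.sign x) y = A.bul x y := by
    change A.bul (𝒱.sign (𝒱.sign x)) y = _
    rw [𝒱.sign_sign]
  rw [← h]
  rfl

/-- The compatibility of the differentials, before any symmetrisation. For fixed exponents `T` of
the remaining factors, the four choices of exponents on the first two factors reproduce the terms of
the double bracket. -/
theorem toPre_mergeFirst {n : ℕ} (t : ⨂[k] _ : Fin (n + 2), V × V) :
    toPre 𝒱 (n + 1) (mergeFirst (A.doubleBr ∘ₗ (PreLieSq.double 𝒱).sign) n t) =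
      (preLieSqOperad k).contractFirst 𝒱 A.op n (toPre 𝒱 (n + 2) t) := by
  have : toPre 𝒱 (n + 1) ∘ₗ mergeFirst (A.doubleBr ∘ₗ (PreLieSq.double 𝒱).sign) n =
      (preLieSqOperad k).contractFirst 𝒱 A.op n ∘ₗ toPre 𝒱 (n + 2) := by
    refine PiTensorProduct.ext (MultilinearMap.ext fun w => ?_)
    simp only [LinearMap.compMultilinearMap_apply, LinearMap.comp_apply]
    rw [mergeFirst_tprod, toPre_tprod_cons, toPre_tprod, sum_cons, sum_cons, map_sum]
    refine Finset.sum_congr rfl fun T _ => ?_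
    refine (sum_zmod_two _).trans ?_
    have h : ∀ a b : ZMod 2, (fun i => twist 𝒱
        (Fin.cons a (Fin.cons b T : Fin (n + 1) → ZMod 2) : Fin (n + 2) → ZMod 2) i
        (part k V ((Fin.cons a (Fin.cons b T : Fin (n + 1) → ZMod 2) : Fin (n + 2) → ZMod 2) i)
          (w i))) =
        (Fin.cons (((𝒱.shift 1).sign ^ (b.val + weight T)) (part k V a (w 0)))
          (Fin.cons (((𝒱.shift 1).sign ^ weight T) (part k V b (w 1)))
            (fun i => twist 𝒱 T i (part k V (T i) (w i.succ.succ))) : Fin (n + 1) → V) :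
          Fin (n + 2) → V) := by
      intro a b
      funext i
      refine Fin.cases ?_ (fun i => Fin.cases ?_ (fun i => ?_) i) i
      · rw [Fin.cons_zero, Fin.cons_zero, twist, weightAfter_cons_zero, weight_cons]
      · rw [Fin.cons_succ, Fin.cons_succ, Fin.cons_zero, Fin.cons_zero, twist,
          weightAfter_cons_succ, weightAfter_cons_zero]
        rfl
      · rw [Fin.cons_succ, Fin.cons_succ, Fin.cons_succ, Fin.cons_succ, twist,
          weightAfter_cons_succ, weightAfter_cons_succ, twist]
    simp only [h, map_add, map_smul, contractFirst_cons_cons, compSign_cons, weight_cons]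
    -- The remaining factors are the same on both sides. What is left is an identity in the four
    -- components of the first two factors, and its signs depend only on the parity of `t`.
    generalize (fun i => twist 𝒱 T i (part k V (T i) (w i.succ.succ))) = u
    generalize weight T = t
    simp only [PreLieSq.part_zero_doubleBr, PreLieSq.part_one_doubleBr, PreLieSq.sign_double,
      LinearMap.comp_apply]
    have hz : ∀ x : V × V, part k V 0 x = x.1 := fun x => rfl
    have ho : ∀ x : V × V, part k V 1 x = x.2 := fun x => rfl
    simp only [hz, ho]
    generalize (w 0).1 = a, (w 0).2 = a', (w 1).1 = b, (w 1).2 = b'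
    have hp : ∀ m : ℕ, Even m → ∀ x : V, ((𝒱.shift 1).sign ^ m) x = x := by
      rintro m ⟨l, rfl⟩ x
      have h2 : (𝒱.shift 1).sign * (𝒱.shift 1).sign = 1 :=
        LinearMap.ext fun x => (𝒱.shift 1).sign_sign x
      rw [← two_mul, pow_mul, pow_two, h2, one_pow, Module.End.one_apply]
    have hq : ∀ m : ℕ, Odd m → ∀ x : V, ((𝒱.shift 1).sign ^ m) x = -𝒱.sign x := by
      rintro m ⟨l, rfl⟩ x
      rw [pow_succ, Module.End.mul_apply, hp _ (even_two_mul l), 𝒱.sign_shift, sg_one,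
        neg_one_smul]
    have v0 : (0 : ZMod 2).val = 0 := rfl
    have v1 : (1 : ZMod 2).val = 1 := rfl
    have n0 : ¬ (0 : ZMod 2) = 1 := by decide
    have n1 : ¬ (1 : ZMod 2) = 0 := by decide
    simp only [v0, v1, if_neg n0, if_neg n1, if_true, zero_add]
    rcases Nat.even_or_odd t with ht | ht
    · have s0 : sg k (t : ℤ) = 1 := sg_even k (by exact_mod_cast ht)
      simp only [hp t ht, hq (1 + t) (by exact Even.one_add ht)]
      push_cast
      simp only [sg_add, sg_one, s0, map_neg, LinearMap.neg_apply, 𝒱.sign_sign, map_add, map_sub]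
      simp
      module
    · have s0 : sg k (t : ℤ) = -1 := sg_odd k (by exact_mod_cast ht)
      simp only [hq t ht, hp (1 + t) (by exact Odd.one_add ht)]
      push_cast
      simp only [sg_add, sg_one, s0, map_neg, LinearMap.neg_apply, 𝒱.sign_sign, map_add, map_sub,
        A.sign_circ, A.sign_bul, A.sign_flip_circ]
      simp
      module
  exact LinearMap.congr_fun this t

end Intertwining

/-! ### The isomorphism of complexes and its effect on degrees -/

section Isomorphism

variable {k : Type u} [Field k] {V : Type v} [AddCommGroup V] [Module k V] {𝒱 : Grading k V}
  (A : PreLieSq 𝒱)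

open Representation (Coinvariants)

namespace PreLieSq

/-- The class of a tensor in the Chevalley–Eilenberg complex. -/
def toCE (n : ℕ) : (⨂[k] _ : Fin n, V × V) →ₗ[k] A.CE n :=
  Coinvariants.mk (koszulRep (shiftedDouble 𝒱) n)

theorem toCE_surjective (n : ℕ) : Function.Surjective (A.toCE n) :=
  Coinvariants.mk_surjective _

theorem toCE_koszulRep {n : ℕ} (σ : Equiv.Perm (Fin n)) (t : ⨂[k] _ : Fin n, V × V) :
    A.toCE n (koszulRep (shiftedDouble 𝒱) n σ t) = A.toCE n t :=
  Coinvariants.mk_self_apply _ _ _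

/-- The class of a chain. -/
def toC (n : ℕ) : (preLieSqOperad k).PreChains V n →ₗ[k] A.C n :=
  (preLieSqOperad k).toChains 𝒱 n

theorem toC_surjective (n : ℕ) : Function.Surjective (A.toC n) :=
  Coinvariants.mk_surjective _

theorem toC_chainRep {n : ℕ} (σ : Equiv.Perm (Fin n)) (x : (preLieSqOperad k).PreChains V n) :
    A.toC n ((preLieSqOperad k).chainRep 𝒱 n σ x) = A.toC n x :=
  Coinvariants.mk_self_apply _ _ _

theorem toCE_inl_mem {n : ℕ} (t : ⨂[k] _ : Fin n, V) :
    A.toCE n (PiTensorProduct.map (fun _ => LinearMap.inl k V V) t) ∈ A.subCE n :=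
  ⟨Coinvariants.mk _ t, rfl⟩

theorem exists_of_mem_subCE {n : ℕ} {c : A.CE n} (hc : c ∈ A.subCE n) :
    ∃ t : ⨂[k] _ : Fin n, V, c = A.toCE n (PiTensorProduct.map (fun _ => LinearMap.inl k V V) t) := by
  obtain ⟨s, rfl⟩ := hc
  obtain ⟨t, rfl⟩ := Coinvariants.mk_surjective _ s
  exact ⟨t, rfl⟩

/-- The comparison map on the Chevalley–Eilenberg complex. -/
def compareCE (n : ℕ) : A.CE n →ₗ[k] A.C n :=
  Coinvariants.lift (koszulRep (shiftedDouble 𝒱) n) (A.toC n ∘ₗ toPre 𝒱 n) fun σ =>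
    LinearMap.ext fun t => by
      rw [LinearMap.comp_apply, LinearMap.comp_apply, LinearMap.comp_apply, toPre_koszulRep,
        toC_chainRep]

theorem compareCE_toCE {n : ℕ} (t : ⨂[k] _ : Fin n, V × V) :
    A.compareCE n (A.toCE n t) = A.toC n (toPre 𝒱 n t) := rfl

/-- The comparison map on the quotient complex. -/
def compareJ (n : ℕ) : A.J n →ₗ[k] A.C n :=
  Submodule.liftQ _ (A.compareCE n) fun c hc => by
    obtain ⟨t, rfl⟩ := A.exists_of_mem_subCE hc
    rw [LinearMap.mem_ker, compareCE_toCE, toPre_inl, map_zero]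

theorem compareJ_mkQ {n : ℕ} (c : A.CE n) :
    A.compareJ n ((A.subCE n).mkQ c) = A.compareCE n c := rfl

theorem mkQ_fromPre_toPre {n : ℕ} (t : ⨂[k] _ : Fin n, V × V) :
    (A.subCE n).mkQ (A.toCE n (fromPre 𝒱 n (toPre 𝒱 n t))) = (A.subCE n).mkQ (A.toCE n t) := by
  rw [fromPre_toPre, map_sub, map_sub, sub_eq_self, Submodule.mkQ_apply,
    Submodule.Quotient.mk_eq_zero]
  exact A.toCE_inl_mem _

/-- The inverse of the comparison map. -/
def compareInv (n : ℕ) : A.C n →ₗ[k] A.J n :=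
  Coinvariants.lift (V := (preLieSqOperad k).PreChains V n) ((preLieSqOperad k).chainRep 𝒱 n)
    ((A.subCE n).mkQ ∘ₗ A.toCE n ∘ₗ fromPre 𝒱 n) fun σ =>
    LinearMap.ext fun x => by
      rw [LinearMap.comp_apply, LinearMap.comp_apply, LinearMap.comp_apply, LinearMap.comp_apply,
        LinearMap.comp_apply]
      -- Equivariance is available for `toPre`. It is surjective, so invariance can be checked on
      -- its image, where `fromPre` undoes it modulo tensors in `V`.
      obtain ⟨t, rfl⟩ : ∃ t, toPre 𝒱 n t = x := ⟨_, toPre_fromPre 𝒱 x⟩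
      rw [← toPre_koszulRep, mkQ_fromPre_toPre, mkQ_fromPre_toPre, toCE_koszulRep]

theorem compareInv_toC {n : ℕ} (x : (preLieSqOperad k).PreChains V n) :
    A.compareInv n (A.toC n x) = (A.subCE n).mkQ (A.toCE n (fromPre 𝒱 n x)) := rfl

/-- The isomorphism of the quotient complex with the operadic complex. -/
def compareEquiv (n : ℕ) : A.J n ≃ₗ[k] A.C n :=
  LinearEquiv.ofLinearMap (A.compareJ n) (A.compareInv n)
    (LinearMap.ext fun c => by
      obtain ⟨x, rfl⟩ := A.toC_surjective n c
      rw [LinearMap.comp_apply, compareInv_toC, compareJ_mkQ, compareCE_toCE, toPre_fromPre,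
        LinearMap.id_apply])
    (LinearMap.ext fun c => by
      obtain ⟨c, rfl⟩ := Submodule.mkQ_surjective _ c
      obtain ⟨t, rfl⟩ := A.toCE_surjective n c
      rw [LinearMap.comp_apply, compareJ_mkQ, compareCE_toCE, compareInv_toC, mkQ_fromPre_toPre,
        LinearMap.id_apply])

theorem compareEquiv_mkQ_toCE {n : ℕ} (t : ⨂[k] _ : Fin n, V × V) :
    A.compareEquiv n ((A.subCE n).mkQ (A.toCE n t)) = A.toC n (toPre 𝒱 n t) := rfl

theorem compareEquiv_symm_toC {n : ℕ} (x : (preLieSqOperad k).PreChains V n) :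
    (A.compareEquiv n).symm (A.toC n x) = (A.subCE n).mkQ (A.toCE n (fromPre 𝒱 n x)) := rfl

theorem dCE_toCE {n : ℕ} (t : ⨂[k] _ : Fin (n + 2), V × V) :
    A.dCE n (A.toCE (n + 2) t) = ((2 * n.factorial : ℕ) : k)⁻¹ • ∑ σ, A.toCE (n + 1)
      (mergeFirst (A.doubleBr ∘ₗ (double 𝒱).sign) n
        (koszulRep (shiftedDouble 𝒱) (n + 2) σ t)) := by
  simp only [dCE, ceDifferential, symmetrized, LinearMap.smul_apply, toCE,
    Coinvariants.lift_mk, LinearMap.sum_apply, LinearMap.comp_apply]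

theorem dC_toC {n : ℕ} (x : (preLieSqOperad k).PreChains V (n + 2)) :
    A.dC n (A.toC (n + 2) x) = ((2 * n.factorial : ℕ) : k)⁻¹ • ∑ σ, A.toC (n + 1)
      ((preLieSqOperad k).contractFirst 𝒱 A.op n
        ((preLieSqOperad k).chainRep 𝒱 (n + 2) σ x)) := by
  have h : ∀ σ, A.toC (n + 1) ((preLieSqOperad k).contractFirst 𝒱 A.op n
      ((preLieSqOperad k).chainRep 𝒱 (n + 2) σ x)) =
      (((preLieSqOperad k).toChains 𝒱 (n + 1) ∘ₗ (preLieSqOperad k).contractFirst 𝒱 A.op n) ∘ₗ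
        (preLieSqOperad k).chainRep 𝒱 (n + 2) σ) x := fun σ => rfl
  simp only [h]
  rw [← LinearMap.sum_apply]
  rfl

/-- Both differentials carry the same normalisation and sum over the same permutations, so the
summands correspond by `toPre_koszulRep` and `toPre_mergeFirst`. -/
theorem compareEquiv_dJ (n : ℕ) (x : A.J (n + 2)) :
    A.compareEquiv (n + 1) (A.dJ n x) = A.dC n (A.compareEquiv (n + 2) x) := by
  obtain ⟨c, rfl⟩ := Submodule.mkQ_surjective _ x
  obtain ⟨t, rfl⟩ := A.toCE_surjective _ c
  have h : A.dJ n ((A.subCE (n + 2)).mkQ (A.toCE (n + 2) t)) =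
      (A.subCE (n + 1)).mkQ (A.dCE n (A.toCE (n + 2) t)) := rfl
  rw [h, compareEquiv_mkQ_toCE, dC_toC, dCE_toCE, map_smul, map_smul, map_sum, map_sum]
  congr 1
  refine Finset.sum_congr rfl fun σ _ => ?_
  rw [compareEquiv_mkQ_toCE, toPre_mergeFirst, toPre_koszulRep]

theorem weight_eq_sum {n : ℕ} (ε : Fin n → ZMod 2) : (weight ε : ℤ) = ∑ i, ((ε i).val : ℤ) := by
  rw [weight]
  push_cast
  rfl

/-- In the component `ε` the entries lose `weight ε` in total degree and the functional has degree
`weight ε - 1`. For the reverse inclusion, a functional of degree `e` only meets exponents of weight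
`e + 1`. -/
theorem map_degJ [CharZero k] (n : ℕ) (m : ℤ) :
    (A.degJ n m).map (A.compareEquiv n).toLinearMap = A.degC n (m - 1) := by
  refine le_antisymm ?_ ?_
  · rw [degJ, symDeg, Submodule.map_span, Submodule.map_span, Submodule.span_le]
    rintro _ ⟨_, ⟨_, ⟨d, w, hw, hm, rfl⟩, rfl⟩, rfl⟩
    have h : A.compareEquiv n ((A.subCE n).mkQ (A.toCE n (PiTensorProduct.tprod k w))) ∈
        A.degC n (m - 1) := by
      rw [compareEquiv_mkQ_toCE, toPre_tprod, map_sum]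
      refine sum_mem fun ε _ => ?_
      rw [map_smul]
      refine Submodule.smul_mem _ _ (Submodule.subset_span ⟨weight ε - 1, fun i => d i - (ε i).val,
        coordinate k ε, _, coordinate_mem ε, fun i => twist_mem 𝒱 ε i (part_mem 𝒱 (hw i) (ε i)),
        ?_, rfl⟩)
      rw [Finset.sum_sub_distrib, hm, weight_eq_sum]
      ring
    exact h
  · rw [degC, QuadraticData.chainDeg, Submodule.span_le]
    rintro _ ⟨e, d, φ, v, hφ, hv, hm, rfl⟩
    refine ⟨(A.compareEquiv n).symm (A.toC n (pureChain k V n φ (PiTensorProduct.tprod k v))), ?_,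
      LinearEquiv.apply_symm_apply _ _⟩
    rw [compareEquiv_symm_toC, fromPre_pureChain, map_sum, map_sum]
    refine sum_mem fun ε _ => ?_
    split_ifs with h
    · rw [map_zero, map_zero]
      exact zero_mem _
    · by_cases hz : φ (basisElement k ε) = 0
      · rw [hz, mul_zero, zero_smul, map_zero, map_zero]
        exact zero_mem _
      · rw [map_smul, map_smul]
        refine Submodule.smul_mem _ _ (Submodule.mem_map_of_mem (Submodule.subset_span
          ⟨fun i => d i + (ε i).val, _,
            fun i => inject_mem 𝒱 (twist_mem 𝒱 ε i (hv i)) (ε i), ?_, rfl⟩))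
        have hw := weight_of_mem_dualDeg hφ h hz
        rw [weight_eq_sum] at hw
        rw [Finset.sum_add_distrib, hw]
        linarith

end PreLieSq

end Isomorphism

/-! ### The Lie algebra structure on the double -/

section LieBracket

/-- It turns sign identities with symbolic degrees into case distinctions on parities. -/
theorem sg_eq_ite (k : Type u) [Field k] (i : ℤ) : sg k i = if Even i then 1 else -1 := by
  split_ifs with h
  · exact sg_even k h
  · exact sg_odd k (Int.not_even_iff_odd.1 h)

variable {k : Type u} [Field k] {V : Type v} [AddCommGroup V] [Module k V] {𝒱 : Grading k V}
  (A : PreLieSq 𝒱)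

namespace PreLieSq

/-- The operation of degree one on `(V ⊕ V[-1])[1]` induced by the Lie bracket. -/
def dbl : V × V →ₗ[k] V × V →ₗ[k] V × V := A.doubleBr ∘ₗ (double 𝒱).sign

theorem ext_part (k : Type u) [Field k] {V : Type v} [AddCommGroup V] [Module k V] {x y : V × V}
    (h0 : part k V 0 x = part k V 0 y) (h1 : part k V 1 x = part k V 1 y) : x = y := Prod.ext h0 h1

theorem dbl_inl_inl {i j : ℤ} {a b : V} (ha : a ∈ 𝒱.deg i) (hb : b ∈ 𝒱.deg j) :
    A.dbl (a, 0) (b, 0) = (sg k i • A.circ a b - sg k (i + i * j) • A.circ b a, 0) := by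
  refine ext_part k ?_ ?_
  · rw [dbl, LinearMap.comp_apply, part_zero_doubleBr, sign_double, 𝒱.sign_of_mem ha]
    simp [part, 𝒱.flip_of_mem A.circ ha hb, smul_smul, sg_add]
  · rw [dbl, LinearMap.comp_apply, part_one_doubleBr, sign_double]
    simp [part]

theorem dbl_inr_inl {i : ℤ} {a : V} (ha : a ∈ 𝒱.deg i) (b : V) :
    A.dbl (0, a) (b, 0) = (A.bul a b, -(sg k i • A.circ a b)) := by
  refine ext_part k ?_ ?_
  · rw [dbl, LinearMap.comp_apply, part_zero_doubleBr, sign_double]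
    simp [part, 𝒱.sign_sign]
  · rw [dbl, LinearMap.comp_apply, part_one_doubleBr, sign_double]
    simp [part, 𝒱.sign_of_mem ha]

theorem dbl_inl_inr {i j : ℤ} {a b : V} (ha : a ∈ 𝒱.deg i) (hb : b ∈ 𝒱.deg j) :
    A.dbl (a, 0) (0, b) = (sg k i • A.bul a b, -(sg k (i * j) • A.circ b a)) := by
  refine ext_part k ?_ ?_
  · rw [dbl, LinearMap.comp_apply, part_zero_doubleBr, sign_double]
    simp [part, 𝒱.sign_of_mem ha]
  · rw [dbl, LinearMap.comp_apply, part_one_doubleBr, sign_double]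
    simp [part, 𝒱.sign_sign, 𝒱.flip_of_mem A.circ ha hb]

theorem dbl_inr_inr {i : ℤ} {a : V} (ha : a ∈ 𝒱.deg i) (b : V) :
    A.dbl (0, a) (0, b) = (0, -(sg k i • A.bul a b)) := by
  refine ext_part k ?_ ?_
  · rw [dbl, LinearMap.comp_apply, part_zero_doubleBr, sign_double]
    simp [part]
  · rw [dbl, LinearMap.comp_apply, part_one_doubleBr, sign_double]
    simp [part, 𝒱.sign_of_mem ha]

theorem bul_swap {i j : ℤ} {a b : V} (ha : a ∈ 𝒱.deg i) (hb : b ∈ 𝒱.deg j) :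
    A.bul b a = sg k (i * j + i + j) • A.bul a b := by
  have h := A.bul_symm i j a ha b hb
  rw [zsmul_units_eq (k := k), zsmul_units_eq (k := k), zsmul_units_eq (k := k), smul_smul,
    ← sg_add] at h
  rw [add_assoc, add_comm i j, ← add_assoc, add_right_comm, sg_add, ← smul_smul, h, smul_smul,
    sg_mul_self, one_smul]

theorem circ_mem' {i j : ℤ} {a b : V} (ha : a ∈ 𝒱.deg i) (hb : b ∈ 𝒱.deg j) :
    A.circ a b ∈ 𝒱.deg (i + j) := A.circ_mem i j a ha b hb

theorem bul_mem' {i j : ℤ} {a b : V} (ha : a ∈ 𝒱.deg i) (hb : b ∈ 𝒱.deg j) :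
    A.bul a b ∈ 𝒱.deg (i + j + 1) := A.bul_mem i j a ha b hb

/-- The given Jacobi identity with all brackets nested on the left, using graded symmetry; this
cyclic form matches `jac`. -/
theorem bul_jacobi {i j l : ℤ} {a b c : V} (ha : a ∈ 𝒱.deg i) (hb : b ∈ 𝒱.deg j)
    (hc : c ∈ 𝒱.deg l) :
    sg k j • A.bul (A.bul a b) c + sg k (i * (j + l) + l) • A.bul (A.bul b c) a +
      sg k (l * (i + j) + i) • A.bul (A.bul c a) b = 0 := by
  have h := A.jacobi i j l a ha b hb c hc
  rw [zsmul_units_eq (k := k), A.bul_swap (A.bul_mem' hb hc) ha, A.bul_swap (A.bul_mem' ha hc) hb,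
    A.bul_swap hc ha, map_smul, LinearMap.smul_apply] at h
  rw [h]
  by_cases hi : Even i <;> by_cases hj : Even j <;> by_cases hl : Even l <;>
  · simp only [sg_eq_ite, Int.even_add, Int.even_mul, hi, hj, hl]
    simp
    try module

/-- The cyclic sum in the Jacobi identity. -/
def jac (p q r : ℤ) (x y z : V × V) : V × V :=
  A.dbl (A.dbl x y) z + sg k (p * (q + r)) • A.dbl (A.dbl y z) x +
    sg k (r * (p + q)) • A.dbl (A.dbl z x) y

/-- A rotation multiplies the cyclic sum by a sign, so one representative is enough for each number
of arguments in `V[-1]`. -/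
theorem jac_rotate (p q r : ℤ) (x y z : V × V) :
    A.jac q r p y z x = sg k (p * (q + r)) • A.jac p q r x y z := by
  rw [jac, jac, smul_add, smul_add, smul_smul, smul_smul, sg_mul_self, one_smul, ← sg_add,
    sg_congr k (i := p * (q + r) + r * (p + q)) (j := q * (r + p)) ⟨p * r, by ring⟩]
  abel

theorem jac_rotate_eq_zero {p q r : ℤ} {x y z : V × V} (h : A.jac p q r x y z = 0) :
    A.jac q r p y z x = 0 := by
  rw [jac_rotate, h, smul_zero]

variable {i j l : ℤ} {a b c : V}

/-- Three arguments with `Π` involve the odd bracket alone and reduce to its Jacobi identity. -/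
theorem jac_inr_inr_inr (ha : a ∈ 𝒱.deg i) (hb : b ∈ 𝒱.deg j) (hc : c ∈ 𝒱.deg l) :
    A.jac i j l (0, a) (0, b) (0, c) = 0 := by
  have h := A.bul_jacobi ha hb hc
  have neg_pair : ∀ x : V, ((0 : V), -x) = -((0 : V), x) := fun x => by simp
  have smul_pair : ∀ (s : k) (x : V), ((0 : V), s • x) = s • ((0 : V), x) := fun s x => by simp
  rw [jac, A.dbl_inr_inr ha, A.dbl_inr_inr hb, A.dbl_inr_inr hc]
  simp only [neg_pair, smul_pair, map_neg, map_smul, LinearMap.neg_apply, LinearMap.smul_apply]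
  rw [A.dbl_inr_inr (A.bul_mem' ha hb), A.dbl_inr_inr (A.bul_mem' hb hc),
    A.dbl_inr_inr (A.bul_mem' hc ha)]
  refine Prod.ext ?_ ?_
  · simp
  · simp only [Prod.snd_add, Prod.smul_snd, Prod.snd_neg, Prod.snd_zero]
    revert h
    by_cases hi : Even i <;> by_cases hj : Even j <;> by_cases hl : Even l <;>
    · simp only [sg_eq_ite, Int.even_add, Int.even_mul, Int.not_even_one, hi, hj, hl,
        iff_true, iff_false, not_true_eq_false, or_true, or_false, if_true, if_false]
      intro h
      -- The overall sign between the two identities depends on the parities.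
      first
        | linear_combination (norm := module) h
        | linear_combination (norm := module) -h

/-- The component in `V` is the Jacobi identity of the odd bracket, and the component in `V[-1]` is
the compatibility identity. -/
theorem jac_inr_inr_inl (ha : a ∈ 𝒱.deg i) (hb : b ∈ 𝒱.deg j) (hc : c ∈ 𝒱.deg l) :
    A.jac i j (l - 1) (0, a) (0, b) (c, 0) = 0 := by
  have h := A.bul_jacobi ha hb hc
  have h' := A.compat i j l a ha b hb c hc
  rw [zsmul_units_eq (k := k), zsmul_units_eq (k := k), zsmul_units_eq (k := k),
    zsmul_units_eq (k := k), A.bul_swap hc ha, map_smul] at h'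
  have pair : ∀ x y : V, (x, y) = (x, (0 : V)) + ((0 : V), y) := fun x y => by simp
  have neg_pair : ∀ x : V, ((0 : V), -x) = -((0 : V), x) := fun x => by simp
  have smul_pair : ∀ (s : k) (x : V), ((0 : V), s • x) = s • ((0 : V), x) := fun s x => by simp
  have smul_pair' : ∀ (s : k) (x : V), (s • x, (0 : V)) = s • (x, (0 : V)) := fun s x => by simp
  rw [jac, A.dbl_inr_inr ha, A.dbl_inr_inl hb, A.dbl_inl_inr hc ha, pair (A.bul b c),
    pair (sg k l • A.bul c a)]
  simp only [neg_pair, smul_pair, smul_pair', map_neg, map_smul, map_add, LinearMap.neg_apply,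
    LinearMap.smul_apply, LinearMap.add_apply]
  rw [A.dbl_inr_inl (A.bul_mem' ha hb), A.dbl_inl_inr (A.bul_mem' hb hc) ha,
    A.dbl_inl_inr (A.bul_mem' hc ha) hb, A.dbl_inr_inr (A.circ_mem' hb hc),
    A.dbl_inr_inr (A.circ_mem' ha hc)]
  refine Prod.ext ?_ ?_
  · simp only [Prod.fst_add, Prod.smul_fst, Prod.fst_neg, Prod.fst_zero]
    revert h
    clear h'
    by_cases hi : Even i <;> by_cases hj : Even j <;> by_cases hl : Even l <;>
    · simp only [sg_eq_ite, Int.even_add, Int.even_mul, Int.even_sub, Int.not_even_one, hi, hj, hl,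
        iff_true, iff_false, not_true_eq_false, or_true, or_false, if_true, if_false]
      intro h
      first
        | linear_combination (norm := module) h
        | linear_combination (norm := module) -h
  · simp only [Prod.snd_add, Prod.smul_snd, Prod.snd_neg, Prod.snd_zero]
    revert h'
    clear h
    by_cases hi : Even i <;> by_cases hj : Even j <;> by_cases hl : Even l <;>
    · simp only [sg_eq_ite, Int.even_add, Int.even_mul, Int.even_sub, Int.not_even_one, hi, hj, hl,
        iff_true, iff_false, not_true_eq_false, or_true, or_false, if_true, if_false]
      intro h
      first
        | linear_combination (norm := module) h
        | linear_combination (norm := module) -h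

/-- The component in `V` combines two instances of compatibility that differ by exchanging `b` and
`c`; the component in `V[-1]` is the pre-Lie identity. -/
theorem jac_inr_inl_inl (ha : a ∈ 𝒱.deg i) (hb : b ∈ 𝒱.deg j) (hc : c ∈ 𝒱.deg l) :
    A.jac i (j - 1) (l - 1) (0, a) (b, 0) (c, 0) = 0 := by
  have h1 := A.compat i j l a ha b hb c hc
  have h2 := A.compat i l j a ha c hc b hb
  have h3 := A.preLie i j l a ha b hb c hc
  simp only [zsmul_units_eq (k := k)] at h1 h2 h3
  rw [A.bul_swap hb hc, map_smul] at h2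
  have h := congrArg₂ (fun x y => sg k (i + j + 1) • x +
    sg k ((l - 1) * (i + j - 1) + l * i + l + 1) • y) h1 h2
  have pair : ∀ x y : V, (x, y) = (x, (0 : V)) + ((0 : V), y) := fun x y => by simp
  have neg_pair : ∀ x : V, ((0 : V), -x) = -((0 : V), x) := fun x => by simp
  have smul_pair : ∀ (s : k) (x : V), ((0 : V), s • x) = s • ((0 : V), x) := fun s x => by simp
  have smul_pair' : ∀ (s : k) (x : V), (s • x, (0 : V)) = s • (x, (0 : V)) := fun s x => by simp
  have sub_pair : ∀ x y : V, (x - y, (0 : V)) = (x, (0 : V)) - (y, (0 : V)) := fun x y => by simp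
  rw [jac, A.dbl_inr_inl ha, A.dbl_inl_inl hb hc, A.dbl_inl_inr hc ha, A.bul_swap ha hc,
    pair (A.bul a b), pair (sg k l • sg k (i * l + i + l) • A.bul a c)]
  simp only [neg_pair, smul_pair, smul_pair', sub_pair, map_neg, map_smul, map_add, map_sub,
    LinearMap.neg_apply, LinearMap.smul_apply, LinearMap.add_apply, LinearMap.sub_apply]
  rw [A.dbl_inl_inl (A.bul_mem' ha hb) hc, A.dbl_inr_inl (A.circ_mem' ha hb),
    A.dbl_inl_inr (A.circ_mem' hb hc) ha, A.dbl_inl_inr (A.circ_mem' hc hb) ha,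
    A.dbl_inl_inl (A.bul_mem' ha hc) hb, A.dbl_inr_inl (A.circ_mem' ha hc)]
  refine Prod.ext ?_ ?_
  · simp only [Prod.fst_add, Prod.smul_fst, Prod.fst_neg, Prod.fst_zero, Prod.fst_sub]
    revert h
    clear h1 h2 h3
    by_cases hi : Even i <;> by_cases hj : Even j <;> by_cases hl : Even l <;>
    · simp only [sg_eq_ite, Int.even_add, Int.even_mul, Int.even_sub, Int.not_even_one, hi, hj, hl,
        iff_true, iff_false, not_true_eq_false, or_true, or_false, if_true, if_false]
      intro h
      linear_combination (norm := module) h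
  · simp only [Prod.snd_add, Prod.smul_snd, Prod.snd_neg,
      Prod.snd_zero, Prod.snd_sub]
    revert h3
    clear h1 h2 h
    by_cases hi : Even i <;> by_cases hj : Even j <;> by_cases hl : Even l <;>
    · simp only [sg_eq_ite, Int.even_add, Int.even_mul, Int.even_sub, Int.not_even_one, hi, hj, hl,
        iff_true, iff_false, not_true_eq_false, or_true, or_false, if_true, if_false]
      intro h
      first
        | linear_combination (norm := module) h
        | linear_combination (norm := module) -h

/-- The commutator of a pre-Lie product is a Lie bracket: its Jacobi sum is the signed sum of the
three rotated pre-Lie identities. -/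
theorem jac_inl_inl_inl (ha : a ∈ 𝒱.deg i) (hb : b ∈ 𝒱.deg j) (hc : c ∈ 𝒱.deg l) :
    A.jac (i - 1) (j - 1) (l - 1) (a, 0) (b, 0) (c, 0) = 0 := by
  have h1 := A.preLie i j l a ha b hb c hc
  have h2 := A.preLie j l i b hb c hc a ha
  have h3 := A.preLie l i j c hc a ha b hb
  simp only [zsmul_units_eq (k := k)] at h1 h2 h3
  have h := congrArg₂ (· + ·) (congrArg₂ (fun x y => sg k j • x +
    sg k ((i - 1) * (j + l) + l) • y) h1 h2)
      (congrArg (fun x => sg k ((l - 1) * (i + j) + i) • x) h3)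
  have smul_pair' : ∀ (s : k) (x : V), (s • x, (0 : V)) = s • (x, (0 : V)) := fun s x => by simp
  have sub_pair : ∀ x y : V, (x - y, (0 : V)) = (x, (0 : V)) - (y, (0 : V)) := fun x y => by simp
  rw [jac, A.dbl_inl_inl ha hb, A.dbl_inl_inl hb hc, A.dbl_inl_inl hc ha]
  simp only [smul_pair', sub_pair, map_smul, map_sub, LinearMap.smul_apply, LinearMap.sub_apply]
  rw [A.dbl_inl_inl (A.circ_mem' ha hb) hc, A.dbl_inl_inl (A.circ_mem' hb ha) hc,
    A.dbl_inl_inl (A.circ_mem' hb hc) ha, A.dbl_inl_inl (A.circ_mem' hc hb) ha,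
    A.dbl_inl_inl (A.circ_mem' hc ha) hb, A.dbl_inl_inl (A.circ_mem' ha hc) hb]
  refine Prod.ext ?_ ?_
  · simp only [Prod.fst_add, Prod.smul_fst, Prod.fst_zero, Prod.fst_sub]
    revert h
    clear h1 h2 h3
    by_cases hi : Even i <;> by_cases hj : Even j <;> by_cases hl : Even l <;>
    · simp only [sg_eq_ite, Int.even_add, Int.even_mul, Int.even_sub, Int.not_even_one, hi, hj, hl,
        iff_true, iff_false, not_true_eq_false, or_true, or_false, if_true, if_false]
      intro h
      linear_combination (norm := module) h
  · simp

theorem jac_add_left (p q r : ℤ) (x x' y z : V × V) :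
    A.jac p q r (x + x') y z = A.jac p q r x y z + A.jac p q r x' y z := by
  simp only [jac, map_add, LinearMap.add_apply, smul_add]
  abel

theorem jac_add_middle (p q r : ℤ) (x y y' z : V × V) :
    A.jac p q r x (y + y') z = A.jac p q r x y z + A.jac p q r x y' z := by
  simp only [jac, map_add, LinearMap.add_apply, smul_add]
  abel

theorem jac_add_right (p q r : ℤ) (x y z z' : V × V) :
    A.jac p q r x y (z + z') = A.jac p q r x y z + A.jac p q r x y z' := by
  simp only [jac, map_add, LinearMap.add_apply, smul_add]
  abel

theorem mem_shiftedDouble {p : ℤ} {x : V × V} (hx : x ∈ (shiftedDouble 𝒱).deg p) :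
    ∃ a b : V, a ∈ 𝒱.deg (p + 1) ∧ b ∈ 𝒱.deg p ∧ x = (a, 0) + (0, b) := by
  refine ⟨x.1, x.2, hx.1, ?_, by simp⟩
  have h : x.2 ∈ 𝒱.deg (p + 1 + -1) := hx.2
  rwa [add_neg_cancel_right] at h

variable {p q r : ℤ} {x y z : V × V}

/-- By trilinearity the sum expands into eight terms, each a rotation of one of the four cases
above. -/
theorem jac_eq_zero (hx : x ∈ (shiftedDouble 𝒱).deg p) (hy : y ∈ (shiftedDouble 𝒱).deg q)
    (hz : z ∈ (shiftedDouble 𝒱).deg r) : A.jac p q r x y z = 0 := by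
  obtain ⟨a, a', ha, ha', rfl⟩ := mem_shiftedDouble hx
  obtain ⟨b, b', hb, hb', rfl⟩ := mem_shiftedDouble hy
  obtain ⟨c, c', hc, hc', rfl⟩ := mem_shiftedDouble hz
  have h1 := A.jac_inl_inl_inl ha hb hc
  have h2 := A.jac_inr_inl_inl ha' hb hc
  have h3 := A.jac_rotate_eq_zero (A.jac_rotate_eq_zero (A.jac_inr_inl_inl hb' hc ha))
  have h4 := A.jac_rotate_eq_zero (A.jac_inr_inl_inl hc' ha hb)
  have h5 := A.jac_inr_inr_inl ha' hb' hc
  have h6 := A.jac_rotate_eq_zero (A.jac_rotate_eq_zero (A.jac_inr_inr_inl hb' hc' ha))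
  have h7 := A.jac_rotate_eq_zero (A.jac_inr_inr_inl hc' ha' hb)
  have h8 := A.jac_inr_inr_inr ha' hb' hc'
  simp only [add_sub_cancel_right] at h1 h2 h3 h4 h5 h6 h7
  simp only [jac_add_left, jac_add_middle, jac_add_right, h1, h2, h3, h4, h5, h6, h7, h8, add_zero]

theorem dbl_add_add (a b a' b' : V) : A.dbl ((a, 0) + (0, a')) ((b, 0) + (0, b')) =
    A.dbl (a, 0) (b, 0) + A.dbl (a, 0) (0, b') + (A.dbl (0, a') (b, 0) + A.dbl (0, a') (0, b')) := by
  simp only [map_add, LinearMap.add_apply]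
  abel

theorem dbl_mem (hx : x ∈ (shiftedDouble 𝒱).deg p) (hy : y ∈ (shiftedDouble 𝒱).deg q) :
    A.dbl x y ∈ (shiftedDouble 𝒱).deg (p + q + 1) := by
  obtain ⟨a, a', ha, ha', rfl⟩ := mem_shiftedDouble hx
  obtain ⟨b, b', hb, hb', rfl⟩ := mem_shiftedDouble hy
  rw [dbl_add_add, A.dbl_inl_inl ha hb, A.dbl_inl_inr ha hb', A.dbl_inr_inl ha',
    A.dbl_inr_inr ha']
  have mem : ∀ {u v : V}, u ∈ 𝒱.deg (p + q + 1 + 1) → v ∈ 𝒱.deg (p + q + 1) →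
      (u, v) ∈ (shiftedDouble 𝒱).deg (p + q + 1) := fun {u v} hu hv => by
    refine ⟨hu, ?_⟩
    change v ∈ 𝒱.deg (p + q + 1 + 1 + -1)
    rwa [add_neg_cancel_right]
  have cast : ∀ {u : V} {m m' : ℤ}, u ∈ 𝒱.deg m → m = m' → u ∈ 𝒱.deg m' := fun h e => e ▸ h
  refine add_mem (add_mem (mem (sub_mem ?_ ?_) (zero_mem _)) (mem ?_ (neg_mem ?_)))
    (add_mem (mem ?_ (neg_mem ?_)) (mem (zero_mem _) (neg_mem ?_)))
  · exact Submodule.smul_mem _ _ (cast (A.circ_mem' ha hb) (by ring))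
  · exact Submodule.smul_mem _ _ (cast (A.circ_mem' hb ha) (by ring))
  · exact Submodule.smul_mem _ _ (cast (A.bul_mem' ha hb') (by ring))
  · exact Submodule.smul_mem _ _ (cast (A.circ_mem' hb' ha) (by ring))
  · exact cast (A.bul_mem' ha' hb) (by ring)
  · exact Submodule.smul_mem _ _ (cast (A.circ_mem' ha' hb) (by ring))
  · exact Submodule.smul_mem _ _ (cast (A.bul_mem' ha' hb') (by ring))

theorem dbl_swap (hx : x ∈ (shiftedDouble 𝒱).deg p) (hy : y ∈ (shiftedDouble 𝒱).deg q) :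
    A.dbl y x = sg k (p * q) • A.dbl x y := by
  obtain ⟨a, a', ha, ha', rfl⟩ := mem_shiftedDouble hx
  obtain ⟨b, b', hb, hb', rfl⟩ := mem_shiftedDouble hy
  rw [dbl_add_add, dbl_add_add, A.dbl_inl_inl ha hb, A.dbl_inl_inr ha hb', A.dbl_inr_inl ha',
    A.dbl_inr_inr ha', A.dbl_inl_inl hb ha, A.dbl_inl_inr hb ha', A.dbl_inr_inl hb',
    A.dbl_inr_inr hb', A.bul_swap ha' hb, A.bul_swap ha hb', A.bul_swap ha' hb']
  refine Prod.ext ?_ ?_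
  all_goals
    simp only [Prod.fst_add, Prod.snd_add, Prod.smul_fst, Prod.smul_snd]
    by_cases hp : Even p <;> by_cases hq : Even q <;>
    · simp only [sg_eq_ite, Int.even_add, Int.even_mul, Int.not_even_one, hp, hq,
        iff_true, iff_false, not_true_eq_false, or_true, or_false, if_true, if_false]
      module

end PreLieSq

end LieBracket

/-! ### Tensor powers with leading factors split off -/

section ConsTensor

variable {k : Type u} [Field k] {W : Type v} [AddCommGroup W] [Module k W]

/-- The map `(x, t) ↦ x ⊗ t`. -/
def consTensor (k : Type u) [Field k] (W : Type v) [AddCommGroup W] [Module k W] (n : ℕ) :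
    W →ₗ[k] (⨂[k] _ : Fin n, W) →ₗ[k] (⨂[k] _ : Fin (n + 1), W) :=
  (PiTensorProduct.lift (R := k) (s := fun _ : Fin n => W)).toLinearMap ∘ₗ
    (PiTensorProduct.tprod k : MultilinearMap k (fun _ : Fin (n + 1) => W) _).curryLeft

theorem consTensor_tprod {n : ℕ} (x : W) (w : Fin n → W) :
    consTensor k W n x (PiTensorProduct.tprod k w) =
      PiTensorProduct.tprod k (Fin.cons x w : Fin (n + 1) → W) := by
  simp [consTensor]

theorem consTensor_ext (𝒲 : Grading k W) {n : ℕ} {M : Type*} [AddCommGroup M] [Module k M]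
    {f g : (⨂[k] _ : Fin (n + 1), W) →ₗ[k] M}
    (h : ∀ i, ∀ x ∈ 𝒲.deg i, ∀ t, f (consTensor k W n x t) = g (consTensor k W n x t)) : f = g := by
  refine PiTensorProduct.ext (MultilinearMap.ext fun w => ?_)
  have h' : (consTensor k W n).compr₂ f = (consTensor k W n).compr₂ g :=
    𝒲.hom_ext fun i x hx => LinearMap.ext fun t => h i x hx t
  have := LinearMap.congr_fun₂ h' (w 0) (PiTensorProduct.tprod k (Fin.tail w))
  rw [LinearMap.compr₂_apply, LinearMap.compr₂_apply, consTensor_tprod, Fin.cons_self_tail] at this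
  exact this

theorem consTensor_ext₂ (𝒲 : Grading k W) {n : ℕ} {M : Type*} [AddCommGroup M] [Module k M]
    {f g : (⨂[k] _ : Fin (n + 2), W) →ₗ[k] M}
    (h : ∀ i, ∀ x ∈ 𝒲.deg i, ∀ j, ∀ y ∈ 𝒲.deg j, ∀ t,
      f (consTensor k W (n + 1) x (consTensor k W n y t)) =
        g (consTensor k W (n + 1) x (consTensor k W n y t))) : f = g :=
  consTensor_ext 𝒲 fun i x hx t => LinearMap.congr_fun
    (consTensor_ext 𝒲 (h i x hx) : f ∘ₗ consTensor k W (n + 1) x = g ∘ₗ consTensor k W (n + 1) x) t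

theorem consTensor_ext₃ (𝒲 : Grading k W) {n : ℕ} {M : Type*} [AddCommGroup M] [Module k M]
    {f g : (⨂[k] _ : Fin (n + 3), W) →ₗ[k] M}
    (h : ∀ i, ∀ x ∈ 𝒲.deg i, ∀ j, ∀ y ∈ 𝒲.deg j, ∀ l, ∀ z ∈ 𝒲.deg l, ∀ t,
      f (consTensor k W (n + 2) x (consTensor k W (n + 1) y (consTensor k W n z t))) =
        g (consTensor k W (n + 2) x (consTensor k W (n + 1) y (consTensor k W n z t)))) : f = g :=
  consTensor_ext 𝒲 fun i x hx t => LinearMap.congr_fun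
    (consTensor_ext₂ 𝒲 (h i x hx) : f ∘ₗ consTensor k W (n + 2) x = g ∘ₗ consTensor k W (n + 2) x) t

theorem consTensor_ext₄ (𝒲 : Grading k W) {n : ℕ} {M : Type*} [AddCommGroup M] [Module k M]
    {f g : (⨂[k] _ : Fin (n + 4), W) →ₗ[k] M}
    (h : ∀ i, ∀ x ∈ 𝒲.deg i, ∀ j, ∀ y ∈ 𝒲.deg j, ∀ l, ∀ z ∈ 𝒲.deg l, ∀ m, ∀ w ∈ 𝒲.deg m, ∀ t,
      f (consTensor k W (n + 3) x (consTensor k W (n + 2) y (consTensor k W (n + 1) z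
        (consTensor k W n w t)))) =
        g (consTensor k W (n + 3) x (consTensor k W (n + 2) y (consTensor k W (n + 1) z
          (consTensor k W n w t))))) : f = g :=
  consTensor_ext 𝒲 fun i x hx t => LinearMap.congr_fun
    (consTensor_ext₃ 𝒲 (h i x hx) : f ∘ₗ consTensor k W (n + 3) x = g ∘ₗ consTensor k W (n + 3) x) t

theorem mergeFirst_consTensor (b : W →ₗ[k] W →ₗ[k] W) {n : ℕ} (x y : W)
    (t : ⨂[k] _ : Fin n, W) :
    mergeFirst b n (consTensor k W (n + 1) x (consTensor k W n y t)) =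
      consTensor k W n (b x y) t := by
  have : mergeFirst b n ∘ₗ consTensor k W (n + 1) x ∘ₗ consTensor k W n y =
      consTensor k W n (b x y) := PiTensorProduct.ext (MultilinearMap.ext fun w => by
    simp only [LinearMap.compMultilinearMap_apply, LinearMap.comp_apply, consTensor_tprod,
      mergeFirst_tprod]
    rfl)
  exact LinearMap.congr_fun this t

/-- The permutation that fixes the first index and acts as `σ` on the others. -/
def succPerm {n : ℕ} (σ : Equiv.Perm (Fin n)) : Equiv.Perm (Fin (n + 1)) :=
  Equiv.Perm.decomposeFin.symm (0, σ)

theorem succPerm_zero {n : ℕ} (σ : Equiv.Perm (Fin n)) : succPerm σ 0 = 0 := by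
  simp [succPerm]

theorem succPerm_succ {n : ℕ} (σ : Equiv.Perm (Fin n)) (i : Fin n) :
    succPerm σ i.succ = (σ i).succ := by
  simp [succPerm]

theorem succPerm_symm_zero {n : ℕ} (σ : Equiv.Perm (Fin n)) : (succPerm σ).symm 0 = 0 := by
  rw [Equiv.symm_apply_eq, succPerm_zero]

theorem succPerm_symm_succ {n : ℕ} (σ : Equiv.Perm (Fin n)) (i : Fin n) :
    (succPerm σ).symm i.succ = (σ.symm i).succ := by
  rw [Equiv.symm_apply_eq, succPerm_succ, Equiv.apply_symm_apply]

theorem exists_succPerm {n : ℕ} {σ : Equiv.Perm (Fin (n + 1))} (h : σ 0 = 0) :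
    ∃ σ', σ = succPerm σ' := by
  refine ⟨(Equiv.Perm.decomposeFin σ).2, ?_⟩
  have h1 : (Equiv.Perm.decomposeFin σ).1 = 0 := by
    have := Equiv.Perm.decomposeFin_symm_apply_zero (Equiv.Perm.decomposeFin σ).1
      (Equiv.Perm.decomposeFin σ).2
    rw [Prod.mk.eta, Equiv.symm_apply_apply, h] at this
    exact this.symm
  rw [succPerm, ← h1, Prod.mk.eta, Equiv.symm_apply_apply]

theorem koszulSign_succPerm {n : ℕ} (σ : Equiv.Perm (Fin n)) (p : ZMod 2) (ε : Fin n → ZMod 2) :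
    koszulSign (succPerm σ) (Fin.cons p ε : Fin (n + 1) → ZMod 2) = koszulSign σ ε := by
  rw [koszulSign, Fin.prod_univ_succ]
  simp only [Fin.prod_univ_succ, succPerm_zero, succPerm_succ, Fin.not_lt_zero, false_and,
    and_false, if_false, Finset.prod_const_one, one_mul, Fin.cons_succ, Fin.succ_lt_succ_iff]
  rfl

variable (𝒲 : Grading k W)

theorem proj_cast {i : ℤ} {x : W} (hx : x ∈ 𝒲.deg i) : 𝒲.proj (i : ZMod 2) x = x := by
  rw [𝒲.proj_of_mem _ hx, if_pos rfl]

/-- A factor that stays in front is not crossed by any other factor, so it contributes no sign. -/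
theorem koszulRep_succPerm {n : ℕ} (σ : Equiv.Perm (Fin n)) {i : ℤ} {x : W} (hx : x ∈ 𝒲.deg i)
    (t : ⨂[k] _ : Fin n, W) :
    koszulRep 𝒲 (n + 1) (succPerm σ) (consTensor k W n x t) =
      consTensor k W n x (koszulRep 𝒲 n σ t) := by
  have : koszulAct 𝒲 (n + 1) (succPerm σ) ∘ₗ consTensor k W n x =
      consTensor k W n x ∘ₗ koszulAct 𝒲 n σ := koszul_ext 𝒲 fun ε w => by
    rw [LinearMap.comp_apply, LinearMap.comp_apply, koszulAct_tprod, map_smul, consTensor_tprod,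
      consTensor_tprod]
    have e : (Fin.cons x fun j => 𝒲.proj (ε j) (w j) : Fin (n + 1) → W) = fun j =>
        𝒲.proj ((Fin.cons (i : ZMod 2) ε : Fin (n + 1) → ZMod 2) j)
          ((Fin.cons x w : Fin (n + 1) → W) j) := by
      funext j
      refine Fin.cases ?_ (fun j => ?_) j
      · rw [Fin.cons_zero, Fin.cons_zero, Fin.cons_zero, proj_cast 𝒲 hx]
      · rw [Fin.cons_succ, Fin.cons_succ, Fin.cons_succ]
    rw [e, koszulAct_tprod, koszulSign_succPerm]
    congr 2
    funext j
    refine Fin.cases ?_ (fun j => ?_) j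
    · rw [succPerm_symm_zero, Fin.cons_zero, Fin.cons_zero, Fin.cons_zero, proj_cast 𝒲 hx]
    · rw [succPerm_symm_succ, Fin.cons_succ, Fin.cons_succ, Fin.cons_succ]
  exact LinearMap.congr_fun this t

/-- The transposition of the first two indices. -/
def headSwap (n : ℕ) : Equiv.Perm (Fin (n + 2)) := Equiv.swap 0 1

theorem koszulRep_headSwap {n : ℕ} {i j : ℤ} {x y : W} (hx : x ∈ 𝒲.deg i) (hy : y ∈ 𝒲.deg j)
    (t : ⨂[k] _ : Fin n, W) :
    koszulRep 𝒲 (n + 2) (headSwap n) (consTensor k W (n + 1) x (consTensor k W n y t)) =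
      sg k (i * j) • consTensor k W (n + 1) y (consTensor k W n x t) := by
  have : koszulAct 𝒲 (n + 2) (headSwap n) ∘ₗ consTensor k W (n + 1) x ∘ₗ consTensor k W n y =
      sg k (i * j) • consTensor k W (n + 1) y ∘ₗ consTensor k W n x := koszul_ext 𝒲 fun ε w => by
    rw [LinearMap.comp_apply, LinearMap.comp_apply, LinearMap.smul_apply, LinearMap.comp_apply,
      consTensor_tprod, consTensor_tprod, consTensor_tprod, consTensor_tprod]
    have e : ∀ (i j : ℤ) (x y : W), x ∈ 𝒲.deg i → y ∈ 𝒲.deg j →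
        (Fin.cons x (Fin.cons y fun j => 𝒲.proj (ε j) (w j) : Fin (n + 1) → W) :
          Fin (n + 2) → W) = fun l =>
        𝒲.proj ((Fin.cons (i : ZMod 2) (Fin.cons (j : ZMod 2) ε : Fin (n + 1) → ZMod 2) :
            Fin (n + 2) → ZMod 2) l)
          ((Fin.cons x (Fin.cons y w : Fin (n + 1) → W) : Fin (n + 2) → W) l) := by
      intro i j x y hx hy
      funext l
      refine Fin.cases ?_ (fun l => Fin.cases ?_ (fun l => ?_) l) l
      · rw [Fin.cons_zero, Fin.cons_zero, Fin.cons_zero, proj_cast 𝒲 hx]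
      · rw [Fin.cons_succ, Fin.cons_succ, Fin.cons_succ, Fin.cons_zero, Fin.cons_zero,
          Fin.cons_zero, proj_cast 𝒲 hy]
      · simp only [Fin.cons_succ]
    rw [e i j x y hx hy, koszulAct_tprod, e j i y x hy hx]
    have hs := koszulSign_swap (0 : Fin (n + 1))
      (Fin.cons (i : ZMod 2) (Fin.cons (j : ZMod 2) ε : Fin (n + 1) → ZMod 2) : Fin (n + 2) → ZMod 2)
    have h0 : (Equiv.swap (Fin.castSucc (0 : Fin (n + 1))) (Fin.succ 0)) = headSwap n := rfl
    rw [h0] at hs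
    rw [hs]
    congr 1
    · have h1 : (Fin.castSucc (0 : Fin (n + 1))) = 0 := rfl
      rw [h1, Fin.cons_zero, Fin.cons_succ, Fin.cons_zero, sg_eq_ite]
      have hi : ∀ i : ℤ, (i : ZMod 2) = 1 ↔ ¬ Even i := fun i => by
        rw [← not_iff_not, not_not, ← ne_eq, zmod_two_ne_one, ZMod.intCast_zmod_eq_zero_iff_dvd,
          even_iff_two_dvd]
        rfl
      simp only [hi, Int.even_mul]
      by_cases hi : Even i <;> by_cases hj : Even j <;> simp [hi, hj]
    · congr 1
      funext l
      refine Fin.cases ?_ (fun l => Fin.cases ?_ (fun l => ?_) l) l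
      · have : (headSwap n).symm 0 = Fin.succ 0 := Equiv.swap_apply_left _ _
        rw [this]
        rfl
      · have : (headSwap n).symm (Fin.succ 0) = 0 := Equiv.swap_apply_right _ _
        rw [this]
        rfl
      · have : (headSwap n).symm l.succ.succ = l.succ.succ := Equiv.swap_apply_of_ne_of_ne
          (Fin.succ_ne_zero _) fun h => Fin.succ_ne_zero _ (Fin.succ_injective _ h)
        rw [this]
        rfl
  exact LinearMap.congr_fun this t

end ConsTensor

/-! ## The square of the Chevalley–Eilenberg differential -/

section SquareZero

variable {k : Type u} [Field k] {W : Type v} [AddCommGroup W] [Module k W] {𝒲 : Grading k W}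
  {b : W →ₗ[k] W →ₗ[k] W}

variable (𝒲 b) in
/-- A graded symmetric operation of degree one that satisfies the Jacobi identity. -/
structure IsShiftedLie : Prop where
  mem : ∀ {i j : ℤ} {x y : W}, x ∈ 𝒲.deg i → y ∈ 𝒲.deg j → b x y ∈ 𝒲.deg (i + j + 1)
  symm : ∀ {i j : ℤ} {x y : W}, x ∈ 𝒲.deg i → y ∈ 𝒲.deg j → b y x = sg k (i * j) • b x y
  jacobi : ∀ {i j l : ℤ} {x y z : W}, x ∈ 𝒲.deg i → y ∈ 𝒲.deg j → z ∈ 𝒲.deg l →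
    b (b x y) z + sg k (i * (j + l)) • b (b y z) x + sg k (l * (i + j)) • b (b z x) y = 0

namespace IsShiftedLie

theorem mergeFirst_succPerm (hb : IsShiftedLie 𝒲 b) {n : ℕ} (σ : Equiv.Perm (Fin n))
    (t : ⨂[k] _ : Fin (n + 2), W) :
    mergeFirst b n (koszulRep 𝒲 (n + 2) (succPerm (succPerm σ)) t) =
      koszulRep 𝒲 (n + 1) (succPerm σ) (mergeFirst b n t) := by
  have : mergeFirst b n ∘ₗ koszulRep 𝒲 (n + 2) (succPerm (succPerm σ)) =
      koszulRep 𝒲 (n + 1) (succPerm σ) ∘ₗ mergeFirst b n :=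
    consTensor_ext₂ 𝒲 fun i x hx j y hy t => by
      rw [LinearMap.comp_apply, LinearMap.comp_apply, koszulRep_succPerm 𝒲 _ hx,
        koszulRep_succPerm 𝒲 _ hy, mergeFirst_consTensor, mergeFirst_consTensor,
        koszulRep_succPerm 𝒲 _ (hb.mem hx hy)]
  exact LinearMap.congr_fun this t

theorem mergeFirst_headSwap (hb : IsShiftedLie 𝒲 b) {n : ℕ} (t : ⨂[k] _ : Fin (n + 2), W) :
    mergeFirst b n (koszulRep 𝒲 (n + 2) (headSwap n) t) = mergeFirst b n t := by
  have : mergeFirst b n ∘ₗ koszulRep 𝒲 (n + 2) (headSwap n) = mergeFirst b n :=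
    consTensor_ext₂ 𝒲 fun i x hx j y hy t => by
      rw [LinearMap.comp_apply, koszulRep_headSwap 𝒲 hx hy, map_smul, mergeFirst_consTensor,
        mergeFirst_consTensor, hb.symm hx hy, map_smul, LinearMap.smul_apply, smul_smul,
        sg_mul_self, one_smul]
  exact LinearMap.congr_fun this t

/-- The three terms of the Jacobi identity are one iterated merge preceded by cyclic permutations of
the first three factors, whose Koszul signs are those in the identity. -/
theorem mergeFirst_jacobi (hb : IsShiftedLie 𝒲 b) {n : ℕ} (t : ⨂[k] _ : Fin (n + 3), W) :
    mergeFirst b n (mergeFirst b (n + 1) t) +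
      mergeFirst b n (mergeFirst b (n + 1) (koszulRep 𝒲 (n + 3) (succPerm (headSwap n))
        (koszulRep 𝒲 (n + 3) (headSwap (n + 1)) t))) +
      mergeFirst b n (mergeFirst b (n + 1) (koszulRep 𝒲 (n + 3) (headSwap (n + 1))
        (koszulRep 𝒲 (n + 3) (succPerm (headSwap n)) t))) = 0 := by
  have : mergeFirst b n ∘ₗ mergeFirst b (n + 1) +
      mergeFirst b n ∘ₗ mergeFirst b (n + 1) ∘ₗ koszulRep 𝒲 (n + 3) (succPerm (headSwap n)) ∘ₗ
        koszulRep 𝒲 (n + 3) (headSwap (n + 1)) +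
      mergeFirst b n ∘ₗ mergeFirst b (n + 1) ∘ₗ koszulRep 𝒲 (n + 3) (headSwap (n + 1)) ∘ₗ
        koszulRep 𝒲 (n + 3) (succPerm (headSwap n)) = 0 :=
    consTensor_ext₃ 𝒲 fun i x hx j y hy l z hz t => by
      have h := congrArg (fun u => consTensor k W n u t) (hb.jacobi hx hy hz)
      simp only [map_add, map_smul, map_zero, LinearMap.add_apply, LinearMap.smul_apply,
        LinearMap.zero_apply] at h
      simp only [LinearMap.comp_apply, LinearMap.add_apply, LinearMap.zero_apply]
      rw [koszulRep_headSwap 𝒲 hx hy, koszulRep_succPerm 𝒲 _ hx, map_smul,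
        koszulRep_succPerm 𝒲 _ hy, koszulRep_headSwap 𝒲 hx hz, koszulRep_headSwap 𝒲 hy hz]
      simp only [map_smul]
      rw [koszulRep_headSwap 𝒲 hx hz]
      simp only [map_smul, mergeFirst_consTensor, smul_smul]
      rw [← h, mul_add, mul_add, sg_add, sg_add, mul_comm l i, mul_comm l j,
        mul_comm (sg k (i * l)) (sg k (j * l))]
  exact LinearMap.congr_fun this t

/-- Merges the third and fourth factors and then the first and second ones. -/
def doubleMerge (𝒲 : Grading k W) (b : W →ₗ[k] W →ₗ[k] W) (n : ℕ) :
    (⨂[k] _ : Fin (n + 4), W) →ₗ[k] (⨂[k] _ : Fin (n + 2), W) :=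
  mergeFirst b (n + 1) ∘ₗ koszulRep 𝒲 (n + 3) (succPerm (headSwap n)) ∘ₗ
    koszulRep 𝒲 (n + 3) (headSwap (n + 1)) ∘ₗ mergeFirst b (n + 2)

theorem doubleMerge_consTensor (hb : IsShiftedLie 𝒲 b) {n : ℕ} {i j l m : ℤ} {x y z w : W}
    (hx : x ∈ 𝒲.deg i) (hy : y ∈ 𝒲.deg j) (hz : z ∈ 𝒲.deg l) (hw : w ∈ 𝒲.deg m)
    (t : ⨂[k] _ : Fin n, W) :
    doubleMerge 𝒲 b n (consTensor k W (n + 3) x (consTensor k W (n + 2) y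
      (consTensor k W (n + 1) z (consTensor k W n w t)))) =
      sg k ((i + j + 1) * (l + m)) • consTensor k W (n + 1) (b z w) (consTensor k W n (b x y) t) := by
  simp only [doubleMerge, LinearMap.comp_apply]
  rw [mergeFirst_consTensor, koszulRep_headSwap 𝒲 (hb.mem hx hy) hz, map_smul,
    koszulRep_succPerm 𝒲 _ hz, koszulRep_headSwap 𝒲 (hb.mem hx hy) hw, map_smul, map_smul,
    map_smul, mergeFirst_consTensor, smul_smul, ← sg_add, ← mul_add]

/-- Two operations of degree one on disjoint pairs anticommute. The four transpositions on the right
exchange the first pair of factors with the second. -/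
theorem headSwap_doubleMerge (hb : IsShiftedLie 𝒲 b) {n : ℕ} (t : ⨂[k] _ : Fin (n + 4), W) :
    koszulRep 𝒲 (n + 2) (headSwap n) (doubleMerge 𝒲 b n t) =
      -doubleMerge 𝒲 b n (koszulRep 𝒲 (n + 4) (succPerm (headSwap (n + 1)))
        (koszulRep 𝒲 (n + 4) (succPerm (succPerm (headSwap n)))
          (koszulRep 𝒲 (n + 4) (headSwap (n + 2))
            (koszulRep 𝒲 (n + 4) (succPerm (headSwap (n + 1))) t)))) := by
  have : koszulRep 𝒲 (n + 2) (headSwap n) ∘ₗ doubleMerge 𝒲 b n =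
      -(doubleMerge 𝒲 b n ∘ₗ koszulRep 𝒲 (n + 4) (succPerm (headSwap (n + 1))) ∘ₗ
        koszulRep 𝒲 (n + 4) (succPerm (succPerm (headSwap n))) ∘ₗ
          koszulRep 𝒲 (n + 4) (headSwap (n + 2)) ∘ₗ
            koszulRep 𝒲 (n + 4) (succPerm (headSwap (n + 1)))) :=
    consTensor_ext₄ 𝒲 fun i x hx j y hy l z hz m w hw t => by
      simp only [LinearMap.comp_apply, LinearMap.neg_apply]
      rw [doubleMerge_consTensor hb hx hy hz hw, map_smul,
        koszulRep_headSwap 𝒲 (hb.mem hz hw) (hb.mem hx hy), koszulRep_succPerm 𝒲 _ hx,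
        koszulRep_headSwap 𝒲 hy hz]
      simp only [map_smul]
      rw [koszulRep_headSwap 𝒲 hx hz]
      simp only [map_smul]
      rw [koszulRep_succPerm 𝒲 _ hz, koszulRep_succPerm 𝒲 _ hx, koszulRep_headSwap 𝒲 hy hw]
      simp only [map_smul]
      rw [koszulRep_succPerm 𝒲 _ hz, koszulRep_headSwap 𝒲 hx hw]
      simp only [map_smul]
      rw [doubleMerge_consTensor hb hz hw hx hy]
      simp only [smul_smul, ← sg_add]
      rw [← neg_smul]
      congr 1
      rw [sg_eq_ite, sg_eq_ite]
      simp only [Int.even_add, Int.even_mul]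
      by_cases h1 : Even i <;> by_cases h2 : Even j <;> by_cases h3 : Even l <;>
        by_cases h4 : Even m <;> simp [h1, h2, h3, h4]
  exact LinearMap.congr_fun this t

variable {M : Type*} [AddCommGroup M] [Module k M]

/-- Two merges with the permutation `τ` in between. -/
def twice (𝒲 : Grading k W) (b : W →ₗ[k] W →ₗ[k] W) {n : ℕ} (c : (⨂[k] _ : Fin (n + 1), W) →ₗ[k] M)
    (t : ⨂[k] _ : Fin (n + 3), W) (τ : Equiv.Perm (Fin (n + 2))) : M :=
  ∑ σ, c (mergeFirst b n (koszulRep 𝒲 (n + 2) τ (mergeFirst b (n + 1) (koszulRep 𝒲 (n + 3) σ t))))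

section Twice

variable {n : ℕ} {c : (⨂[k] _ : Fin (n + 1), W) →ₗ[k] M}

/-- A permutation that fixes the merged factor can be performed before the merge, where the sum over
all permutations absorbs it. Hence only the position `τ 0` of the merged factor matters. -/
theorem twice_mul_succPerm (hb : IsShiftedLie 𝒲 b) (t : ⨂[k] _ : Fin (n + 3), W)
    (τ : Equiv.Perm (Fin (n + 2))) (σ : Equiv.Perm (Fin (n + 1))) :
    twice 𝒲 b c t (τ * succPerm σ) = twice 𝒲 b c t τ := by
  refine Fintype.sum_equiv (Equiv.mulLeft (succPerm (succPerm σ))) _ _ fun ρ => ?_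
  rw [map_mul, Module.End.mul_apply, ← mergeFirst_succPerm hb, Equiv.coe_mulLeft,
    map_mul (koszulRep 𝒲 (n + 3)), Module.End.mul_apply]

theorem twice_congr (hb : IsShiftedLie 𝒲 b) (t : ⨂[k] _ : Fin (n + 3), W)
    {τ τ' : Equiv.Perm (Fin (n + 2))} (h : τ 0 = τ' 0) :
    twice 𝒲 b c t τ = twice 𝒲 b c t τ' := by
  obtain ⟨σ, hσ⟩ : ∃ σ, τ'⁻¹ * τ = succPerm σ := exists_succPerm (by
    rw [Equiv.Perm.mul_apply, h]; exact τ'.symm_apply_apply 0)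
  rw [← mul_inv_cancel_left τ' τ, hσ, twice_mul_succPerm hb]

/-- A permutation that fixes the two factors to be merged becomes a permutation of the result, which
`c` does not see. -/
theorem twice_succPerm_mul (hb : IsShiftedLie 𝒲 b) (hc : ∀ σ t, c (koszulRep 𝒲 (n + 1) σ t) = c t)
    (t : ⨂[k] _ : Fin (n + 3), W) (τ : Equiv.Perm (Fin (n + 2))) (σ : Equiv.Perm (Fin n)) :
    twice 𝒲 b c t (succPerm (succPerm σ) * τ) = twice 𝒲 b c t τ :=
  Finset.sum_congr rfl fun ρ _ => by
    rw [map_mul, Module.End.mul_apply, mergeFirst_succPerm hb, hc]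

theorem twice_headSwap_mul (hb : IsShiftedLie 𝒲 b) (t : ⨂[k] _ : Fin (n + 3), W)
    (τ : Equiv.Perm (Fin (n + 2))) : twice 𝒲 b c t (headSwap n * τ) = twice 𝒲 b c t τ :=
  Finset.sum_congr rfl fun ρ _ => by
    rw [map_mul, Module.End.mul_apply, mergeFirst_headSwap hb]

/-- The sum over all permutations is invariant under translation, so the three Jacobi terms
contribute equally and three times the sum is zero. -/
theorem twice_one [CharZero k] (hb : IsShiftedLie 𝒲 b) (t : ⨂[k] _ : Fin (n + 3), W) :
    twice 𝒲 b c t 1 = 0 := by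
  have key : ∀ π : Equiv.Perm (Fin (n + 3)), ∑ σ, c (mergeFirst b n (mergeFirst b (n + 1)
      (koszulRep 𝒲 (n + 3) π (koszulRep 𝒲 (n + 3) σ t)))) = twice 𝒲 b c t 1 := fun π =>
    Fintype.sum_equiv (Equiv.mulLeft π) _ _ fun ρ => by
      rw [map_one, Module.End.one_apply, Equiv.coe_mulLeft, map_mul, Module.End.mul_apply]
  have h : ∑ σ, c (mergeFirst b n (mergeFirst b (n + 1) (koszulRep 𝒲 (n + 3) σ t)) +
      mergeFirst b n (mergeFirst b (n + 1) (koszulRep 𝒲 (n + 3) (succPerm (headSwap n))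
        (koszulRep 𝒲 (n + 3) (headSwap (n + 1)) (koszulRep 𝒲 (n + 3) σ t)))) +
      mergeFirst b n (mergeFirst b (n + 1) (koszulRep 𝒲 (n + 3) (headSwap (n + 1))
        (koszulRep 𝒲 (n + 3) (succPerm (headSwap n)) (koszulRep 𝒲 (n + 3) σ t))))) = 0 :=
    Finset.sum_eq_zero fun σ _ => by rw [mergeFirst_jacobi hb, map_zero]
  simp only [map_add, Finset.sum_add_distrib] at h
  have h1 := key 1
  have h2 := key (succPerm (headSwap n) * headSwap (n + 1))
  have h3 := key (headSwap (n + 1) * succPerm (headSwap n))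
  simp only [map_mul, Module.End.mul_apply, map_one, Module.End.one_apply] at h1 h2 h3
  have h3s : (3 : k) • twice 𝒲 b c t 1 = 0 := by
    rw [h1, h2, h3] at h
    rw [← h]
    module
  exact (smul_eq_zero.1 h3s).resolve_left three_ne_zero

end Twice

/-- Exchanging the two disjoint pairs only translates the summation variable, but it changes the
sign, so the sum equals its own negative. -/
theorem twice_disjoint [CharZero k] (hb : IsShiftedLie 𝒲 b) {n : ℕ}
    {c : (⨂[k] _ : Fin (n + 2), W) →ₗ[k] M} (hc : ∀ σ t, c (koszulRep 𝒲 (n + 2) σ t) = c t)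
    (t : ⨂[k] _ : Fin (n + 4), W) :
    twice 𝒲 b c t (succPerm (headSwap n) * headSwap (n + 1)) = 0 := by
  have h0 : twice 𝒲 b c t (succPerm (headSwap n) * headSwap (n + 1)) =
      ∑ σ, c (doubleMerge 𝒲 b n (koszulRep 𝒲 (n + 4) σ t)) :=
    Finset.sum_congr rfl fun σ _ => by rw [map_mul]; rfl
  have h1 : ∑ σ, c (doubleMerge 𝒲 b n (koszulRep 𝒲 (n + 4) σ t)) =
      -∑ σ, c (doubleMerge 𝒲 b n (koszulRep 𝒲 (n + 4) σ t)) := by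
    rw [← Finset.sum_neg_distrib]
    refine Fintype.sum_equiv (Equiv.mulLeft (succPerm (headSwap (n + 1)) *
      (succPerm (succPerm (headSwap n)) * (headSwap (n + 2) * succPerm (headSwap (n + 1)))))) _ _
      fun σ => ?_
    rw [← hc (headSwap n), headSwap_doubleMerge hb, map_neg, Equiv.coe_mulLeft]
    simp only [map_mul, Module.End.mul_apply]
  rw [h0]
  have h2 := eq_neg_iff_add_eq_zero.1 h1
  rw [← two_smul k] at h2
  exact (smul_eq_zero.1 h2).resolve_left two_ne_zero

/-- If the merged factor goes to one of the first two positions, it is merged again and the Jacobi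
identity applies. Otherwise the second merge involves two other factors, and all further positions
are equivalent to the third. -/
theorem twice_eq_zero [CharZero k] (hb : IsShiftedLie 𝒲 b) {n : ℕ}
    {c : (⨂[k] _ : Fin (n + 1), W) →ₗ[k] M} (hc : ∀ σ t, c (koszulRep 𝒲 (n + 1) σ t) = c t)
    (t : ⨂[k] _ : Fin (n + 3), W) (τ : Equiv.Perm (Fin (n + 2))) : twice 𝒲 b c t τ = 0 := by
  obtain ⟨p, hp⟩ : ∃ p, τ 0 = p := ⟨_, rfl⟩
  induction p using Fin.cases with
  | zero => rw [twice_congr hb t (hp.trans (Equiv.Perm.one_apply 0).symm), twice_one hb]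
  | succ p =>
    induction p using Fin.cases with
    | zero =>
      rw [twice_congr (τ' := headSwap n * 1) hb t
        (hp.trans (Equiv.swap_apply_left (0 : Fin (n + 2)) 1).symm),
        twice_headSwap_mul hb, twice_one hb]
    | succ p =>
      -- A position beyond the second exists only if there are at least four factors.
      obtain ⟨n, rfl⟩ : ∃ m, n = m + 1 := ⟨n - 1, by have := p.2; omega⟩
      rw [twice_congr (τ' := succPerm (succPerm (Equiv.swap 0 p)) *
        (succPerm (headSwap n) * headSwap (n + 1))) hb t, twice_succPerm_mul hb hc,
        twice_disjoint hb hc]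
      have h1 : headSwap (n + 1) 0 = Fin.succ 0 := Equiv.swap_apply_left _ _
      have h2 : headSwap n 0 = Fin.succ 0 := Equiv.swap_apply_left _ _
      rw [hp, Equiv.Perm.mul_apply, Equiv.Perm.mul_apply, h1, succPerm_succ, h2, succPerm_succ,
        succPerm_succ, Equiv.swap_apply_left]

end IsShiftedLie

namespace PreLieSq

variable {V : Type v} [AddCommGroup V] [Module k V] {𝒱 : Grading k V} (A : PreLieSq 𝒱)

theorem isShiftedLie : IsShiftedLie (shiftedDouble 𝒱) A.dbl where
  mem := A.dbl_mem
  symm := A.dbl_swap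
  jacobi := A.jac_eq_zero

/-- After the two sums are interchanged, the inner sum is `twice` for each fixed permutation between
the two merges. -/
theorem dCE_comp_dCE [CharZero k] (n : ℕ) : A.dCE n ∘ₗ A.dCE (n + 1) = 0 := by
  refine LinearMap.ext fun x => ?_
  obtain ⟨t, rfl⟩ := A.toCE_surjective _ x
  rw [LinearMap.comp_apply, dCE_toCE, map_smul, map_sum]
  simp only [dCE_toCE]
  rw [← Finset.smul_sum, Finset.sum_comm, Finset.sum_eq_zero, smul_zero, smul_zero,
    LinearMap.zero_apply]
  intro τ _
  exact A.isShiftedLie.twice_eq_zero (c := A.toCE (n + 1)) (fun σ t => A.toCE_koszulRep σ t) t τ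

theorem dJ_comp_dJ [CharZero k] (n : ℕ) : A.dJ n ∘ₗ A.dJ (n + 1) = 0 := by
  refine LinearMap.ext fun x => ?_
  obtain ⟨x, rfl⟩ := Submodule.mkQ_surjective _ x
  have h := LinearMap.congr_fun (A.dCE_comp_dCE n) x
  rw [LinearMap.comp_apply, LinearMap.zero_apply] at h
  exact (congrArg (Submodule.mkQ _) h).trans (map_zero _)

/-- Transported along the isomorphism; no direct computation with the cooperad is needed. -/
theorem dC_comp_dC [CharZero k] (n : ℕ) : A.dC n ∘ₗ A.dC (n + 1) = 0 := by
  refine LinearMap.ext fun x => ?_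
  obtain ⟨x, rfl⟩ := (A.compareEquiv (n + 3)).surjective x
  have h := LinearMap.congr_fun (A.dJ_comp_dJ n) x
  rw [LinearMap.comp_apply, LinearMap.zero_apply] at h
  rw [LinearMap.comp_apply, ← compareEquiv_dJ, ← compareEquiv_dJ, h, map_zero,
    LinearMap.zero_apply]

end PreLieSq

end SquareZero

end PreLieTwo

end

open PreLieTwo in
theorem proposition3p5p1 {k V : Type*} [Field k] [CharZero k] [AddCommGroup V] [Module k V]
    (𝒱 : Grading k V) (A : PreLieSq 𝒱) :
    (∀ n, A.dCE n ∘ₗ A.dCE (n + 1) = 0) ∧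
    (∀ n, A.dJ n ∘ₗ A.dJ (n + 1) = 0) ∧
    (∀ n, A.dC n ∘ₗ A.dC (n + 1) = 0) ∧
    ∃ Φ : ∀ n, A.J n ≃ₗ[k] A.C n,
      (∀ n (x : A.J (n + 2)), Φ (n + 1) (A.dJ n x) = A.dC n (Φ (n + 2) x)) ∧
      ∀ n m, (A.degJ n m).map (Φ n).toLinearMap = A.degC n (m - 1) :=
  ⟨A.dCE_comp_dCE, A.dJ_comp_dJ, A.dC_comp_dC, A.compareEquiv, A.compareEquiv_dJ, A.map_degJ⟩
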